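/- **Polling model.** Consider a polling system with $M\ge 1$ queues $Q_1,\dots,Q_M$ of unlimited length, visited cyclically by one server. Jobs arrive to $Q_m$ according to independent Poisson processes with rates $\lambda_m>0$; service times at $Q_m$ are exponential with mean $b_m>0$; the switch-over time $C^{m}\ge 0$ from $Q_m$ to the next queue has a general distribution; initial queue lengths, arrivals, service times and switch-over times are all independent. Indices are read cyclically, so $Q_0=Q_M$. Assume $\lambda_m b_m<1$ for all $m$ (which stability of the system implies). Under the $k$-limited discipline the server leaves a queue as soon as it is empty or $k$ jobs have been served in the visit, whichever occurs first (it leaves an empty queue immediately); under the exhaustive discipline it leaves as soon as the queue is empty. Write $\mathbf z^{\mathbf n}=\prod_m z_m^{n_m}$ with $\mathbf z\in\mathbb C^M$, $|z_m|\le 1$ for all $m$, and let $\mathbf N_i^b,\mathbf N_i^e$ be the vectors of queue lengths at the beginning and the end of a visit to $Q_i$. Let $C^{i}(\mathbf z)$ be the joint p.g.f. of the numbers of Poisson arrivals to the $M$ queues during $C^{i}$. **Claim.** Fix $i$ and such a $\mathbf z$, and put $s_i^*=\lambda_i+1/b_i+\sum_{m\ne i}\lambda_m(1-z_m)$. 1.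 The polynomial $\lambda_i y^2-s_i^*y+1/b_i$ has exactly one root $y_{1i}$ with $|y_{1i}|\le 1$. Put $\mathbf z_i^*=(z_1,\dots,z_{i-1},y_{1i},z_{i+1},\dots,z_M)$. Under the exhaustive discipline every visit ends almost surely. 2. ($k\to\infty$ for the truncated queue.) Let $L\ge 2$ and suppose that $Q_i$ holds at most $L-1$ jobs, arrivals to a full $Q_i$ being lost. Let $\mathbf D$ be the $(L-1)\times(L-1)$ matrix on the states $1,\dots,L-1$ with superdiagonal entries $\lambda_i$ and diagonal entries $-s_i^*$, except that the last diagonal entry is $-(s_i^*-\lambda_i)$, and let $\mathbf U$ be the matrix with entries $1/b_i$ on the subdiagonal and zeros elsewhere. Then $\mathbf D+\mathbf U$ is invertible, and for a visit to $Q_i$ starting from queue lengths $\mathbf x$ with $1\le x_i\le L-1$, the $k$-limited p.g.f. $\mathbb E_L[\mathbf z^{\mathbf N_i^e}\mid \mathbf N_i^b=\mathbf x]$ converges, as $k\to\infty$, to the exhaustive one, which equals $$-\frac1{b_i}\Big(\prod_{m\ne i}z_m^{x_m}\Big)\,e_{x_i}(\mathbf D+\mathbf U)^{-1}e_1^{T}.$$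 3. ($L\to\infty$.) For every $\mathbf x$, the truncated exhaustive p.g.f. converges, as $L\to\infty$, to $y_{1i}^{x_i}\prod_{m\ne i}z_m^{x_m}$. This is also the exhaustive p.g.f. $\mathbb E[\mathbf z^{\mathbf N_i^e}\mid\mathbf N_i^b=\mathbf x]$ of the unlimited queue, and the limit of the $k$-limited p.g.f. of the unlimited queue as $k\to\infty$. The formula for $\mathbb E[\mathbf z^{\mathbf N_i^e}\mid\mathbf N_i^b=\mathbf x]$ holds at every visit to $Q_i$ in the exhaustive system and every $\mathbf x$ with $\mathbb P(\mathbf N_i^b=\mathbf x)>0$. 4. For every visit (to $Q_i$, say), the p.g.f. of the queue lengths at the end of this visit in the $k$-limited system converges, as $k\to\infty$, to the p.g.f. in the exhaustive system with the same initial law. In the exhaustive system, the p.g.f.s $\beta$ and $\gamma$ of the queue lengths at the beginning and the end of this visit satisfy $\gamma(\mathbf z)=\beta(\mathbf z_i^*)$; if this is not the first visit, and $\gamma'$ is the p.g.f. at the end of the preceding visit (to $Q_{i-1}$), then $\gamma(\mathbf z)=\gamma'(\mathbf z_i^*)\,C^{i-1}(\mathbf z_i^*)$. 5. If the exhaustive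 system has a steady state, i.e. for each $j$ the queue lengths at the beginnings and at the ends of successive visits to $Q_j$ converge in law to probability distributions, with p.g.f.s $\beta_j^E$ and $\gamma_j^E$, then $$\gamma_i^E(\mathbf z)=\beta_i^E(\mathbf z_i^*),\qquad \gamma_i^E(\mathbf z)=\gamma_{i-1}^E(\mathbf z_i^*)\,C^{i-1}(\mathbf z_i^*).$$ -/

import Mathlib

open MeasureTheory ProbabilityTheory Filter Topology
open scoped NNReal ENNReal

noncomputable section

namespace Polling

/-! ### Poisson processes and generating functions -/

/-- `A` is a Poisson process of rate `r` on `[0, ∞)`: a counting process with right-continuous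
nondecreasing paths started at `0`, with independent increments, the number of points in
`(t, t + h]` being Poisson distributed with parameter `r * h`. -/
structure IsPoissonProcess {Ω : Type*} [MeasurableSpace Ω] (P : Measure Ω)
    (A : ℝ≥0 → Ω → ℕ) (r : ℝ≥0) : Prop where
  measurable : ∀ t, Measurable (A t)
  zero : ∀ ω, A 0 ω = 0
  monotone : ∀ ω, Monotone (fun t => A t ω)
  right_continuous : ∀ ω t, ContinuousWithinAt (fun u => A u ω) (Set.Ici t) t
  indep_increments : HasIndepIncrements A P
  law_increment : ∀ t h, P.map (fun ω => A (t + h) ω - A t ω) = poissonMeasure (r * h)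

/-- The monomial `∏ₘ zₘ ^ nₘ`. -/
def monomial {M : ℕ} (z : Fin M → ℂ) (n : Fin M → ℕ) : ℂ := ∏ m, z m ^ n m

/-- The joint probability generating function of a law on queue-length vectors. -/
def pgf {M : ℕ} (μ : Measure (Fin M → ℕ)) (z : Fin M → ℂ) : ℂ := ∫ n, monomial z n ∂μ

/-- The p.g.f. of the vector of numbers of Poisson arrivals (rates `lam m`, independent streams)
during an independent random time with law `C`. -/
def arrivalsPgf {M : ℕ} (lam : Fin M → ℝ≥0) (C : Measure ℝ≥0) (z : Fin M → ℂ) : ℂ :=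
  ∫ t, pgf (Measure.pi fun m => poissonMeasure (lam m * t)) z ∂C

/-! ### One visit of the server

The dynamics below are deterministic functions of the cumulative arrival counts `a m t`
(number of arrivals to queue `m` in `[0, t]`), the service times and the initial queue lengths. -/

/-- The instant of the `n`-th departure of a visit starting at time `τ`, if the server is
permanently busy with the successive service times `s 0, s 1, …`. -/
def departureTime (τ : ℝ≥0) (s : ℕ → ℝ≥0) (n : ℕ) : ℝ≥0 := τ + ∑ l ∈ Finset.range n, s l

/-- The queue lengths just after the `n`-th departure of a visit to queue `i` that starts at time
`τ` with queue lengths `x`. Queue `i` holds at most `cap` jobs (including the one in service), and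
arrivals to queue `i` that find `cap` jobs are lost; `cap = ⊤` is the queue of unlimited length.
Only the values up to the end of the visit are meaningful. -/
def lengthsAfter {M : ℕ} (cap : ℕ∞) (a : Fin M → ℝ≥0 → ℕ) (i : Fin M) (τ : ℝ≥0) (s : ℕ → ℝ≥0)
    (x : Fin M → ℕ) : ℕ → Fin M → ℕ
  | 0 => x
  | n + 1 => fun m =>
      let y := lengthsAfter cap a i τ s x n m +
        (a m (departureTime τ s (n + 1)) - a m (departureTime τ s n))
      if m = i then (min (y : ℕ∞) cap).toNat - 1 else y

/-- The number of jobs served in a visit under the `k`-limited discipline: the server leaves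
as soon as queue `i` is empty or `k` jobs have been served, whichever occurs first.
The exhaustive discipline is `k = ⊤`. (It is `0` by convention if the visit never ends.) -/
def jobsServed {M : ℕ} (k cap : ℕ∞) (a : Fin M → ℝ≥0 → ℕ) (i : Fin M) (τ : ℝ≥0) (s : ℕ → ℝ≥0)
    (x : Fin M → ℕ) : ℕ :=
  sInf {n : ℕ | lengthsAfter cap a i τ s x n i = 0 ∨ (n : ℕ∞) = k}

/-- The time at which the visit ends, and the queue lengths at that time. -/
def visitEnd {M : ℕ} (k cap : ℕ∞) (a : Fin M → ℝ≥0 → ℕ) (i : Fin M) (τ : ℝ≥0) (s : ℕ → ℝ≥0)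
    (x : Fin M → ℕ) : ℝ≥0 × (Fin M → ℕ) :=
  (departureTime τ s (jobsServed k cap a i τ s x),
    lengthsAfter cap a i τ s x (jobsServed k cap a i τ s x))

/-! ### The polling system -/

/-- The queue visited in the `v`-th visit, `v = 0, 1, …`, of a server that goes round the queues
cyclically, starting with queue `first`. -/
def queueOf {M : ℕ} [NeZero M] (first : Fin M) (v : ℕ) : Fin M := first + Fin.ofNat M v

/-- The time at which the `v`-th visit begins, and the queue lengths at that time. The system
starts at time `0` with queue lengths `x` and the server arriving at queue `first`; `s v` are the
service times in visit `v`, and `c v` is the switch-over time after visit `v`. -/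
def visitBegin {M : ℕ} [NeZero M] (k : ℕ∞) (first : Fin M) (a : Fin M → ℝ≥0 → ℕ)
    (s : ℕ → ℕ → ℝ≥0) (c : ℕ → ℝ≥0) (x : Fin M → ℕ) : ℕ → ℝ≥0 × (Fin M → ℕ)
  | 0 => (0, x)
  | v + 1 =>
      let p := visitBegin k first a s c x v
      let e := visitEnd k ⊤ a (queueOf first v) p.1 (s v) p.2
      (e.1 + c v, fun m => e.2 m + (a m (e.1 + c v) - a m e.1))

/-- The primitive sources of randomness of a polling system. -/
inductive Source (M : ℕ) : Type
  | initialLengths : Source M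
  | arrivals (m : Fin M) : Source M
  | service (v n : ℕ) : Source M
  | switchover (v : ℕ) : Source M

/-- The σ-algebra generated by each source of randomness. -/
@[reducible] def sourceSigma {M : ℕ} {Ω : Type*} (N0 : Ω → Fin M → ℕ) (A : Fin M → ℝ≥0 → Ω → ℕ)
    (B : ℕ → ℕ → Ω → ℝ≥0) (S : ℕ → Ω → ℝ≥0) : Source M → MeasurableSpace Ω
  | .initialLengths => MeasurableSpace.comap N0 inferInstance
  | .arrivals m => ⨆ t, MeasurableSpace.comap (A m t) inferInstance
  | .service v n => MeasurableSpace.comap (B v n) inferInstance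
  | .switchover v => MeasurableSpace.comap (S v) inferInstance

/-- The stochastic input of a polling system: initial queue lengths `N0` (of arbitrary law),
Poisson arrivals to queue `m` with rate `lam m`, exponential service times `B v n` with mean
`b i` (`n`-th service of visit `v`, a visit to queue `i`), switch-over times `S v` from
queue `i` to the next with law `C i`; all independent. -/
structure IsInput {M : ℕ} [NeZero M] {Ω : Type*} [MeasurableSpace Ω] (P : Measure Ω)
    (lam b : Fin M → ℝ≥0) (C : Fin M → Measure ℝ≥0) (first : Fin M)
    (N0 : Ω → Fin M → ℕ) (A : Fin M → ℝ≥0 → Ω → ℕ)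
    (B : ℕ → ℕ → Ω → ℝ≥0) (S : ℕ → Ω → ℝ≥0) : Prop where
  measurable_initial : Measurable N0
  poisson : ∀ m, IsPoissonProcess P (A m) (lam m)
  measurable_service : ∀ v n, Measurable (B v n)
  law_service : ∀ v n,
    P.map (fun ω => (B v n ω : ℝ)) = expMeasure (1 / (b (queueOf first v) : ℝ))
  measurable_switchover : ∀ v, Measurable (S v)
  law_switchover : ∀ v, P.map (S v) = C (queueOf first v)
  indep : iIndep (sourceSigma N0 A B S) P

/-- Queue lengths at the beginning of the `v`-th visit, under the `k`-limited discipline at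
every queue (`k = ⊤`: the exhaustive discipline). -/
def lengthsBegin {M : ℕ} [NeZero M] {Ω : Type*} (k : ℕ∞) (first : Fin M)
    (N0 : Ω → Fin M → ℕ) (A : Fin M → ℝ≥0 → Ω → ℕ) (B : ℕ → ℕ → Ω → ℝ≥0) (S : ℕ → Ω → ℝ≥0)
    (v : ℕ) (ω : Ω) : Fin M → ℕ :=
  (visitBegin k first (fun m t => A m t ω) (fun u n => B u n ω) (fun u => S u ω) (N0 ω) v).2

/-- Queue lengths at the end of the `v`-th visit, under the `k`-limited discipline at every
queue (`k = ⊤`: the exhaustive discipline). -/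
def lengthsEnd {M : ℕ} [NeZero M] {Ω : Type*} (k : ℕ∞) (first : Fin M)
    (N0 : Ω → Fin M → ℕ) (A : Fin M → ℝ≥0 → Ω → ℕ) (B : ℕ → ℕ → Ω → ℝ≥0) (S : ℕ → Ω → ℝ≥0)
    (v : ℕ) (ω : Ω) : Fin M → ℕ :=
  let a := fun m t => A m t ω
  let p := visitBegin k first a (fun u n => B u n ω) (fun u => S u ω) (N0 ω) v
  (visitEnd k ⊤ a (queueOf first v) p.1 (fun n => B v n ω) p.2).2

/-- `E[z ^ Nᵉ | Nᵇ = x]` for one visit, started at time `0`, to queue `first`, which holds at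
most `cap` jobs, under the `k`-limited discipline. -/
def visitPgf {M : ℕ} {Ω : Type*} [MeasurableSpace Ω] (P : Measure Ω) (k cap : ℕ∞) (first : Fin M)
    (A : Fin M → ℝ≥0 → Ω → ℕ) (B : ℕ → ℕ → Ω → ℝ≥0) (x : Fin M → ℕ) (z : Fin M → ℂ) : ℂ :=
  ∫ ω, monomial z (visitEnd k cap (fun m t => A m t ω) first 0 (fun n => B 0 n ω) x).2 ∂P

/-- The steady state of the system with exhaustive service: `β i` and `γ i` are the limits in law
of the queue lengths at the beginnings and at the ends of the successive visits to queue `i`. -/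
structure IsSteadyState {M : ℕ} [NeZero M] {Ω : Type*} [MeasurableSpace Ω] (P : Measure Ω)
    (first : Fin M) (N0 : Ω → Fin M → ℕ) (A : Fin M → ℝ≥0 → Ω → ℕ)
    (B : ℕ → ℕ → Ω → ℝ≥0) (S : ℕ → Ω → ℝ≥0) (β γ : Fin M → Measure (Fin M → ℕ)) : Prop where
  prob_begin : ∀ i, IsProbabilityMeasure (β i)
  prob_end : ∀ i, IsProbabilityMeasure (γ i)
  tendsto_begin : ∀ i x,
    Tendsto (fun v => P.real {ω | lengthsBegin ⊤ first N0 A B S v ω = x})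
      (atTop ⊓ 𝓟 {v | queueOf first v = i}) (𝓝 ((β i).real {x}))
  tendsto_end : ∀ i x,
    Tendsto (fun v => P.real {ω | lengthsEnd ⊤ first N0 A B S v ω = x})
      (atTop ⊓ 𝓟 {v | queueOf first v = i}) (𝓝 ((γ i).real {x}))

/-! ### The root and the matrices of the analysis -/

/-- `∑_{m ≠ i} λₘ (1 - zₘ)`. -/
def otherRate {M : ℕ} (lam : Fin M → ℝ≥0) (i : Fin M) (z : Fin M → ℂ) : ℂ :=
  ∑ m ∈ Finset.univ.erase i, ((lam m : ℝ) : ℂ) * (1 - z m)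

/-- `y` is a root in the closed unit disk of `λᵢ y² - s*ᵢ y + 1 / bᵢ`, where
`s*ᵢ = λᵢ + 1 / bᵢ + ∑_{m ≠ i} λₘ (1 - zₘ)`. -/
def IsSmallRoot {M : ℕ} (lam b : Fin M → ℝ≥0) (i : Fin M) (z : Fin M → ℂ) (y : ℂ) : Prop :=
  ‖y‖ ≤ 1 ∧
    ((lam i : ℝ) : ℂ) * y ^ 2
      - (((lam i : ℝ) : ℂ) + 1 / ((b i : ℝ) : ℂ) + otherRate lam i z) * y
      + 1 / ((b i : ℝ) : ℂ) = 0

/-- The matrix `D` on the states `1, …, K + 1` of queue `i` (index `r` stands for `r + 1` jobs),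
for a queue holding at most `K + 1` jobs: generator of the arrivals to queue `i`, minus
`∑_{m ≠ i} λₘ (1 - zₘ) + 1 / bᵢ` times the identity. -/
def matD {M : ℕ} (lam b : Fin M → ℝ≥0) (i : Fin M) (z : Fin M → ℂ) (K : ℕ) :
    Matrix (Fin (K + 1)) (Fin (K + 1)) ℂ :=
  Matrix.of fun r c =>
    if c = r then
      -(if r = Fin.last K then 0 else ((lam i : ℝ) : ℂ))
        - (otherRate lam i z + 1 / ((b i : ℝ) : ℂ))
    else if (c : ℕ) = r + 1 then ((lam i : ℝ) : ℂ) else 0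

/-- The matrix `U` of departures: entries `1 / bᵢ` just below the diagonal. -/
def matU {M : ℕ} (b : Fin M → ℝ≥0) (i : Fin M) (K : ℕ) :
    Matrix (Fin (K + 1)) (Fin (K + 1)) ℂ :=
  Matrix.of fun r c => if (r : ℕ) = c + 1 then 1 / ((b i : ℝ) : ℂ) else 0

end Polling

end

/-!
The proof rests on a regeneration property, on harmonic functions of the walk embedded at the
departures of a visit, and on pathwise limits.

*Regeneration.* `Renews P lam A D used T E` says that, on the event `E`, the numbers of arrivals in
successive intervals after the random time `T`, whose lengths are durations that have not been
used, are independent of `E` and of each other, and are distributed as Poisson arrivals during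
independent durations. It holds at time `0` (`IsInput.renews_initial`), as the arrivals have
independent stationary increments and are independent of the durations. It is preserved when the
next interval is appended and its arrivals are observed (`Renews.next`), when `T` is changed off
`E`, and under countable disjoint unions of events. Hence it passes from the beginning of an
exhaustive visit to its end (`renews_visitEnd`) and through a switch-over, so that it holds at the
beginning and at the end of every visit. This takes the place of the strong Markov property.

*Harmonic functions.* During a visit to queue `i`, a step of the walk adds the arrivals during an
exponential service time and removes one job from queue `i`; with a marker `zₘ` at the other
queues, `n` arrivals to queue `i` have weight `r λ ^ n / (r + λ + o) ^ (n + 1)`, where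
`r = 1 / bᵢ`, `λ = λᵢ` and `o = ∑_{m ≠ i} λₘ (1 - zₘ)` (`hasSum_arrivals_service`). The function
`markedFun z i f`, i.e. `w ↦ f wᵢ * ∏_{m ≠ i} zₘ ^ wₘ`, is therefore harmonic while queue `i` is
nonempty as soon as `f` solves a one-dimensional recursion. Bounded harmonic functions keep their mean up
to the end of the visit (`integral_visitEnd`), where `wᵢ = 0`.
- For the unlimited queue, `f j = y ^ j` is a solution because `y` is a root of the
  quadratic (`IsSmallRoot.hasSum_pow`).
- For the truncated queue, a vector `g` with `(D + U) g = -c r e₁`, extended by `f 0 = c`, is a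
  solution (`hasSum_extendVec`). With `c = 0` this shows that `D + U` is injective, hence
  invertible; with `c = 1` it gives the formula for the generating function.

*End of a visit.* With `y = (λ + r) / (2 λ) > 1`, the mean of `y ^ wᵢ` on the event that the visit
goes on decreases at least by the factor `4 λ r / (λ + r) ^ 2 < 1` at each step, so an exhaustive
visit ends almost surely; a truncated queue is never longer than the unlimited one.

*Limits.* Once a visit ends, its `k`-limited and truncated versions coincide with the exhaustive
unlimited one for all large `k` and `L`, so bounded convergence applies. In the steady state,
pointwise convergence of the masses implies convergence of the generating functions by Scheffé's
lemma, and the identities for the single visits pass to the limit.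
-/

noncomputable section

namespace Polling

/-! ### Right-continuous counting paths -/

/-- The value at time `t` of a nondecreasing right-continuous `ℕ`-valued path, recovered from the
values `r` of the path at rational times. -/
def evalPath (r : ℚ≥0 → ℕ) (t : ℝ≥0) : ℕ := sInf (r '' {q : ℚ≥0 | t < (q : ℝ≥0)})

theorem exists_nnrat_gt (t : ℝ≥0) : ∃ q : ℚ≥0, t < (q : ℝ≥0) := by
  obtain ⟨n, hn⟩ := exists_nat_gt t
  exact ⟨n, by simpa using hn⟩

theorem le_evalPath_iff (r : ℚ≥0 → ℕ) (t : ℝ≥0) (n : ℕ) :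
    n ≤ evalPath r t ↔ ∀ q : ℚ≥0, t < (q : ℝ≥0) → n ≤ r q := by
  have hne : (r '' {q : ℚ≥0 | t < (q : ℝ≥0)}).Nonempty := by
    obtain ⟨q, hq⟩ := exists_nnrat_gt t
    exact ⟨r q, q, hq, rfl⟩
  rw [evalPath, le_csInf_iff (OrderBot.bddBelow _) hne]
  simp

theorem measurable_evalPath :
    Measurable (fun p : (ℚ≥0 → ℕ) × ℝ≥0 => evalPath p.1 p.2) := by
  refine measurable_of_Ici fun n => ?_
  have : (fun p : (ℚ≥0 → ℕ) × ℝ≥0 => evalPath p.1 p.2) ⁻¹' Set.Ici n =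
      ⋂ q : ℚ≥0, ({p | (q : ℝ≥0) ≤ p.2} ∪ {p | n ≤ p.1 q}) := by
    ext p
    simp only [Set.mem_preimage, Set.mem_Ici, le_evalPath_iff, Set.mem_iInter, Set.mem_union,
      Set.mem_ofPred_eq]
    exact forall_congr' fun q => by rw [← not_lt, imp_iff_not_or, not_lt]
  rw [this]
  refine MeasurableSet.iInter fun q => ?_
  refine (measurableSet_le measurable_const measurable_snd).union ?_
  exact measurableSet_le measurable_const ((measurable_pi_apply q).comp measurable_fst)

section Paths

variable {Ω : Type*} [MeasurableSpace Ω] {P : Measure Ω} {A : ℝ≥0 → Ω → ℕ} {r : ℝ≥0}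

theorem IsPoissonProcess.evalPath_eq (h : IsPoissonProcess P A r) (t : ℝ≥0) (ω : Ω) :
    evalPath (fun q => A q ω) t = A t ω := by
  refine le_antisymm ?_ ((le_evalPath_iff _ _ _).2 fun q hq => h.monotone ω hq.le)
  have hev : ∀ᶠ u in 𝓝[≥] t, A u ω = A t ω :=
    (h.right_continuous ω t).eventually (eventually_of_mem (by simp) fun _ hx => hx)
      |>.mono fun u (hu : A u ω ∈ ({A t ω} : Set ℕ)) => hu
  obtain ⟨u, hu, hsub⟩ := (mem_nhdsGE_iff_exists_Ico_subset' (lt_add_one t)).1 hev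
  obtain ⟨q, hq, hqu⟩ := exists_rat_btwn (NNReal.coe_lt_coe.2 hu)
  lift q to ℚ≥0 using by exact_mod_cast (t.2.trans_lt hq).le
  replace hq : t < (q : ℝ≥0) := by rw [← NNReal.coe_lt_coe]; exact_mod_cast hq
  replace hqu : (q : ℝ≥0) < u := by rw [← NNReal.coe_lt_coe]; exact_mod_cast hqu
  have := hsub ⟨hq.le, hqu⟩
  exact ((le_evalPath_iff _ _ _).1 le_rfl q hq).trans_eq this

/-- A Poisson process evaluated at a random time is a random variable. -/
theorem IsPoissonProcess.measurable_comp (h : IsPoissonProcess P A r) {T : Ω → ℝ≥0}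
    (hT : Measurable T) : Measurable fun ω => A (T ω) ω := by
  have : (fun ω => A (T ω) ω) = fun ω => evalPath (fun q => A q ω) (T ω) := by
    ext ω; rw [h.evalPath_eq]
  rw [this]
  exact measurable_evalPath.comp
    ((measurable_pi_lambda _ fun q : ℚ≥0 => h.measurable q).prodMk hT)

end Paths

/-! ### Arrivals during a random time -/

section ArrivalLaw

variable {M : ℕ}

theorem measurable_pi_poissonMeasure (lam : Fin M → ℝ≥0) :
    Measurable fun t : ℝ≥0 => Measure.pi fun m => poissonMeasure (lam m * t) := by
  refine Measure.measurable_of_measurable_coe _ fun s hs => ?_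
  have : ∀ t : ℝ≥0, Measure.pi (fun m => poissonMeasure (lam m * t)) s =
      ∑' x : s, ∏ m, poissonMeasure (lam m * t) {(x : Fin M → ℕ) m} := fun t => by
    rw [← Measure.tsum_indicator_apply_singleton _ _ hs, ← tsum_subtype]
    simp_rw [Measure.pi_singleton]
  simp_rw [this, poissonMeasure_singleton]
  refine Measurable.tsum fun x => Finset.measurable_prod _ fun m _ => ?_
  fun_prop

/-- The Markov kernel sending a duration `t` to the law of the vector of numbers of Poisson
arrivals (rates `lam m`, independent streams) during `t`. -/
def arrivalKernel (lam : Fin M → ℝ≥0) : Kernel ℝ≥0 (Fin M → ℕ) :=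
  ⟨fun t => Measure.pi fun m => poissonMeasure (lam m * t), measurable_pi_poissonMeasure lam⟩

instance (lam : Fin M → ℝ≥0) : IsMarkovKernel (arrivalKernel lam) :=
  ⟨fun t => by change IsProbabilityMeasure (Measure.pi _); infer_instance⟩

/-- The law of the vector of numbers of Poisson arrivals during an independent random time
with law `C`. -/
def arrivalLaw (lam : Fin M → ℝ≥0) (C : Measure ℝ≥0) : Measure (Fin M → ℕ) :=
  C.bind (arrivalKernel lam)

instance (lam : Fin M → ℝ≥0) (C : Measure ℝ≥0) [IsProbabilityMeasure C] :
    IsProbabilityMeasure (arrivalLaw lam C) := by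
  unfold arrivalLaw; infer_instance

theorem arrivalLaw_singleton (lam : Fin M → ℝ≥0) (C : Measure ℝ≥0) (x : Fin M → ℕ) :
    arrivalLaw lam C {x} = ∫⁻ t, ∏ m, poissonMeasure (lam m * t) {x m} ∂C := by
  rw [arrivalLaw, Measure.bind_apply (measurableSet_singleton x) (Kernel.aemeasurable _)]
  simp [arrivalKernel, Measure.pi_singleton]

theorem integral_arrivalLaw (lam : Fin M → ℝ≥0) (C : Measure ℝ≥0) [IsProbabilityMeasure C]
    {f : (Fin M → ℕ) → ℂ} {c : ℝ} (hf : ∀ x, ‖f x‖ ≤ c) :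
    ∫ x, f x ∂arrivalLaw lam C =
      ∫ t, ∫ x, f x ∂(Measure.pi fun m => poissonMeasure (lam m * t)) ∂C := by
  have hint : Integrable (fun p : ℝ≥0 × (Fin M → ℕ) => f p.2) (C ⊗ₘ arrivalKernel lam) :=
    Integrable.of_bound ((measurable_of_countable f).comp measurable_snd).aestronglyMeasurable c
      (ae_of_all _ fun p => hf p.2)
  have h := Measure.integral_compProd hint
  have h2 : arrivalLaw lam C = (C ⊗ₘ arrivalKernel lam).map Prod.snd := by
    rw [← Measure.snd, Measure.snd_compProd]; rfl
  rw [h2, integral_map measurable_snd.aemeasurable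
    (measurable_of_countable f).aestronglyMeasurable, h]
  rfl

theorem norm_monomial_le {z : Fin M → ℂ} (hz : ∀ m, ‖z m‖ ≤ 1) (n : Fin M → ℕ) :
    ‖monomial z n‖ ≤ 1 := by
  rw [monomial, norm_prod]
  exact Finset.prod_le_one (fun _ _ => norm_nonneg _) fun m _ => by
    rw [norm_pow]; exact pow_le_one₀ (norm_nonneg _) (hz m)

theorem pgf_arrivalLaw (lam : Fin M → ℝ≥0) (C : Measure ℝ≥0) [IsProbabilityMeasure C]
    {z : Fin M → ℂ} (hz : ∀ m, ‖z m‖ ≤ 1) : pgf (arrivalLaw lam C) z = arrivalsPgf lam C z :=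
  integral_arrivalLaw lam C (norm_monomial_le hz)

end ArrivalLaw

/-! ### Independence of the sources -/

/-- The durations that make up the time line of the server: the service times, indexed by visit
and rank in the visit, and the switch-over times, indexed by visit. -/
abbrev DurationIndex : Type := (ℕ × ℕ) ⊕ ℕ

/-- The value of a duration. -/
def duration {Ω : Type*} (B : ℕ → ℕ → Ω → ℝ≥0) (S : ℕ → Ω → ℝ≥0) : DurationIndex → Ω → ℝ≥0
  | .inl p => B p.1 p.2
  | .inr v => S v

/-- The source of randomness that a duration is. -/
def DurationIndex.source (M : ℕ) : DurationIndex → Source M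
  | .inl p => .service p.1 p.2
  | .inr v => .switchover v

theorem DurationIndex.source_injective (M : ℕ) :
    Function.Injective (DurationIndex.source M) := by
  rintro (⟨a, b⟩ | a) (⟨c, d⟩ | c) h <;> simp_all [DurationIndex.source]

section Input

variable {M : ℕ} [NeZero M] {Ω : Type*} [MeasurableSpace Ω] {P : Measure Ω}
    {lam b : Fin M → ℝ≥0} {C : Fin M → Measure ℝ≥0} {first : Fin M} {N0 : Ω → Fin M → ℕ}
    {A : Fin M → ℝ≥0 → Ω → ℕ} {B : ℕ → ℕ → Ω → ℝ≥0} {S : ℕ → Ω → ℝ≥0}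

theorem IsInput.measurable_duration (h : IsInput P lam b C first N0 A B S) (d : DurationIndex) :
    Measurable (duration B S d) := by
  rcases d with p | v
  · exact h.measurable_service _ _
  · exact h.measurable_switchover _

theorem IsInput.sourceSigma_le (h : IsInput P lam b C first N0 A B S) (s : Source M) :
    sourceSigma N0 A B S s ≤ (inferInstance : MeasurableSpace Ω) := by
  rcases s with _ | m | ⟨v, n⟩ | v
  · exact h.measurable_initial.comap_le
  · exact iSup_le fun t => ((h.poisson m).measurable t).comap_le
  · exact (h.measurable_service v n).comap_le
  · exact (h.measurable_switchover v).comap_le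

omit [NeZero M] [MeasurableSpace Ω] in
theorem sourceSigma_source (d : DurationIndex) :
    sourceSigma N0 A B S (d.source M) = MeasurableSpace.comap (duration B S d) inferInstance := by
  rcases d with p | v <;> rfl

theorem IsInput.iIndepFun_duration (h : IsInput P lam b C first N0 A B S) :
    iIndepFun (duration B S) P := by
  have := h.indep.precomp (DurationIndex.source_injective M)
  rw [iIndepFun_iff_iIndep]
  convert this using 1
  ext1 d
  exact (sourceSigma_source d).symm

/-- The vector of the initial queue lengths and the arrival paths at rational times. -/
def initialAndPaths (N0 : Ω → Fin M → ℕ) (A : Fin M → ℝ≥0 → Ω → ℕ) (ω : Ω) :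
    (Fin M → ℕ) × (Fin M → ℚ≥0 → ℕ) := (N0 ω, fun m q => A m q ω)

theorem IsInput.measurable_initialAndPaths (h : IsInput P lam b C first N0 A B S) :
    Measurable (initialAndPaths N0 A) :=
  h.measurable_initial.prodMk
    (measurable_pi_lambda _ fun m => measurable_pi_lambda _ fun q => (h.poisson m).measurable q)

/-- The durations are independent of the initial queue lengths and the arrivals. -/
theorem IsInput.indepFun_duration_paths (h : IsInput P lam b C first N0 A B S) {n : ℕ}
    (d : Fin n → DurationIndex) :
    IndepFun (fun ω j => duration B S (d j) ω) (initialAndPaths N0 A) P := by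
  have hdisj : Disjoint (Set.range (DurationIndex.source M)) (Set.range (DurationIndex.source M))ᶜ :=
    disjoint_compl_right
  have key := indep_iSup_of_disjoint h.sourceSigma_le h.indep hdisj
  rw [IndepFun_iff_Indep]
  refine indep_of_indep_of_le_left (indep_of_indep_of_le_right key ?_) ?_
  · have h0 : MeasurableSpace.comap N0 inferInstance ≤
        ⨆ i ∈ (Set.range (DurationIndex.source M))ᶜ, sourceSigma N0 A B S i :=
      le_iSup₂_of_le (f := fun i _ => sourceSigma N0 A B S i) Source.initialLengths
        (by rintro ⟨(d | d), hd⟩ <;> cases hd) le_rfl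
    have h1 : ∀ m t, MeasurableSpace.comap (A m t) inferInstance ≤
        ⨆ i ∈ (Set.range (DurationIndex.source M))ᶜ, sourceSigma N0 A B S i := fun m t =>
      le_iSup₂_of_le (f := fun i _ => sourceSigma N0 A B S i) (Source.arrivals m)
        (by rintro ⟨(d | d), hd⟩ <;> cases hd)
        (le_iSup (fun t => MeasurableSpace.comap (A m t) inferInstance) t)
    rw [← measurable_iff_comap_le]
    refine Measurable.prodMk (measurable_iff_comap_le.2 h0) ?_
    exact @measurable_pi_lambda _ _ _ (_) _ _ fun m => @measurable_pi_lambda _ _ _ (_) _ _ fun q =>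
      measurable_iff_comap_le.2 (h1 m q)
  · rw [← measurable_iff_comap_le]
    refine @measurable_pi_lambda _ _ _ (_) _ _ fun j => measurable_iff_comap_le.2 ?_
    rw [← sourceSigma_source (M := M) (N0 := N0) (A := A)]
    exact le_iSup₂_of_le (f := fun i _ => sourceSigma N0 A B S i) _ ⟨d j, rfl⟩ le_rfl

theorem monotone_partialSum {n : ℕ} (t : Fin n → ℝ≥0) : Monotone (Fin.partialSum t) :=
  Fin.monotone_iff_le_succ.2 fun j => by rw [Fin.partialSum_succ]; exact le_self_add

/-- The joint law of the initial queue lengths and the arrivals in consecutive intervals of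
deterministic lengths `t 0, t 1, …`. -/
theorem IsInput.measure_arrivals_deterministic (h : IsInput P lam b C first N0 A B S) {n : ℕ}
    (t : Fin n → ℝ≥0) (x₀ : Fin M → ℕ) (x : Fin n → Fin M → ℕ) :
    P ({ω | N0 ω = x₀} ∩ {ω | ∀ j m,
        A m (Fin.partialSum t j.succ) ω - A m (Fin.partialSum t j.castSucc) ω = x j m}) =
      P {ω | N0 ω = x₀} * ∏ j, ∏ m, poissonMeasure (lam m * t j) {x j m} := by
  let src : Option (Fin M) → Source M := fun o => o.elim .initialLengths .arrivals
  have hsrc : Function.Injective src := by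
    rintro (_ | a) (_ | c) hac <;> simp_all [src]
  let E : Option (Fin M) → Set Ω := fun o => o.elim {ω | N0 ω = x₀} fun m =>
    ⋂ j, {ω | A m (Fin.partialSum t j.succ) ω - A m (Fin.partialSum t j.castSucc) ω = x j m}
  have hE : ∀ o, MeasurableSet[(sourceSigma N0 A B S ∘ src) o] (E o) := by
    rintro (_ | m)
    · exact ⟨{x₀}, measurableSet_singleton _, rfl⟩
    · have hA : ∀ u, Measurable[sourceSigma N0 A B S (.arrivals m)] (A m u) := fun u =>
        measurable_iff_comap_le.2 (le_iSup (fun t => MeasurableSpace.comap (A m t) inferInstance) u)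
      refine @MeasurableSet.iInter _ _ (_) _ _ fun j => ?_
      have := @Measurable.sub _ _ _ _ _ (_) _ _ (hA (Fin.partialSum t j.succ))
        (hA (Fin.partialSum t j.castSucc))
      exact this (measurableSet_singleton (x j m))
  have hmeas := (h.indep.precomp hsrc).meas_iInter hE
  have hset : ({ω | N0 ω = x₀} ∩ {ω | ∀ j m,
        A m (Fin.partialSum t j.succ) ω - A m (Fin.partialSum t j.castSucc) ω = x j m}) =
      ⋂ o, E o := by
    ext ω
    simp only [Set.mem_inter_iff, Set.mem_ofPred_eq, Set.mem_iInter, Option.forall, E,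
      Option.elim_none, Option.elim_some]
    exact and_congr_right fun _ => forall_comm
  rw [hset, hmeas, Fintype.prod_option, Finset.prod_comm]
  simp only [E, Option.elim_none, Option.elim_some]
  congr 1
  refine Finset.prod_congr rfl fun m _ => ?_
  have hind := (h.poisson m).indep_increments n (Fin.partialSum t) (monotone_partialSum t)
  refine (hind.meas_iInter fun j => ⟨{x j m}, measurableSet_singleton _, rfl⟩).trans ?_
  refine Finset.prod_congr rfl fun j _ => ?_
  rw [← (h.poisson m).law_increment (Fin.partialSum t j.castSucc) (t j), ← Fin.partialSum_succ]
  exact (Measure.map_apply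
    (((h.poisson m).measurable _).sub ((h.poisson m).measurable _)) (measurableSet_singleton _)).symm

/-- The joint law of the initial queue lengths and the arrivals in consecutive intervals whose
lengths are distinct durations of the system. -/
theorem IsInput.measure_arrivals (h : IsInput P lam b C first N0 A B S)
    {n : ℕ} (d : Fin n → DurationIndex) (hd : Function.Injective d) (x₀ : Fin M → ℕ)
    (x : Fin n → Fin M → ℕ) :
    P ({ω | N0 ω = x₀} ∩ {ω | ∀ j m,
        A m (Fin.partialSum (fun l => duration B S (d l) ω) j.succ) ω -
          A m (Fin.partialSum (fun l => duration B S (d l) ω) j.castSucc) ω = x j m}) =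
      P {ω | N0 ω = x₀} * ∏ j, arrivalLaw lam (P.map (duration B S (d j))) {x j} := by
  have hprob : IsProbabilityMeasure P := h.indep.isProbabilityMeasure
  let D : Ω → Fin n → ℝ≥0 := fun ω j => duration B S (d j) ω
  have hD : Measurable D := measurable_pi_lambda _ fun j => h.measurable_duration (d j)
  have hpart : ∀ i : Fin (n + 1), Measurable fun t : Fin n → ℝ≥0 => Fin.partialSum t i := by
    intro i
    induction i using Fin.induction with
    | zero => simp
    | succ i ih => simp_rw [Fin.partialSum_succ]; exact ih.add (measurable_pi_apply i)
  let G : Set ((Fin n → ℝ≥0) × ((Fin M → ℕ) × (Fin M → ℚ≥0 → ℕ))) :=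
    {p | p.2.1 = x₀} ∩ {p | ∀ j m,
      evalPath (p.2.2 m) (Fin.partialSum p.1 j.succ) -
        evalPath (p.2.2 m) (Fin.partialSum p.1 j.castSucc) = x j m}
  have heval : ∀ (m : Fin M) (i : Fin (n + 1)),
      Measurable fun p : (Fin n → ℝ≥0) × ((Fin M → ℕ) × (Fin M → ℚ≥0 → ℕ)) =>
        evalPath (p.2.2 m) (Fin.partialSum p.1 i) := fun m i => by
    have hm : Measurable fun p : (Fin n → ℝ≥0) × ((Fin M → ℕ) × (Fin M → ℚ≥0 → ℕ)) =>
        (p.2.2 m, Fin.partialSum p.1 i) :=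
      ((measurable_pi_apply m).comp (measurable_snd.comp measurable_snd)).prodMk
        ((hpart i).comp measurable_fst)
    exact measurable_evalPath.comp hm
  have hG : MeasurableSet G := by
    refine MeasurableSet.inter ?_ ?_
    · exact (measurable_fst.comp measurable_snd) (measurableSet_singleton x₀)
    · simp only [Set.ofPred_forall]
      exact MeasurableSet.iInter fun j => MeasurableSet.iInter fun m =>
        ((heval m j.succ).sub (heval m j.castSucc)) (measurableSet_singleton (x j m))
  have hmap := (indepFun_iff_map_prod_eq_prod_map_map hD.aemeasurable
    h.measurable_initialAndPaths.aemeasurable).1 (h.indepFun_duration_paths d)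
  have h1 : ({ω | N0 ω = x₀} ∩ {ω | ∀ j m,
        A m (Fin.partialSum (fun l => duration B S (d l) ω) j.succ) ω -
          A m (Fin.partialSum (fun l => duration B S (d l) ω) j.castSucc) ω = x j m}) =
      (fun ω => (D ω, initialAndPaths N0 A ω)) ⁻¹' G := by
    ext ω
    simp only [G, initialAndPaths, Set.preimage_inter, Set.mem_inter_iff, Set.mem_ofPred_eq,
      Set.mem_preimage, (h.poisson _).evalPath_eq, D]
  have h2 : ∀ t : Fin n → ℝ≥0, initialAndPaths N0 A ⁻¹' (Prod.mk t ⁻¹' G) =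
      ({ω | N0 ω = x₀} ∩ {ω | ∀ j m,
        A m (Fin.partialSum t j.succ) ω - A m (Fin.partialSum t j.castSucc) ω = x j m}) := by
    intro t
    ext ω
    simp only [G, initialAndPaths, Set.preimage_inter, Set.mem_inter_iff, Set.mem_ofPred_eq,
      Set.mem_preimage, (h.poisson _).evalPath_eq]
  have hq : ∀ (j : Fin n), Measurable fun t : ℝ≥0 => ∏ m, poissonMeasure (lam m * t) {x j m} := by
    intro j
    simp_rw [poissonMeasure_singleton]
    refine Finset.measurable_prod _ fun m _ => ?_
    fun_prop
  rw [h1, ← Measure.map_apply (hD.prodMk h.measurable_initialAndPaths) hG, hmap,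
    Measure.prod_apply hG]
  simp_rw [Measure.map_apply h.measurable_initialAndPaths (measurable_prodMk_left hG), h2,
    h.measure_arrivals_deterministic]
  have hprod : Measurable fun t : Fin n → ℝ≥0 => ∏ j, ∏ m, poissonMeasure (lam m * t j) {x j m} :=
    Finset.measurable_prod _ fun j _ => (hq j).comp (measurable_pi_apply j)
  rw [lintegral_const_mul _ hprod, lintegral_map hprod hD]
  congr 1
  have hind : iIndepFun (fun j ω => ∏ m, poissonMeasure (lam m * D ω j) {x j m}) P :=
    (h.iIndepFun_duration.precomp hd).comp
      (fun j t => ∏ m, poissonMeasure (lam m * t) {x j m}) hq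
  rw [lintegral_prod_eq_prod_lintegral_of_indepFun Finset.univ _ hind
    fun j => (hq j).comp ((measurable_pi_apply j).comp hD)]
  refine Finset.prod_congr rfl fun j _ => ?_
  rw [arrivalLaw_singleton, lintegral_map (hq j) (h.measurable_duration _)]

end Input

/-! ### Paths of a visit -/

section VisitPaths

variable {M : ℕ}

/-- One service at queue `i`: the queue lengths `w` become `step cap i w x` if `x` counts the
arrivals during the service. -/
def step (cap : ℕ∞) (i : Fin M) (w x : Fin M → ℕ) : Fin M → ℕ := fun m =>
  if m = i then (min ((w m + x m : ℕ) : ℕ∞) cap).toNat - 1 else w m + x m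

/-- The arrivals during the `n`-th service of a visit. -/
def serviceArrivals (a : Fin M → ℝ≥0 → ℕ) (τ : ℝ≥0) (s : ℕ → ℝ≥0) (n : ℕ) : Fin M → ℕ :=
  fun m => a m (departureTime τ s (n + 1)) - a m (departureTime τ s n)

/-- The queue lengths after `n` services of a visit to queue `i`, frozen as soon as queue `i` is
empty, when `X l` counts the arrivals during the `l`-th service. -/
def stoppedWalk (cap : ℕ∞) (i : Fin M) (w : Fin M → ℕ) (X : ℕ → Fin M → ℕ) : ℕ → Fin M → ℕ
  | 0 => w
  | n + 1 => if stoppedWalk cap i w X n i = 0 then stoppedWalk cap i w X n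
      else step cap i (stoppedWalk cap i w X n) (X n)

variable {cap : ℕ∞} {a : Fin M → ℝ≥0 → ℕ} {i : Fin M} {τ : ℝ≥0} {s : ℕ → ℝ≥0} {x : Fin M → ℕ}

theorem departureTime_succ (τ : ℝ≥0) (s : ℕ → ℝ≥0) (n : ℕ) :
    departureTime τ s (n + 1) = departureTime τ s n + s n := by
  simp [departureTime, Finset.sum_range_succ, add_assoc]

theorem lengthsAfter_succ (n : ℕ) : lengthsAfter cap a i τ s x (n + 1) =
    step cap i (lengthsAfter cap a i τ s x n) (serviceArrivals a τ s n) := by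
  ext m
  simp only [lengthsAfter, step, serviceArrivals]

theorem stoppedWalk_eq_lengthsAfter {n : ℕ} (h : ∀ l < n, lengthsAfter cap a i τ s x l i ≠ 0) :
    stoppedWalk cap i x (serviceArrivals a τ s) n = lengthsAfter cap a i τ s x n := by
  induction n with
  | zero => rfl
  | succ n ih =>
    rw [stoppedWalk, ih fun l hl => h l (hl.trans n.lt_succ_self), if_neg (h n n.lt_succ_self),
      lengthsAfter_succ]

theorem stoppedWalk_of_zero {w : Fin M → ℕ} {X : ℕ → Fin M → ℕ} {N : ℕ}
    (h : stoppedWalk cap i w X N i = 0) {n : ℕ} (hn : N ≤ n) :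
    stoppedWalk cap i w X n = stoppedWalk cap i w X N := by
  induction n, hn using Nat.le_induction with
  | base => rfl
  | succ n _ ih => rw [stoppedWalk, ih, if_pos h]

theorem jobsServed_top_spec (h : ∃ n, lengthsAfter cap a i τ s x n i = 0) :
    lengthsAfter cap a i τ s x (jobsServed ⊤ cap a i τ s x) i = 0 ∧
      ∀ l < jobsServed ⊤ cap a i τ s x, lengthsAfter cap a i τ s x l i ≠ 0 := by
  have hset : {n : ℕ | lengthsAfter cap a i τ s x n i = 0 ∨ (n : ℕ∞) = ⊤} =
      {n | lengthsAfter cap a i τ s x n i = 0} := by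
    ext n; simp
  rw [jobsServed, hset]
  exact ⟨Nat.sInf_mem h, fun l hl =>
    Nat.notMem_of_lt_sInf (s := {n | lengthsAfter cap a i τ s x n i = 0}) hl⟩

theorem exists_stoppedWalk_eq_zero_iff :
    (∃ n, stoppedWalk cap i x (serviceArrivals a τ s) n i = 0) ↔
      ∃ n, lengthsAfter cap a i τ s x n i = 0 := by
  constructor
  · rintro ⟨n, hn⟩
    by_contra! hcon
    exact hcon n (by rwa [stoppedWalk_eq_lengthsAfter fun l _ => hcon l] at hn)
  · intro h
    obtain ⟨h0, hl⟩ := jobsServed_top_spec h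
    exact ⟨_, by rw [stoppedWalk_eq_lengthsAfter hl, h0]⟩

/-- Once the stopped walk has emptied queue `i`, it gives the queue lengths at the end of the
visit. -/
theorem visitEnd_top_eq_stoppedWalk {n : ℕ}
    (h : stoppedWalk cap i x (serviceArrivals a τ s) n i = 0) :
    (visitEnd ⊤ cap a i τ s x).2 = stoppedWalk cap i x (serviceArrivals a τ s) n := by
  obtain ⟨h0, hl⟩ := jobsServed_top_spec (exists_stoppedWalk_eq_zero_iff.1 ⟨n, h⟩)
  have hN := stoppedWalk_eq_lengthsAfter hl
  change lengthsAfter cap a i τ s x (jobsServed ⊤ cap a i τ s x) = _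
  rw [← hN] at h0 ⊢
  rcases le_total n (jobsServed ⊤ cap a i τ s x) with hle | hle
  · exact stoppedWalk_of_zero h hle
  · exact (stoppedWalk_of_zero h0 hle).symm

/-- If the walk empties queue `i` for the first time at the `n`-th departure, this departure ends
the visit. -/
theorem visitEnd_top_of_first_zero {n : ℕ}
    (h : stoppedWalk cap i x (serviceArrivals a τ s) n i = 0)
    (hl : ∀ l < n, stoppedWalk cap i x (serviceArrivals a τ s) l i ≠ 0) :
    visitEnd ⊤ cap a i τ s x =
      (departureTime τ s n, stoppedWalk cap i x (serviceArrivals a τ s) n) := by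
  obtain ⟨h0, hl'⟩ := jobsServed_top_spec (exists_stoppedWalk_eq_zero_iff.1 ⟨n, h⟩)
  have hN := stoppedWalk_eq_lengthsAfter hl'
  have hle : n ≤ jobsServed ⊤ cap a i τ s x := by
    by_contra! hlt
    exact hl _ hlt (by rw [hN, h0])
  have hn : stoppedWalk cap i x (serviceArrivals a τ s) n = lengthsAfter cap a i τ s x n :=
    stoppedWalk_eq_lengthsAfter fun l hln => hl' l (hln.trans_le hle)
  have heq : jobsServed ⊤ cap a i τ s x = n := by
    refine le_antisymm ?_ hle
    by_contra! hlt
    exact hl' n hlt (by rw [← hn, h])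
  rw [visitEnd, heq, hn]

/-- The `k`-limited visit coincides with the exhaustive one as soon as `k` is at least the number
of jobs that the latter serves. -/
theorem visitEnd_eq_visitEnd_top {n k : ℕ} (h : lengthsAfter cap a i τ s x n i = 0) (hk : n ≤ k) :
    visitEnd k cap a i τ s x = visitEnd ⊤ cap a i τ s x := by
  obtain ⟨h0, hl⟩ := jobsServed_top_spec ⟨n, h⟩
  have hle : jobsServed ⊤ cap a i τ s x ≤ n := by
    by_contra! hlt
    exact hl n hlt h
  have hmem := Nat.sInf_mem (s := {n : ℕ | lengthsAfter cap a i τ s x n i = 0 ∨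
    (n : ℕ∞) = (k : ℕ∞)}) ⟨_, Or.inl h0⟩
  have heq : jobsServed k cap a i τ s x = jobsServed ⊤ cap a i τ s x := by
    refine le_antisymm (Nat.sInf_le (Or.inl h0)) ?_
    rcases hmem with hmem | hmem
    · by_contra! hlt
      exact hl _ hlt hmem
    · exact (hle.trans hk).trans_eq (Nat.cast_inj.1 hmem).symm
  rw [visitEnd, visitEnd, heq]

theorem step_apply_le (cap : ℕ∞) (i : Fin M) {w w' : Fin M → ℕ} (x : Fin M → ℕ)
    (h : w i ≤ w' i) : step cap i w x i ≤ step ⊤ i w' x i := by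
  simp only [step, if_pos]
  refine Nat.sub_le_sub_right ?_ 1
  rw [min_top_right, ENat.toNat_natCast]
  refine (ENat.toNat_le_toNat (min_le_left _ _) (ENat.natCast_ne_top _)).trans ?_
  rw [ENat.toNat_natCast]
  omega

/-- A truncated queue is never longer than the unlimited one. -/
theorem lengthsAfter_le_top (n : ℕ) :
    lengthsAfter cap a i τ s x n i ≤ lengthsAfter ⊤ a i τ s x n i := by
  induction n with
  | zero => exact le_rfl
  | succ n ih => rw [lengthsAfter_succ, lengthsAfter_succ]; exact step_apply_le cap i _ ih

/-- A large truncation level does not affect the first services. -/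
theorem eventually_lengthsAfter_eq (a : Fin M → ℝ≥0 → ℕ) (i : Fin M) (τ : ℝ≥0) (s : ℕ → ℝ≥0)
    (x : Fin M → ℕ) (n : ℕ) : ∀ᶠ K : ℕ in atTop, ∀ l ≤ n,
      lengthsAfter ((K + 1 : ℕ) : ℕ∞) a i τ s x l = lengthsAfter ⊤ a i τ s x l := by
  induction n with
  | zero => exact Eventually.of_forall fun K l hl => by rw [Nat.le_zero.1 hl]; rfl
  | succ n ih =>
    filter_upwards [ih, eventually_ge_atTop
      (lengthsAfter ⊤ a i τ s x n i + serviceArrivals a τ s n i)] with K hK hge l hl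
    rcases Nat.le_succ_iff.1 hl with hl | rfl
    · exact hK l hl
    · rw [lengthsAfter_succ, lengthsAfter_succ, hK n le_rfl]
      ext m
      simp only [step]
      split_ifs with hm
      · subst hm
        rw [min_top_right, min_eq_left (by exact_mod_cast hge.trans K.le_succ)]
      · rfl

theorem eventually_visitEnd_eq (h : ∃ n, lengthsAfter ⊤ a i τ s x n i = 0) :
    ∀ᶠ K : ℕ in atTop,
      visitEnd ⊤ ((K + 1 : ℕ) : ℕ∞) a i τ s x = visitEnd ⊤ ⊤ a i τ s x := by
  obtain ⟨h0, hl⟩ := jobsServed_top_spec h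
  filter_upwards [eventually_lengthsAfter_eq a i τ s x (jobsServed ⊤ ⊤ a i τ s x)] with K hK
  have heq := hK _ le_rfl
  obtain ⟨h0', hl'⟩ := jobsServed_top_spec (cap := ((K + 1 : ℕ) : ℕ∞))
    ⟨jobsServed ⊤ ⊤ a i τ s x, by rw [heq, h0]⟩
  have hjobs : jobsServed ⊤ ((K + 1 : ℕ) : ℕ∞) a i τ s x = jobsServed ⊤ ⊤ a i τ s x := by
    refine le_antisymm ?_ ?_ <;> by_contra! hlt
    · exact hl' _ hlt (by rw [heq, h0])
    · exact hl _ hlt (by rw [← hK _ hlt.le, h0'])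
  rw [visitEnd, visitEnd, hjobs, heq]

end VisitPaths

/-! ### Measurability -/

section Measurability

variable {M : ℕ} {Ω : Type*} [MeasurableSpace Ω] {P : Measure Ω} {lam : Fin M → ℝ≥0}
  {A : Fin M → ℝ≥0 → Ω → ℕ}

theorem measurable_sInf_nat {p : ℕ → Ω → Prop} (hp : ∀ n, MeasurableSet {ω | p n ω}) :
    Measurable fun ω => sInf {n | p n ω} := by
  refine measurable_of_Ici fun k => ?_
  rcases Nat.eq_zero_or_pos k with rfl | hk
  · convert MeasurableSet.univ using 1
    ext ω; simp
  · have : (fun ω => sInf {n | p n ω}) ⁻¹' Set.Ici k =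
        (⋃ n, {ω | p n ω}) ∩ ⋂ n, ⋂ (_ : n < k), {ω | p n ω}ᶜ := by
      ext ω
      simp only [Set.mem_preimage, Set.mem_Ici, Set.mem_inter_iff, Set.mem_iUnion, Set.mem_iInter,
        Set.mem_compl_iff]
      constructor
      · intro h
        have hpos : 0 < sInf {n | p n ω} := hk.trans_le h
        refine ⟨Nat.nonempty_of_pos_sInf hpos, fun n hn => Nat.notMem_of_lt_sInf (hn.trans_le h)⟩
      · rintro ⟨hne, hn⟩
        by_contra! hlt
        exact hn _ hlt (Nat.sInf_mem (s := {n | p n ω}) hne)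
    rw [this]
    exact (MeasurableSet.iUnion hp).inter
      (MeasurableSet.iInter fun n => MeasurableSet.iInter fun _ => (hp n).compl)

theorem measurable_comp_nat {β : Type*} [MeasurableSpace β] {f : ℕ → Ω → β}
    (hf : ∀ n, Measurable (f n)) {N : Ω → ℕ} (hN : Measurable N) :
    Measurable fun ω => f (N ω) ω :=
  (measurable_from_prod_countable_left (f := fun p : Ω × ℕ => f p.2 p.1) hf).comp
    (measurable_id.prodMk hN)

theorem measurable_departureTime {τ : Ω → ℝ≥0} (hτ : Measurable τ) {s : ℕ → Ω → ℝ≥0}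
    (hs : ∀ n, Measurable (s n)) (n : ℕ) :
    Measurable fun ω => departureTime (τ ω) (fun l => s l ω) n :=
  hτ.add (Finset.measurable_sum _ fun l _ => hs l)

theorem measurable_arrivals (hA : ∀ m, IsPoissonProcess P (A m) (lam m)) {T U : Ω → ℝ≥0}
    (hT : Measurable T) (hU : Measurable U) :
    Measurable fun ω m => A m (U ω) ω - A m (T ω) ω :=
  measurable_pi_lambda _ fun m => ((hA m).measurable_comp hU).sub ((hA m).measurable_comp hT)

variable {i : Fin M} {τ : Ω → ℝ≥0} {s : ℕ → Ω → ℝ≥0} {ξ : Ω → Fin M → ℕ}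

theorem measurable_serviceArrivals (hA : ∀ m, IsPoissonProcess P (A m) (lam m))
    (hτ : Measurable τ) (hs : ∀ n, Measurable (s n)) (n : ℕ) :
    Measurable fun ω => serviceArrivals (fun m t => A m t ω) (τ ω) (fun l => s l ω) n :=
  measurable_arrivals hA (measurable_departureTime hτ hs n) (measurable_departureTime hτ hs (n + 1))

theorem measurable_lengthsAfter (hA : ∀ m, IsPoissonProcess P (A m) (lam m)) (hτ : Measurable τ)
    (hs : ∀ n, Measurable (s n)) (hξ : Measurable ξ) (cap : ℕ∞) (i : Fin M) (n : ℕ) :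
    Measurable fun ω => lengthsAfter cap (fun m t => A m t ω) i (τ ω) (fun l => s l ω) (ξ ω) n := by
  induction n with
  | zero => exact hξ
  | succ n ih =>
    simp_rw [lengthsAfter_succ]
    exact (measurable_of_countable fun p : (Fin M → ℕ) × (Fin M → ℕ) => step cap i p.1 p.2).comp
      (ih.prodMk (measurable_serviceArrivals hA hτ hs n))

theorem measurable_stoppedWalk (cap : ℕ∞) (i : Fin M) (hξ : Measurable ξ)
    {X : ℕ → Ω → Fin M → ℕ} (hX : ∀ n, Measurable (X n)) (n : ℕ) :
    Measurable fun ω => stoppedWalk cap i (ξ ω) (fun l => X l ω) n := by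
  induction n with
  | zero => exact hξ
  | succ n ih =>
    exact (measurable_of_countable fun p : (Fin M → ℕ) × (Fin M → ℕ) =>
      if p.1 i = 0 then p.1 else step cap i p.1 p.2).comp (ih.prodMk (hX n))

theorem measurable_jobsServed (hA : ∀ m, IsPoissonProcess P (A m) (lam m)) (hτ : Measurable τ)
    (hs : ∀ n, Measurable (s n)) (hξ : Measurable ξ) (k cap : ℕ∞) (i : Fin M) :
    Measurable fun ω =>
      jobsServed k cap (fun m t => A m t ω) i (τ ω) (fun l => s l ω) (ξ ω) := by
  refine measurable_sInf_nat fun n => ?_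
  refine MeasurableSet.union (s₁ := {ω | lengthsAfter cap (fun m t => A m t ω) i (τ ω)
    (fun l => s l ω) (ξ ω) n i = 0}) (s₂ := {ω | (n : ℕ∞) = k}) ?_ (MeasurableSet.const _)
  exact ((measurable_pi_apply i).comp (measurable_lengthsAfter hA hτ hs hξ cap i n))
    (measurableSet_singleton 0)

theorem measurable_visitEnd (hA : ∀ m, IsPoissonProcess P (A m) (lam m)) (hτ : Measurable τ)
    (hs : ∀ n, Measurable (s n)) (hξ : Measurable ξ) (k cap : ℕ∞) (i : Fin M) :
    Measurable fun ω => visitEnd k cap (fun m t => A m t ω) i (τ ω) (fun l => s l ω) (ξ ω) :=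
  (measurable_comp_nat (measurable_departureTime hτ hs)
      (measurable_jobsServed hA hτ hs hξ k cap i)).prodMk
    (measurable_comp_nat (measurable_lengthsAfter hA hτ hs hξ cap i)
      (measurable_jobsServed hA hτ hs hξ k cap i))

variable [NeZero M] {b : Fin M → ℝ≥0} {C : Fin M → Measure ℝ≥0} {first : Fin M}
    {N0 : Ω → Fin M → ℕ} {B : ℕ → ℕ → Ω → ℝ≥0} {S : ℕ → Ω → ℝ≥0}

theorem IsInput.measurable_visitBegin (h : IsInput P lam b C first N0 A B S) (k : ℕ∞) (v : ℕ) :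
    Measurable fun ω => visitBegin k first (fun m t => A m t ω) (fun u n => B u n ω)
      (fun u => S u ω) (N0 ω) v := by
  induction v with
  | zero => exact measurable_const.prodMk h.measurable_initial
  | succ v ih =>
    have he := measurable_visitEnd h.poisson (measurable_fst.comp ih)
      (h.measurable_service v) (measurable_snd.comp ih) k ⊤ (queueOf first v)
    have ht := (measurable_fst.comp he).add (h.measurable_switchover v)
    refine ht.prodMk (measurable_pi_lambda _ fun m => ?_)
    exact ((measurable_pi_apply m).comp (measurable_snd.comp he)).add
      ((measurable_pi_apply m).comp (measurable_arrivals h.poisson (measurable_fst.comp he) ht))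

theorem IsInput.measurable_lengthsBegin (h : IsInput P lam b C first N0 A B S) (k : ℕ∞) (v : ℕ) :
    Measurable (lengthsBegin k first N0 A B S v) :=
  measurable_snd.comp (h.measurable_visitBegin k v)

theorem IsInput.measurable_lengthsEnd (h : IsInput P lam b C first N0 A B S) (k : ℕ∞) (v : ℕ) :
    Measurable (lengthsEnd k first N0 A B S v) :=
  measurable_snd.comp (measurable_visitEnd h.poisson
    (measurable_fst.comp (h.measurable_visitBegin k v)) (h.measurable_service v)
    (measurable_snd.comp (h.measurable_visitBegin k v)) k ⊤ (queueOf first v))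

end Measurability

/-! ### Renewal of the arrivals at random times -/

section Renewal

variable {M : ℕ} {Ω : Type*} [MeasurableSpace Ω]

/-- The arrivals after the random time `T` start afresh on the event `E`: independently of `E`, the
numbers of arrivals in consecutive intervals after `T`, whose lengths are distinct durations outside
`used`, are independent and distributed as over independent random times. This is the form of the
strong Markov property on which the analysis rests; `used` contains the durations that have
contributed to `T` and `E`. -/
structure Renews (P : Measure Ω) (lam : Fin M → ℝ≥0) (A : Fin M → ℝ≥0 → Ω → ℕ)
    (D : DurationIndex → Ω → ℝ≥0) (used : Set DurationIndex) (T : Ω → ℝ≥0) (E : Set Ω) : Prop where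
  measurable_time : Measurable T
  measurableSet : MeasurableSet E
  measure_inter : ∀ (n : ℕ) (d : Fin n → DurationIndex) (x : Fin n → Fin M → ℕ),
    Function.Injective d → (∀ j, d j ∉ used) →
      P (E ∩ {ω | ∀ j m, A m (T ω + Fin.partialSum (fun l => D (d l) ω) j.succ) ω -
          A m (T ω + Fin.partialSum (fun l => D (d l) ω) j.castSucc) ω = x j m}) =
        P E * ∏ j, arrivalLaw lam (P.map (D (d j))) {x j}

/-- The arrivals during the random time `U` that follows the random time `T`. -/
def arrivalsAfter (A : Fin M → ℝ≥0 → Ω → ℕ) (T U : Ω → ℝ≥0) (ω : Ω) : Fin M → ℕ :=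
  fun m => A m (T ω + U ω) ω - A m (T ω) ω

variable {P : Measure Ω} {lam : Fin M → ℝ≥0} {A : Fin M → ℝ≥0 → Ω → ℕ}
  {D : DurationIndex → Ω → ℝ≥0} {used : Set DurationIndex} {T T' : Ω → ℝ≥0} {E E' : Set Ω}

theorem measurable_arrivalsAfter (hA : ∀ m, IsPoissonProcess P (A m) (lam m))
    {T U : Ω → ℝ≥0} (hT : Measurable T) (hU : Measurable U) :
    Measurable (arrivalsAfter A T U) :=
  measurable_arrivals hA hT (hT.add hU)

theorem measurableSet_arrivals (hA : ∀ m, IsPoissonProcess P (A m) (lam m))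
    (hD : ∀ d, Measurable (D d)) (hT : Measurable T) {n : ℕ} (d : Fin n → DurationIndex)
    (x : Fin n → Fin M → ℕ) :
    MeasurableSet {ω | ∀ j m, A m (T ω + Fin.partialSum (fun l => D (d l) ω) j.succ) ω -
          A m (T ω + Fin.partialSum (fun l => D (d l) ω) j.castSucc) ω = x j m} := by
  have hpart : ∀ i : Fin (n + 1), Measurable fun ω => Fin.partialSum (fun l => D (d l) ω) i := by
    intro i
    induction i using Fin.induction with
    | zero => simp
    | succ i ih => simp_rw [Fin.partialSum_succ]; exact ih.add (hD _)
  simp only [Set.ofPred_forall]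
  exact MeasurableSet.iInter fun j => MeasurableSet.iInter fun m =>
    (((hA m).measurable_comp (hT.add (hpart _))).sub
      ((hA m).measurable_comp (hT.add (hpart _)))) (measurableSet_singleton _)

namespace Renews

theorem mono (h : Renews P lam A D used T E) {used' : Set DurationIndex} (hu : used ⊆ used') :
    Renews P lam A D used' T E :=
  ⟨h.measurable_time, h.measurableSet, fun n d x hd hdu =>
    h.measure_inter n d x hd fun j hj => hdu j (hu hj)⟩

theorem congr_time (h : Renews P lam A D used T E) (hT' : Measurable T')
    (heq : ∀ ω ∈ E, T ω = T' ω) : Renews P lam A D used T' E := by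
  refine ⟨hT', h.measurableSet, fun n d x hd hdu => ?_⟩
  rw [← h.measure_inter n d x hd hdu]
  congr 1
  ext ω
  refine and_congr_right fun hω => ?_
  simp only [Set.mem_ofPred_eq, heq ω hω]

theorem congr_ae (h : Renews P lam A D used T E) (hE' : MeasurableSet E') (heq : E' =ᵐ[P] E) :
    Renews P lam A D used T E' := by
  refine ⟨h.measurable_time, hE', fun n d x hd hdu => ?_⟩
  rw [measure_congr heq, ← h.measure_inter n d x hd hdu]
  exact measure_congr (heq.inter (ae_eq_refl _))

theorem empty (hT : Measurable T) : Renews P lam A D used T ∅ :=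
  ⟨hT, MeasurableSet.empty, fun n d x _ _ => by simp⟩

theorem iUnion (hA : ∀ m, IsPoissonProcess P (A m) (lam m)) (hD : ∀ d, Measurable (D d))
    {ι : Type*} [Countable ι] {E : ι → Set Ω} (hT : Measurable T)
    (h : ∀ a, Renews P lam A D used T (E a))
    (hdisj : Pairwise (Function.onFun Disjoint E)) : Renews P lam A D used T (⋃ a, E a) := by
  refine ⟨hT, MeasurableSet.iUnion fun a => (h a).measurableSet, fun n d x hd hdu => ?_⟩
  rw [Set.iUnion_inter, measure_iUnion, measure_iUnion hdisj fun a => (h a).measurableSet,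
    ← ENNReal.tsum_mul_right]
  · exact tsum_congr fun a => (h a).measure_inter n d x hd hdu
  · exact fun a c hac => (hdisj hac).mono Set.inter_subset_left Set.inter_subset_left
  · exact fun a => (h a).measurableSet.inter (measurableSet_arrivals hA hD hT d x)

variable {d : DurationIndex}

theorem measure_next (h : Renews P lam A D used T E) (hd : d ∉ used) (x : Fin M → ℕ) :
    P (E ∩ {ω | arrivalsAfter A T (D d) ω = x}) =
      P E * arrivalLaw lam (P.map (D d)) {x} := by
  have := h.measure_inter 1 (fun _ => d) (fun _ => x) (Function.injective_of_subsingleton _)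
    fun _ => hd
  rw [Fin.prod_univ_one] at this
  rw [← this]
  congr 2
  ext ω
  simp only [arrivalsAfter, Set.mem_ofPred_eq, funext_iff, Fin.forall_fin_one]
  have h1 : Fin.partialSum (fun _ : Fin 1 => D d ω) (Fin.succ 0) = D d ω := by
    rw [Fin.partialSum_succ]; simp
  have h0 : Fin.partialSum (fun _ : Fin 1 => D d ω) (Fin.castSucc 0) = 0 := by simp
  rw [h1, h0, add_zero]

/-- The renewal property passes from `T` to the end of the next duration, the arrivals during the
latter being recorded. -/
theorem next (hA : ∀ m, IsPoissonProcess P (A m) (lam m)) (hD : ∀ d, Measurable (D d))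
    (h : Renews P lam A D used T E) (hd : d ∉ used) (x : Fin M → ℕ) :
    Renews P lam A D (insert d used) (fun ω => T ω + D d ω)
      (E ∩ {ω | arrivalsAfter A T (D d) ω = x}) := by
  refine ⟨h.measurable_time.add (hD d), h.measurableSet.inter
    ((measurable_arrivalsAfter hA h.measurable_time (hD d)) (measurableSet_singleton x)),
    fun n e y he heu => ?_⟩
  have key := h.measure_inter (n + 1) (Fin.cons d e) (Fin.cons x y)
    (Fin.cons_injective_iff.2 ⟨?_, he⟩) ?_
  · rw [h.measure_next hd, mul_assoc]
    rw [Fin.prod_univ_succ] at key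
    simp only [Fin.cons_zero, Fin.cons_succ] at key
    rw [← key, Set.inter_assoc]
    congr 2
    ext ω
    have hcons : (fun l => D ((Fin.cons d e : Fin (n + 1) → DurationIndex) l) ω) =
        Fin.cons (D d ω) fun l => D (e l) ω := by
      ext l; refine Fin.cases ?_ (fun l => ?_) l <;> simp
    simp only [Set.mem_inter_iff, Set.mem_ofPred_eq, Fin.forall_fin_succ, hcons,
      Fin.partialSum_succ', Fin.cons_zero, Fin.tail_cons, Fin.castSucc_zero, Fin.partialSum_zero,
      add_zero, Fin.cons_succ, ← Fin.succ_castSucc, arrivalsAfter, funext_iff, add_assoc]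
  · rintro ⟨j, rfl⟩
    exact heu j (Set.mem_insert _ _)
  · intro j
    refine Fin.cases ?_ (fun j => ?_) j
    · simpa using hd
    · simpa using fun hj => heu j (Set.mem_insert_of_mem _ hj)

variable {W : Ω → Fin M → ℕ}

/-- The renewal property after the next duration, when only a function of the present state `W` and
of the arrivals is recorded. -/
theorem next_of_mem (hA : ∀ m, IsPoissonProcess P (A m) (lam m)) (hD : ∀ d, Measurable (D d))
    (hT : Measurable T)
    (h : ∀ w, Renews P lam A D used T (E ∩ {ω | W ω = w})) (hd : d ∉ used)
    (G : Set ((Fin M → ℕ) × (Fin M → ℕ))) :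
    Renews P lam A D (insert d used) (fun ω => T ω + D d ω)
      (E ∩ {ω | (W ω, arrivalsAfter A T (D d) ω) ∈ G}) := by
  have hset : E ∩ {ω | (W ω, arrivalsAfter A T (D d) ω) ∈ G} =
      ⋃ p : G, E ∩ {ω | W ω = p.1.1} ∩ {ω | arrivalsAfter A T (D d) ω = p.1.2} := by
    ext ω
    simp only [Set.mem_inter_iff, Set.mem_ofPred_eq, Set.mem_iUnion, Subtype.exists, Prod.exists]
    constructor
    · rintro ⟨hE, hG⟩
      exact ⟨_, _, hG, ⟨hE, rfl⟩, rfl⟩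
    · rintro ⟨w, x, hG, ⟨hE, rfl⟩, rfl⟩
      exact ⟨hE, hG⟩
  rw [hset]
  refine iUnion hA hD (hT.add (hD d)) (fun p => (h p.1.1).next hA hD hd p.1.2) ?_
  intro p q hpq
  refine Set.disjoint_left.2 fun ω hp hq => hpq ?_
  exact Subtype.ext (Prod.ext (hp.1.2.symm.trans hq.1.2) (hp.2.symm.trans hq.2))

/-- The arrivals during the next duration are independent of the present state. -/
theorem map_prod_next [IsProbabilityMeasure P] (hA : ∀ m, IsPoissonProcess P (A m) (lam m))
    (hD : ∀ d, Measurable (D d)) (hT : Measurable T) (hW : Measurable W)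
    (h : ∀ w, Renews P lam A D used T (E ∩ {ω | W ω = w})) (hd : d ∉ used) :
    (P.restrict E).map (fun ω => (W ω, arrivalsAfter A T (D d) ω)) =
      ((P.restrict E).map W).prod (arrivalLaw lam (P.map (D d))) := by
  have : IsProbabilityMeasure (P.map (D d)) := Measure.isProbabilityMeasure_map (hD d).aemeasurable
  refine Measure.ext_of_singleton fun p => ?_
  have hX := measurable_arrivalsAfter hA hT (hD d)
  have hp : ({p} : Set ((Fin M → ℕ) × (Fin M → ℕ))) = {p.1} ×ˢ {p.2} := by
    rw [Set.singleton_prod_singleton]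
  rw [Measure.map_apply (hW.prodMk hX) (measurableSet_singleton p),
    Measure.restrict_apply ((hW.prodMk hX) (measurableSet_singleton p)), hp, Measure.prod_prod,
    Measure.map_apply hW (measurableSet_singleton _),
    Measure.restrict_apply (hW (measurableSet_singleton _)), Set.inter_comm (W ⁻¹' _) E]
  refine Eq.trans (congrArg P ?_) ((h p.1).measure_next hd p.2)
  ext ω
  simp only [Set.mem_inter_iff, Set.mem_preimage, Set.mem_prod, Set.mem_singleton_iff,
    Set.mem_ofPred_eq]
  tauto

end Renews

variable [NeZero M] {b : Fin M → ℝ≥0} {C : Fin M → Measure ℝ≥0} {first : Fin M}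
    {N0 : Ω → Fin M → ℕ} {B : ℕ → ℕ → Ω → ℝ≥0} {S : ℕ → Ω → ℝ≥0}

theorem IsInput.renews_initial (h : IsInput P lam b C first N0 A B S) (x : Fin M → ℕ) :
    Renews P lam A (duration B S) ∅ (fun _ => 0) {ω | N0 ω = x} := by
  refine ⟨measurable_const, h.measurable_initial (measurableSet_singleton x),
    fun n d y hd _ => ?_⟩
  simp only [zero_add]
  exact h.measure_arrivals d hd x y

end Renewal

/-! ### The walk embedded in a visit -/

section Visit

variable {M : ℕ} {Ω : Type*} [MeasurableSpace Ω]

/-- The walk of the queue lengths at the successive departures of the `v`-th visit, which is a visit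
to queue `i` starting at time `τ` with queue lengths `ξ`, frozen when queue `i` is empty. -/
def visitWalk (cap : ℕ∞) (A : Fin M → ℝ≥0 → Ω → ℕ) (B : ℕ → ℕ → Ω → ℝ≥0) (v : ℕ) (i : Fin M)
    (τ : Ω → ℝ≥0) (ξ : Ω → Fin M → ℕ) (n : ℕ) (ω : Ω) : Fin M → ℕ :=
  stoppedWalk cap i (ξ ω) (serviceArrivals (fun m t => A m t ω) (τ ω) fun l => B v l ω) n

/-- The durations used up by the first `n` services of the `v`-th visit. -/
def usedBy (used : Set DurationIndex) (v n : ℕ) : Set DurationIndex :=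
  used ∪ {d | ∃ l < n, d = .inl (v, l)}

variable {P : Measure Ω} {lam : Fin M → ℝ≥0} {A : Fin M → ℝ≥0 → Ω → ℕ}
  {B : ℕ → ℕ → Ω → ℝ≥0} {S : ℕ → Ω → ℝ≥0} {used : Set DurationIndex} {cap : ℕ∞} {v : ℕ}
  {i : Fin M} {τ : Ω → ℝ≥0} {ξ : Ω → Fin M → ℕ} {E : Set Ω}

theorem insert_usedBy (used : Set DurationIndex) (v n : ℕ) :
    insert (.inl (v, n)) (usedBy used v n) = usedBy used v (n + 1) := by
  ext d
  simp only [usedBy, Set.mem_insert_iff, Set.mem_union, Set.mem_ofPred_eq, Nat.lt_succ_iff_lt_or_eq,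
    or_and_right, exists_or, exists_eq_left]
  rw [or_comm, or_assoc]

theorem notMem_usedBy (hv : ∀ n, (.inl (v, n) : DurationIndex) ∉ used) (n : ℕ) :
    (.inl (v, n) : DurationIndex) ∉ usedBy used v n := by
  rintro (h | ⟨l, hl, h⟩)
  · exact hv n h
  · simp only [Sum.inl.injEq, Prod.mk.injEq, true_and] at h
    omega

omit [MeasurableSpace Ω] in
theorem serviceArrivals_eq (n : ℕ) (ω : Ω) :
    serviceArrivals (fun m t => A m t ω) (τ ω) (fun l => B v l ω) n =
      arrivalsAfter A (fun ω => departureTime (τ ω) (fun l => B v l ω) n)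
        (duration B S (.inl (v, n))) ω := by
  ext m
  simp only [serviceArrivals, arrivalsAfter, departureTime_succ, duration]

omit [MeasurableSpace Ω] in
theorem visitWalk_succ (n : ℕ) (ω : Ω) :
    visitWalk cap A B v i τ ξ (n + 1) ω =
      if visitWalk cap A B v i τ ξ n ω i = 0 then visitWalk cap A B v i τ ξ n ω
      else step cap i (visitWalk cap A B v i τ ξ n ω)
        (arrivalsAfter A (fun ω => departureTime (τ ω) (fun l => B v l ω) n)
          (duration B S (.inl (v, n))) ω) := by
  rw [← serviceArrivals_eq]; rfl

theorem measurable_visitWalk (hA : ∀ m, IsPoissonProcess P (A m) (lam m))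
    (hB : ∀ v n, Measurable (B v n)) (hτ : Measurable τ) (hξ : Measurable ξ) (n : ℕ) :
    Measurable (visitWalk cap A B v i τ ξ n) :=
  measurable_stoppedWalk cap i hξ
    (X := fun n ω => serviceArrivals (fun m t => A m t ω) (τ ω) (fun l => B v l ω) n)
    (measurable_serviceArrivals hA hτ (hB v)) n

variable (hA : ∀ m, IsPoissonProcess P (A m) (lam m)) (hB : ∀ v n, Measurable (B v n))
  (hS : ∀ v, Measurable (S v)) (hτ : Measurable τ) (hξ : Measurable ξ)
  (hv : ∀ n, (.inl (v, n) : DurationIndex) ∉ used)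
  (h : ∀ w, Renews P lam A (duration B S) used τ (E ∩ {ω | ξ ω = w}))

include hB hS in
theorem measurable_duration (d : DurationIndex) : Measurable (duration B S d) := by
  rcases d with p | v
  · exact hB _ _
  · exact hS _

include hA hB hS hτ hv h

theorem renews_visitWalk (n : ℕ) (w : Fin M → ℕ) :
    Renews P lam A (duration B S) (usedBy used v n)
      (fun ω => departureTime (τ ω) (fun l => B v l ω) n)
      (E ∩ {ω | visitWalk cap A B v i τ ξ n ω = w}) := by
  induction n generalizing w with
  | zero =>
    exact ((h w).mono Set.subset_union_left).congr_time (measurable_departureTime hτ (hB v) 0)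
      fun ω _ => by simp [departureTime]
  | succ n ih =>
    have := Renews.next_of_mem hA (measurable_duration hB hS)
      (measurable_departureTime hτ (hB v) n) ih (notMem_usedBy hv n)
      {p | (if p.1 i = 0 then p.1 else step cap i p.1 p.2) = w}
    rw [insert_usedBy] at this
    simp only [visitWalk_succ (S := S), departureTime_succ]
    exact this

/-- The renewal property at the `n`-th departure, if the visit has not ended before. -/
theorem renews_visitWalk_first (n : ℕ) (w : Fin M → ℕ) :
    Renews P lam A (duration B S) (usedBy used v n)
      (fun ω => departureTime (τ ω) (fun l => B v l ω) n)
      (E ∩ {ω | ∀ l < n, visitWalk cap A B v i τ ξ l ω i ≠ 0} ∩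
        {ω | visitWalk cap A B v i τ ξ n ω = w}) := by
  induction n generalizing w with
  | zero =>
    have := renews_visitWalk (cap := cap) (i := i) hA hB hS hτ hv h 0 w
    simpa using this
  | succ n ih =>
    have := Renews.next_of_mem hA (measurable_duration hB hS)
      (measurable_departureTime hτ (hB v) n) ih (notMem_usedBy hv n)
      {p | p.1 i ≠ 0 ∧ step cap i p.1 p.2 = w}
    rw [insert_usedBy] at this
    simp_rw [departureTime_succ]
    refine Eq.mp (congrArg (Renews P lam A (duration B S) (usedBy used v (n + 1)) _) ?_) this
    ext ω
    simp only [Set.mem_inter_iff, Set.mem_ofPred_eq, visitWalk_succ (S := S),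
      Nat.lt_succ_iff_lt_or_eq, or_imp, forall_and, forall_eq]
    symm
    constructor
    · rintro ⟨⟨hE, hl, hn⟩, hw⟩
      rw [if_neg hn] at hw
      exact ⟨⟨hE, hl⟩, hn, hw⟩
    · rintro ⟨⟨hE, hl⟩, hn, hw⟩
      exact ⟨⟨hE, hl, hn⟩, by rw [if_neg hn, hw]⟩

/-- The renewal property at the end of an exhaustive visit. -/
theorem renews_visitEnd (hξ : Measurable ξ)
    (hend : ∀ᵐ ω ∂P, ω ∈ E → ∃ n, visitWalk cap A B v i τ ξ n ω i = 0) (hE : MeasurableSet E)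
    (w : Fin M → ℕ) :
    Renews P lam A (duration B S) (used ∪ {d | ∃ l, d = .inl (v, l)})
      (fun ω => (visitEnd ⊤ cap (fun m t => A m t ω) i (τ ω) (fun l => B v l ω) (ξ ω)).1)
      (E ∩ {ω | (visitEnd ⊤ cap (fun m t => A m t ω) i (τ ω) (fun l => B v l ω) (ξ ω)).2 = w}) := by
  have hmeas := measurable_visitEnd hA hτ (hB v) hξ ⊤ cap i
  have hfirst : ∀ (n : ℕ) (ω : Ω), (∀ l < n, visitWalk cap A B v i τ ξ l ω i ≠ 0) →
      visitWalk cap A B v i τ ξ n ω i = 0 →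
      visitEnd ⊤ cap (fun m t => A m t ω) i (τ ω) (fun l => B v l ω) (ξ ω) =
        (departureTime (τ ω) (fun l => B v l ω) n, visitWalk cap A B v i τ ξ n ω) :=
    fun n ω hl h0 => visitEnd_top_of_first_zero h0 hl
  let F : {n : ℕ // w i = 0} → Set Ω := fun n =>
    E ∩ {ω | ∀ l < n.1, visitWalk cap A B v i τ ξ l ω i ≠ 0} ∩
        {ω | visitWalk cap A B v i τ ξ n.1 ω = w}
  have hF : ∀ n, Renews P lam A (duration B S) (used ∪ {d | ∃ l, d = .inl (v, l)})
      (fun ω => (visitEnd ⊤ cap (fun m t => A m t ω) i (τ ω) (fun l => B v l ω) (ξ ω)).1) (F n) := by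
    rintro ⟨n, hn⟩
    refine ((renews_visitWalk_first (cap := cap) (i := i) hA hB hS hτ hv h n w).mono
      ?_).congr_time (measurable_fst.comp hmeas) ?_
    · exact Set.union_subset_union_right _ fun d ⟨l, _, hl⟩ => ⟨l, hl⟩
    · rintro ω ⟨⟨_, hl⟩, hw⟩
      rw [hfirst n ω hl (by rw [show visitWalk cap A B v i τ ξ n ω = w from hw, hn])]
  have hdisj : Pairwise (Function.onFun Disjoint F) := by
    have hlt : ∀ a c : {n : ℕ // w i = 0}, a.1 < c.1 → Disjoint (F a) (F c) := by
      intro a c hac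
      refine Set.disjoint_left.2 fun ω ha hc => hc.1.2 a.1 hac ?_
      rw [show visitWalk cap A B v i τ ξ a.1 ω = w from ha.2, a.2]
    intro a c hac
    rcases lt_or_gt_of_ne fun heq => hac (Subtype.ext heq) with hlt' | hlt'
    · exact hlt a c hlt'
    · exact (hlt c a hlt').symm
  refine (Renews.iUnion hA (measurable_duration hB hS) (measurable_fst.comp hmeas) hF
    hdisj).congr_ae (hE.inter ((measurable_snd.comp hmeas) (measurableSet_singleton w))) ?_
  filter_upwards [hend] with ω hω
  refine propext ⟨?_, ?_⟩
  · rintro ⟨hE, hw⟩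
    classical
    have hex := hω hE
    have h0 := Nat.find_spec hex
    have hl : ∀ l < Nat.find hex, visitWalk cap A B v i τ ξ l ω i ≠ 0 := fun l => Nat.find_min hex
    have hW : visitWalk cap A B v i τ ξ (Nat.find hex) ω = w :=
      (congrArg Prod.snd (hfirst _ ω hl h0)).symm.trans hw
    exact Set.mem_iUnion.2 ⟨⟨Nat.find hex, by rw [← hW]; exact h0⟩, ⟨hE, hl⟩, hW⟩
  · intro hU
    obtain ⟨⟨n, hn⟩, ⟨hE, hl⟩, hW⟩ := Set.mem_iUnion.1 hU
    have hW' : visitWalk cap A B v i τ ξ n ω = w := hW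
    exact ⟨hE, (congrArg Prod.snd (hfirst n ω hl (by rw [hW', hn]))).trans hW'⟩

variable [IsProbabilityMeasure P] {C : Measure ℝ≥0} (hlaw : ∀ n, P.map (B v n) = C)

include hlaw hξ

theorem map_visitWalk_prod (n : ℕ) :
    (P.restrict E).map (fun ω => (visitWalk cap A B v i τ ξ n ω,
        arrivalsAfter A (fun ω => departureTime (τ ω) (fun l => B v l ω) n)
          (duration B S (.inl (v, n))) ω)) =
      ((P.restrict E).map (visitWalk cap A B v i τ ξ n)).prod (arrivalLaw lam C) := by
  rw [← hlaw n]
  exact Renews.map_prod_next hA (measurable_duration hB hS) (measurable_departureTime hτ (hB v) n)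
    (measurable_visitWalk hA hB hτ hξ n) (renews_visitWalk hA hB hS hτ hv h n) (notMem_usedBy hv n)

/-- A bounded function that is harmonic for the walk embedded in a visit has a constant mean. -/
theorem integral_visitWalk {H : (Fin M → ℕ) → ℂ} {c : ℝ} (hH : ∀ w, ‖H w‖ ≤ c)
    (hharm : ∀ w, w i ≠ 0 → ∫ x, H (step cap i w x) ∂arrivalLaw lam C = H w) (n : ℕ) :
    ∫ ω in E, H (visitWalk cap A B v i τ ξ n ω) ∂P = ∫ ω in E, H (ξ ω) ∂P := by
  induction n with
  | zero => rfl
  | succ n ih =>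
    have : IsProbabilityMeasure C := hlaw 0 ▸ Measure.isProbabilityMeasure_map (hB v 0).aemeasurable
    rw [← ih]
    let g : (Fin M → ℕ) × (Fin M → ℕ) → ℂ := fun p =>
      H (if p.1 i = 0 then p.1 else step cap i p.1 p.2)
    have hW := measurable_visitWalk (cap := cap) (v := v) (i := i) hA hB hτ hξ n
    have hX := measurable_arrivalsAfter hA (measurable_departureTime hτ (hB v) n)
      (measurable_duration hB hS (.inl (v, n)))
    have hprod := map_visitWalk_prod (cap := cap) (i := i) hA hB hS hτ hξ hv h hlaw n
    have hg : Integrable g (((P.restrict E).map (visitWalk cap A B v i τ ξ n)).prod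
        (arrivalLaw lam C)) :=
      Integrable.of_bound (measurable_of_countable g).aestronglyMeasurable c
        (ae_of_all _ fun p => hH _)
    calc ∫ ω in E, H (visitWalk cap A B v i τ ξ (n + 1) ω) ∂P
        = ∫ ω in E, g (visitWalk cap A B v i τ ξ n ω,
            arrivalsAfter A (fun ω => departureTime (τ ω) (fun l => B v l ω) n)
              (duration B S (.inl (v, n))) ω) ∂P := by
          simp only [g, visitWalk_succ (S := S)]
      _ = ∫ p, g p ∂((P.restrict E).map (visitWalk cap A B v i τ ξ n)).prod (arrivalLaw lam C) := by
          rw [← hprod, integral_map (hW.prodMk hX).aemeasurable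
            (measurable_of_countable g).aestronglyMeasurable]
      _ = ∫ w, H w ∂(P.restrict E).map (visitWalk cap A B v i τ ξ n) := by
          rw [integral_prod _ hg]
          refine integral_congr_ae (ae_of_all _ fun w => ?_)
          by_cases hw : w i = 0
          · simp [g, hw]
          · simp only [g, hw, if_false]
            exact hharm w hw
      _ = _ := integral_map hW.aemeasurable (measurable_of_countable H).aestronglyMeasurable

/-- Optional stopping: a bounded harmonic function has the same mean at the end of the exhaustive
visit as at its beginning. -/
theorem integral_visitEnd {H : (Fin M → ℕ) → ℂ} {c : ℝ} (hH : ∀ w, ‖H w‖ ≤ c)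
    (hharm : ∀ w, w i ≠ 0 → ∫ x, H (step cap i w x) ∂arrivalLaw lam C = H w)
    (hend : ∀ᵐ ω ∂P, ∃ n, visitWalk cap A B v i τ ξ n ω i = 0) :
    ∫ ω in E, H (visitEnd ⊤ cap (fun m t => A m t ω) i (τ ω) (fun l => B v l ω) (ξ ω)).2 ∂P =
      ∫ ω in E, H (ξ ω) ∂P := by
  have hlim : Tendsto (fun n => ∫ ω in E, H (visitWalk cap A B v i τ ξ n ω) ∂P) atTop
      (𝓝 (∫ ω in E,
        H (visitEnd ⊤ cap (fun m t => A m t ω) i (τ ω) (fun l => B v l ω) (ξ ω)).2 ∂P)) := by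
    refine tendsto_integral_of_dominated_convergence (fun _ => c) (fun n => ?_)
      (integrable_const c) (fun n => ae_of_all _ fun ω => hH _) ?_
    · exact ((measurable_of_countable H).comp
        (measurable_visitWalk hA hB hτ hξ n)).aestronglyMeasurable
    · filter_upwards [ae_restrict_of_ae hend] with ω ⟨N, hN⟩
      refine tendsto_const_nhds.congr' ?_
      filter_upwards [eventually_ge_atTop N] with n hn
      congr 1
      have hW : visitWalk cap A B v i τ ξ n ω = visitWalk cap A B v i τ ξ N ω :=
        stoppedWalk_of_zero hN hn
      exact visitEnd_top_eq_stoppedWalk (by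
        change visitWalk cap A B v i τ ξ n ω i = 0
        rw [hW, hN])
  refine tendsto_nhds_unique hlim ?_
  simp only [integral_visitWalk hA hB hS hτ hξ hv h hlaw hH hharm]
  exact tendsto_const_nhds

/-- A Foster–Lyapunov criterion: if a function of the state that is at least `1` as long as the
visit lasts decreases geometrically in the mean, then the visit ends almost surely. -/
theorem ae_exists_visitWalk_eq_zero {f : (Fin M → ℕ) → ℝ≥0∞} {θ : ℝ≥0∞} (hθ : θ < 1)
    (hf1 : ∀ w, 1 ≤ f w) (hftop : ∀ w, f w ≠ ∞)
    (hdrift : ∀ w, w i ≠ 0 → ∫⁻ x, f (step cap i w x) ∂arrivalLaw lam C ≤ θ * f w)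
    (hE : MeasurableSet E) :
    ∀ᵐ ω ∂P, ω ∈ E → ∃ n, visitWalk cap A B v i τ ξ n ω i = 0 := by
  have : IsProbabilityMeasure C := hlaw 0 ▸ Measure.isProbabilityMeasure_map (hB v 0).aemeasurable
  -- The drift bounds nothing unless the initial mean is finite: fix the initial state `w₀`.
  suffices hsuff : ∀ w₀, ∀ᵐ ω ∂P, ω ∈ E ∩ {ω | ξ ω = w₀} →
      ∃ n, visitWalk cap A B v i τ ξ n ω i = 0 by
    filter_upwards [ae_all_iff.2 hsuff] with ω hω hE using hω (ξ ω) ⟨hE, rfl⟩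
  intro w₀
  have hE₀ : MeasurableSet (E ∩ {ω | ξ ω = w₀}) := hE.inter (hξ (measurableSet_singleton w₀))
  have h' : ∀ w, Renews P lam A (duration B S) used τ (E ∩ {ω | ξ ω = w₀} ∩ {ω | ξ ω = w}) := by
    intro w
    by_cases hw : w = w₀
    · subst hw
      rw [Set.inter_assoc, Set.inter_self]
      exact h w
    · have hempty : E ∩ {ω | ξ ω = w₀} ∩ {ω | ξ ω = w} = ∅ :=
        Set.eq_empty_iff_forall_notMem.2 fun ω hω => hw (hω.2.symm.trans hω.1.2)
      rw [hempty]
      exact Renews.empty hτ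
  let f' : (Fin M → ℕ) → ℝ≥0∞ := fun w => if w i = 0 then 0 else f w
  have hf' : ∀ w, f' w ≤ f w := fun w => by
    simp only [f']; split_ifs
    · exact zero_le
    · exact le_rfl
  -- `e n` is the mean of `f` on the event that the visit lasts longer than `n` services.
  let e : ℕ → ℝ≥0∞ := fun n =>
    ∫⁻ ω in E ∩ {ω | ξ ω = w₀}, f' (visitWalk cap A B v i τ ξ n ω) ∂P
  have he0 : e 0 ≤ f w₀ := by
    calc e 0 ≤ ∫⁻ ω in E ∩ {ω | ξ ω = w₀}, f w₀ ∂P := by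
          refine setLIntegral_mono' hE₀ fun ω hω => ?_
          have : visitWalk cap A B v i τ ξ 0 ω = w₀ := hω.2
          rw [this]
          exact hf' w₀
      _ ≤ f w₀ := by
          rw [setLIntegral_const]
          exact mul_le_of_le_one_right' prob_le_one
  have hstep : ∀ n, e (n + 1) ≤ θ * e n := by
    intro n
    have hW := measurable_visitWalk (cap := cap) (v := v) (i := i) hA hB hτ hξ n
    have hX := measurable_arrivalsAfter hA (measurable_departureTime hτ (hB v) n)
      (measurable_duration hB hS (.inl (v, n)))
    have hprod := map_visitWalk_prod (cap := cap) (i := i) hA hB hS hτ hξ hv h' hlaw n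
    let g : (Fin M → ℕ) × (Fin M → ℕ) → ℝ≥0∞ := fun p =>
      f' (if p.1 i = 0 then p.1 else step cap i p.1 p.2)
    calc e (n + 1)
        = ∫⁻ ω in E ∩ {ω | ξ ω = w₀}, g (visitWalk cap A B v i τ ξ n ω,
            arrivalsAfter A (fun ω => departureTime (τ ω) (fun l => B v l ω) n)
              (duration B S (.inl (v, n))) ω) ∂P := by
          simp only [e, g, visitWalk_succ (S := S)]
      _ = ∫⁻ w, ∫⁻ x, g (w, x) ∂arrivalLaw lam C
            ∂(P.restrict (E ∩ {ω | ξ ω = w₀})).map (visitWalk cap A B v i τ ξ n) := by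
          rw [← lintegral_prod _ (measurable_of_countable g).aemeasurable, ← hprod,
            lintegral_map (measurable_of_countable g) (hW.prodMk hX)]
      _ ≤ ∫⁻ w, θ * f' w
            ∂(P.restrict (E ∩ {ω | ξ ω = w₀})).map (visitWalk cap A B v i τ ξ n) := by
          refine lintegral_mono fun w => ?_
          by_cases hw : w i = 0
          · simp [g, f', hw]
          · simp only [g, hw, if_false]
            refine (lintegral_mono fun x => hf' _).trans ((hdrift w hw).trans_eq ?_)
            simp only [f', hw, if_false]
      _ = θ * e n := by
          rw [lintegral_const_mul _ (measurable_of_countable f'),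
            lintegral_map (measurable_of_countable f') hW]
  have hen : ∀ n, e n ≤ θ ^ n * f w₀ := by
    intro n
    induction n with
    | zero => simpa using he0
    | succ n ih =>
      calc e (n + 1) ≤ θ * e n := hstep n
        _ ≤ θ * (θ ^ n * f w₀) := by gcongr
        _ = θ ^ (n + 1) * f w₀ := by ring
  have hbad : ∀ n, P {ω | ω ∈ E ∩ {ω | ξ ω = w₀} ∧ ∀ n, visitWalk cap A B v i τ ξ n ω i ≠ 0} ≤
      θ ^ n * f w₀ := by
    intro n
    have hmeas : MeasurableSet {ω | visitWalk cap A B v i τ ξ n ω i ≠ 0} :=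
      (((measurable_pi_apply i).comp (measurable_visitWalk hA hB hτ hξ n))
        (measurableSet_singleton 0)).compl
    calc P {ω | ω ∈ E ∩ {ω | ξ ω = w₀} ∧ ∀ n, visitWalk cap A B v i τ ξ n ω i ≠ 0}
        ≤ (P.restrict (E ∩ {ω | ξ ω = w₀})) {ω | visitWalk cap A B v i τ ξ n ω i ≠ 0} := by
          rw [Measure.restrict_apply hmeas]
          exact measure_mono fun ω hω => ⟨hω.2 n, hω.1⟩
      _ = ∫⁻ ω in E ∩ {ω | ξ ω = w₀},
            {ω | visitWalk cap A B v i τ ξ n ω i ≠ 0}.indicator 1 ω ∂P :=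
          (lintegral_indicator_one hmeas).symm
      _ ≤ e n := by
          refine lintegral_mono fun ω => ?_
          by_cases hω : visitWalk cap A B v i τ ξ n ω i = 0
          · simp [hω]
          · simpa [hω, f'] using hf1 _
      _ ≤ _ := hen n
  have hlim : Tendsto (fun n => θ ^ n * f w₀) atTop (𝓝 0) := by
    simpa using ENNReal.Tendsto.mul_const (ENNReal.tendsto_pow_atTop_nhds_zero_of_lt_one hθ)
      (Or.inr (hftop w₀))
  have hzero := le_antisymm (ge_of_tendsto' hlim hbad) zero_le
  rw [ae_iff]
  refine measure_mono_null (fun ω hω => ?_) hzero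
  simpa only [Set.mem_ofPred_eq, Classical.not_imp, not_exists] using hω

end Visit

/-! ### Exponential service times -/

section ExponentialLaw

/-- The exponential law of rate `r`, as a law on `ℝ≥0`. -/
def serviceLaw (r : ℝ) : Measure ℝ≥0 := (expMeasure r).map Real.toNNReal

theorem map_eq_serviceLaw {Ω : Type*} [MeasurableSpace Ω] {P : Measure Ω} {B : Ω → ℝ≥0}
    (hB : Measurable B) {r : ℝ} (h : P.map (fun ω => (B ω : ℝ)) = expMeasure r) :
    P.map B = serviceLaw r := by
  rw [serviceLaw, ← h, Measure.map_map measurable_real_toNNReal (by fun_prop)]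
  congr 1
  ext ω
  simp

theorem isProbabilityMeasure_serviceLaw {r : ℝ} (hr : 0 < r) :
    IsProbabilityMeasure (serviceLaw r) := by
  have := isProbabilityMeasure_expMeasure hr
  exact Measure.isProbabilityMeasure_map measurable_real_toNNReal.aemeasurable

theorem integral_serviceLaw {r : ℝ} (hr : 0 < r) {F : ℝ → ℂ} (hF : Measurable F) :
    ∫ t, F (t : ℝ) ∂serviceLaw r = ∫ x in Set.Ioi (0 : ℝ), (r * Real.exp (-(r * x))) • F x := by
  rw [serviceLaw, integral_map measurable_real_toNNReal.aemeasurable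
    (by fun_prop : Measurable fun t : ℝ≥0 => F t).aestronglyMeasurable, expMeasure, gammaMeasure,
    show gammaPDF 1 r = fun x => ENNReal.ofReal (gammaPDFReal 1 r x) from rfl,
    integral_withDensity_eq_integral_toReal_smul
      (measurable_gammaPDFReal 1 r).ennreal_ofReal
      (ae_of_all _ fun x => ENNReal.ofReal_lt_top), ← integral_Ici_eq_integral_Ioi,
    ← integral_indicator measurableSet_Ici]
  congr 1
  ext x
  change (exponentialPDF r x).toReal • _ = _
  rw [exponentialPDF_eq]
  by_cases hx : 0 ≤ x
  · rw [if_pos hx, Set.indicator_of_mem (Set.mem_Ici.2 hx), ENNReal.toReal_ofReal (by positivity),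
      Real.coe_toNNReal x hx]
  · rw [if_neg hx, Set.indicator_of_notMem (by simpa using hx)]
    simp

theorem integrableOn_pow_mul_cexp {c : ℂ} (hc : 0 < c.re) (n : ℕ) :
    IntegrableOn (fun x : ℝ => (x : ℂ) ^ n * Complex.exp (-(c * x))) (Set.Ioi 0) := by
  have h := integrableOn_rpow_mul_exp_neg_mul_rpow (p := 1) (s := n) (b := c.re)
    (by linarith [n.cast_nonneg (α := ℝ)]) one_pos hc
  refine h.mono' (by fun_prop) ?_
  filter_upwards [ae_restrict_mem measurableSet_Ioi] with x hx
  rw [norm_mul, norm_pow, Complex.norm_real, Complex.norm_exp, Real.norm_eq_abs,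
    abs_of_pos hx, Real.rpow_natCast, Real.rpow_one]
  simp

theorem integral_pow_mul_cexp {c : ℂ} (hc : 0 < c.re) (n : ℕ) :
    ∫ x in Set.Ioi (0 : ℝ), (x : ℂ) ^ n * Complex.exp (-(c * x)) =
      n.factorial / c ^ (n + 1) := by
  have hc0 : c ≠ 0 := fun h => by simp [h] at hc
  have hexp : ∀ x : ℝ, HasDerivAt (fun x : ℝ => Complex.exp (-(c * x)))
      (-c * Complex.exp (-(c * x))) x := fun x => by
    have h1 : HasDerivAt (fun x : ℝ => -(c * (x : ℂ))) (-c) x := by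
      simpa using ((hasDerivAt_id x).ofReal_comp.const_mul c).fun_neg
    simpa [mul_comm] using h1.cexp
  induction n with
  | zero =>
    have hI := integrableOn_pow_mul_cexp hc 0
    simp only [pow_zero, one_mul] at hI
    have hlim := tendsto_zero_of_hasDerivAt_of_integrableOn_Ioi (a := 0) (fun x _ => hexp x)
      (hI.const_mul (-c)) hI
    have := integral_Ioi_of_hasDerivAt_of_tendsto' (a := 0) (fun x _ => hexp x)
      (hI.const_mul (-c)) hlim
    rw [integral_const_mul] at this
    simp only [pow_zero, one_mul, Nat.factorial_zero, Nat.cast_one, zero_add, pow_one]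
    rw [eq_div_iff hc0]
    simp only [Complex.ofReal_zero, mul_zero, neg_zero, Complex.exp_zero] at this
    linear_combination -this
  | succ n ih =>
    have hI := integrableOn_pow_mul_cexp hc n
    have hI' := integrableOn_pow_mul_cexp hc (n + 1)
    have hder : ∀ x : ℝ, HasDerivAt (fun x : ℝ => (x : ℂ) ^ (n + 1) * Complex.exp (-(c * x)))
        ((n + 1) * ((x : ℂ) ^ n * Complex.exp (-(c * x))) -
          c * ((x : ℂ) ^ (n + 1) * Complex.exp (-(c * x)))) x := fun x => by
      have hp : HasDerivAt (fun x : ℝ => (x : ℂ) ^ (n + 1)) ((n + 1) * (x : ℂ) ^ n) x := by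
        simpa using (hasDerivAt_id x).ofReal_comp.fun_pow (n + 1)
      refine (hp.fun_mul (hexp x)).congr_deriv ?_
      ring
    have hint := (hI.const_mul ((n : ℂ) + 1)).sub (hI'.const_mul c)
    have hlim := tendsto_zero_of_hasDerivAt_of_integrableOn_Ioi (a := 0) (fun x _ => hder x)
      hint hI'
    have := integral_Ioi_of_hasDerivAt_of_tendsto' (a := 0) (fun x _ => hder x) hint hlim
    rw [integral_sub (hI.const_mul _) (hI'.const_mul _), integral_const_mul, integral_const_mul,
      ih] at this
    simp only [Complex.ofReal_zero, ne_eq, Nat.add_eq_zero_iff, one_ne_zero, and_false,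
      not_false_eq_true, zero_pow, zero_mul, sub_zero] at this
    rw [Nat.factorial_succ, pow_succ _ (n + 1)]
    push_cast
    rw [eq_div_iff (by positivity)]
    field_simp at this
    linear_combination -this

/-- The number of Poisson arrivals (rate `ℓ`) during an exponential time of rate `r` that is
discounted at rate `o` has geometric weights. -/
theorem integral_serviceLaw_poisson {r : ℝ} (hr : 0 < r) (ℓ : ℝ≥0) {o : ℂ} (ho : 0 ≤ o.re) (n : ℕ) :
    ∫ t : ℝ≥0, Complex.exp (-(o * (t : ℝ))) *
        ((Real.exp (-(ℓ * t : ℝ≥0)) * (ℓ * t : ℝ≥0) ^ n / n.factorial : ℝ) : ℂ) ∂serviceLaw r =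
      r / (r + ℓ + o) * (ℓ / (r + ℓ + o)) ^ n := by
  have hc : 0 < (r + ℓ + o : ℂ).re := by
    simp only [Complex.add_re, Complex.ofReal_re]
    have := ℓ.2
    positivity
  have hc0 : (r + ℓ + o : ℂ) ≠ 0 := fun h => by rw [h] at hc; simp at hc
  simp_rw [NNReal.coe_mul]
  rw [integral_serviceLaw hr (F := fun t => Complex.exp (-(o * (t : ℝ))) *
    ((Real.exp (-(ℓ * t)) * (ℓ * t) ^ n / n.factorial : ℝ) : ℂ)) (by fun_prop)]
  have hfun : ∀ x : ℝ, (r * Real.exp (-(r * x))) • (Complex.exp (-(o * (x : ℝ))) *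
      ((Real.exp (-(ℓ * x)) * (ℓ * x) ^ n / n.factorial : ℝ) : ℂ)) =
      (r * (ℓ : ℂ) ^ n / n.factorial) * ((x : ℂ) ^ n * Complex.exp (-((r + ℓ + o) * x))) := by
    intro x
    have : Complex.exp (-((r + ℓ + o) * x)) =
        Complex.exp (-(r * x)) * Complex.exp (-(ℓ * x)) * Complex.exp (-(o * x)) := by
      rw [← Complex.exp_add, ← Complex.exp_add]; ring_nf
    rw [this, Complex.real_smul]
    push_cast
    rw [mul_pow]
    ring
  simp_rw [hfun]
  rw [integral_const_mul, integral_pow_mul_cexp hc]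
  have : (n.factorial : ℂ) ≠ 0 := by exact_mod_cast n.factorial_ne_zero
  rw [div_pow, pow_succ]
  field_simp

end ExponentialLaw

section ServiceArrivals

variable {M : ℕ} {lam : Fin M → ℝ≥0} {i : Fin M} {z : Fin M → ℂ}

theorem otherRate_re_nonneg (hz : ∀ m, ‖z m‖ ≤ 1) : 0 ≤ (otherRate lam i z).re := by
  rw [otherRate, Complex.re_sum]
  refine Finset.sum_nonneg fun m _ => ?_
  rw [Complex.re_ofReal_mul]
  refine mul_nonneg (lam m).2 ?_
  simpa using (Complex.re_le_norm _).trans (hz m)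

theorem integral_pow_poissonMeasure (ρ : ℝ≥0) (z : ℂ) :
    ∫ n, z ^ n ∂poissonMeasure ρ = Complex.exp (-(ρ * (1 - z))) := by
  rw [integral_poissonMeasure]
  have h := (NormedSpace.expSeries_div_hasSum_exp ((ρ : ℂ) * z)).mul_left (Complex.exp (-ρ))
  rw [← Complex.exp_eq_exp_ℂ, ← Complex.exp_add] at h
  rw [show -((ρ : ℂ) * (1 - z)) = -ρ + ρ * z by ring, ← h.tsum_eq]
  refine tsum_congr fun n => ?_
  rw [Complex.real_smul]
  push_cast
  rw [mul_pow]
  ring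

theorem integral_arrivals_fixed_time (t : ℝ≥0) (g : ℕ → ℂ) :
    ∫ x, (∏ m ∈ Finset.univ.erase i, z m ^ x m) * g (x i)
        ∂(Measure.pi fun m => poissonMeasure (lam m * t)) =
      Complex.exp (-(otherRate lam i z * (t : ℝ))) * ∫ n, g n ∂poissonMeasure (lam i * t) := by
  let f : Fin M → ℕ → ℂ := fun m n => if m = i then g n else z m ^ n
  have hf : ∀ x : Fin M → ℕ, (∏ m ∈ Finset.univ.erase i, z m ^ x m) * g (x i) =
      ∏ m, f m (x m) := fun x => by
    rw [← Finset.prod_erase_mul _ _ (Finset.mem_univ i)]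
    congr 1
    · exact Finset.prod_congr rfl fun m hm => by simp [f, Finset.ne_of_mem_erase hm]
    · simp [f]
  simp_rw [hf]
  rw [integral_fintype_prod_eq_prod, ← Finset.prod_erase_mul _ _ (Finset.mem_univ i)]
  congr 1
  · rw [otherRate, Finset.sum_mul, ← Finset.sum_neg_distrib, Complex.exp_sum]
    refine Finset.prod_congr rfl fun m hm => ?_
    simp only [f, Finset.ne_of_mem_erase hm, if_false]
    rw [integral_pow_poissonMeasure]
    push_cast
    ring_nf
  · simp [f]

/-- The joint weights of the arrivals during a service: the arrivals to the other queues, marked by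
`z`, discount the service at the rate `otherRate`, and the arrivals to queue `i` are geometric. -/
theorem hasSum_arrivals_service {r : ℝ} (hr : 0 < r) (hz : ∀ m, ‖z m‖ ≤ 1) {g : ℕ → ℂ} {c : ℝ}
    (hg : ∀ n, ‖g n‖ ≤ c) :
    HasSum (fun n => (r : ℂ) / (r + lam i + otherRate lam i z) *
        (lam i / (r + lam i + otherRate lam i z)) ^ n * g n)
      (∫ x, (∏ m ∈ Finset.univ.erase i, z m ^ x m) * g (x i) ∂arrivalLaw lam (serviceLaw r)) := by
  have := isProbabilityMeasure_serviceLaw hr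
  have ho : 0 ≤ (otherRate lam i z).re := otherRate_re_nonneg hz
  rw [integral_arrivalLaw lam _ (c := c) fun x => ?_]
  · simp_rw [integral_arrivals_fixed_time]
    let p : ℕ → ℝ≥0 → ℝ := fun n t =>
      Real.exp (-(lam i * t : ℝ≥0)) * (lam i * t : ℝ≥0) ^ n / n.factorial
    have hp : ∀ n t, 0 ≤ p n t := fun n t => by positivity
    have hpsum : ∀ t, HasSum (fun n => p n t) 1 := fun t => hasSum_one_poissonMeasure _
    have hexp : ∀ t : ℝ≥0, ‖Complex.exp (-(otherRate lam i z * (t : ℝ)))‖ ≤ 1 := fun t => by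
      rw [Complex.norm_exp, Real.exp_le_one_iff, Complex.neg_re, Complex.re_mul_ofReal]
      have := mul_nonneg ho t.2
      exact neg_nonpos.2 this
    have hc : 0 ≤ c := (norm_nonneg _).trans (hg 0)
    have key := hasSum_integral_of_dominated_convergence (μ := serviceLaw r)
      (F := fun n t => Complex.exp (-(otherRate lam i z * (t : ℝ))) * (p n t : ℂ) * g n)
      (f := fun t => Complex.exp (-(otherRate lam i z * (t : ℝ))) *
        ∫ n, g n ∂poissonMeasure (lam i * t))
      (fun n t => p n t * c) (fun n => ?_) (fun n => ae_of_all _ fun t => ?_)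
      (ae_of_all _ fun t => (hpsum t).summable.mul_right c) ?_ (ae_of_all _ fun t => ?_)
    · refine (congrArg (fun f => HasSum f _) (funext fun n => ?_)).mp key
      rw [integral_mul_const, integral_serviceLaw_poisson hr (lam i) ho n]
    · refine Measurable.aestronglyMeasurable ?_
      simp only [p]
      fun_prop
    · rw [norm_mul, norm_mul, Complex.norm_real, Real.norm_of_nonneg (hp n t)]
      exact mul_le_mul (mul_le_of_le_one_left (hp n t) (hexp t)) (hg n) (norm_nonneg _) (hp n t)
    · simp_rw [tsum_mul_right, (hpsum _).tsum_eq]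
      exact integrable_const _
    · have hint : Integrable g (poissonMeasure (lam i * t)) :=
        Integrable.of_bound (measurable_of_countable g).aestronglyMeasurable c (ae_of_all _ hg)
      have := (hasSum_integral_poissonMeasure hint).mul_left
        (Complex.exp (-(otherRate lam i z * (t : ℝ))))
      refine (congrArg (fun f => HasSum f _) (funext fun n => ?_)).mp this
      rw [Complex.real_smul, mul_assoc]
  · rw [norm_mul, norm_prod]
    refine (mul_le_of_le_one_left (norm_nonneg _) ?_).trans (hg _)
    exact Finset.prod_le_one (fun _ _ => norm_nonneg _) fun m _ => by
      rw [norm_pow]; exact pow_le_one₀ (norm_nonneg _) (hz m)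

end ServiceArrivals

/-! ### Harmonic functions of the embedded walk -/

section Harmonic

variable {M : ℕ} {lam b : Fin M → ℝ≥0} {i : Fin M} {z : Fin M → ℂ}

/-- The function `h (wᵢ) ∏_{m ≠ i} zₘ ^ wₘ` of the queue lengths `w`. -/
def markedFun (z : Fin M → ℂ) (i : Fin M) (h : ℕ → ℂ) (w : Fin M → ℕ) : ℂ :=
  h (w i) * ∏ m ∈ Finset.univ.erase i, z m ^ w m

theorem norm_prod_erase_le (hz : ∀ m, ‖z m‖ ≤ 1) (w : Fin M → ℕ) :
    ‖∏ m ∈ Finset.univ.erase i, z m ^ w m‖ ≤ 1 := by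
  rw [norm_prod]
  exact Finset.prod_le_one (fun _ _ => norm_nonneg _) fun m _ => by
    rw [norm_pow]; exact pow_le_one₀ (norm_nonneg _) (hz m)

theorem norm_markedFun_le (hz : ∀ m, ‖z m‖ ≤ 1) {h : ℕ → ℂ} {c : ℝ} (hc : ∀ j, ‖h j‖ ≤ c)
    (w : Fin M → ℕ) : ‖markedFun z i h w‖ ≤ c := by
  rw [markedFun, norm_mul]
  exact (mul_le_of_le_one_right (norm_nonneg _) (norm_prod_erase_le hz w)).trans (hc _)

theorem markedFun_of_zero {h : ℕ → ℂ} (h0 : h 0 = 1) {w : Fin M → ℕ} (hw : w i = 0) :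
    markedFun z i h w = monomial z w := by
  rw [markedFun, monomial, ← Finset.mul_prod_erase _ _ (Finset.mem_univ i), hw, h0, pow_zero]

theorem markedFun_pow (y : ℂ) (w : Fin M → ℕ) :
    markedFun z i (fun j => y ^ j) w = monomial (Function.update z i y) w := by
  rw [markedFun, monomial, ← Finset.mul_prod_erase _ _ (Finset.mem_univ i), Function.update_self]
  congr 1
  exact Finset.prod_congr rfl fun m hm => by
    rw [Function.update_of_ne (Finset.ne_of_mem_erase hm)]

/-- The weight of `n` arrivals to queue `i` during a service, see `hasSum_arrivals_service`. -/
def arrivalWeight (r ℓ : ℝ) (o : ℂ) (n : ℕ) : ℂ := r / (r + ℓ + o) * (ℓ / (r + ℓ + o)) ^ n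

/-- If `h` solves the one-step equations of a queue of capacity `cap`, then `markedFun z i h` is
harmonic for the walk embedded in a visit. -/
theorem integral_step_markedFun {r : ℝ} (hr : 0 < r) (hz : ∀ m, ‖z m‖ ≤ 1) {h : ℕ → ℂ} {c : ℝ}
    (hc : ∀ j, ‖h j‖ ≤ c) {cap : ℕ∞}
    (hh : ∀ j, j ≠ 0 → HasSum (fun n => arrivalWeight r (lam i) (otherRate lam i z) n *
      h ((min ((j + n : ℕ) : ℕ∞) cap).toNat - 1)) (h j))
    {w : Fin M → ℕ} (hw : w i ≠ 0) :
    ∫ x, markedFun z i h (step cap i w x) ∂arrivalLaw lam (serviceLaw r) = markedFun z i h w := by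
  have key := (hasSum_arrivals_service (lam := lam) (i := i) hr hz
    (g := fun n => h ((min ((w i + n : ℕ) : ℕ∞) cap).toNat - 1)) fun n => hc _).unique (hh (w i) hw)
  have hfun : ∀ x : Fin M → ℕ, markedFun z i h (step cap i w x) =
      (∏ m ∈ Finset.univ.erase i, z m ^ w m) * ((∏ m ∈ Finset.univ.erase i, z m ^ x m) *
        h ((min ((w i + x i : ℕ) : ℕ∞) cap).toNat - 1)) := by
    intro x
    have h1 : ∏ m ∈ Finset.univ.erase i, z m ^ step cap i w x m =
        (∏ m ∈ Finset.univ.erase i, z m ^ w m) * ∏ m ∈ Finset.univ.erase i, z m ^ x m := by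
      rw [← Finset.prod_mul_distrib]
      refine Finset.prod_congr rfl fun m hm => ?_
      rw [step, if_neg (Finset.ne_of_mem_erase hm), pow_add]
    rw [markedFun, h1, step, if_pos rfl]
    ring
  simp_rw [hfun]
  rw [integral_const_mul, key, markedFun, mul_comm]

/-! ### The small root -/

theorem re_le_norm_denominator {r : ℝ} (ℓ : ℝ≥0) {o : ℂ} (ho : 0 ≤ o.re) :
    r + ℓ ≤ ‖(r + ℓ + o : ℂ)‖ := by
  refine le_trans ?_ (Complex.re_le_norm _)
  simpa using ho

theorem isSmallRoot_iff {y : ℂ} : IsSmallRoot lam b i z y ↔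
    ‖y‖ ≤ 1 ∧ ((1 / (b i : ℝ) : ℝ) : ℂ) =
      y * (((1 / (b i : ℝ) : ℝ) : ℂ) + (lam i : ℝ) + otherRate lam i z - (lam i : ℝ) * y) := by
  rw [IsSmallRoot]
  refine and_congr_right fun _ => ?_
  push_cast
  constructor <;> intro h <;> linear_combination h

/-- The powers of the small root solve the one-step equations of the unlimited queue. -/
theorem IsSmallRoot.hasSum_pow (hb : 0 < b i) (hz : ∀ m, ‖z m‖ ≤ 1) {y : ℂ}
    (hy : IsSmallRoot lam b i z y) {j : ℕ} (hj : j ≠ 0) :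
    HasSum (fun n => arrivalWeight (1 / (b i : ℝ)) (lam i) (otherRate lam i z) n *
      y ^ ((min ((j + n : ℕ) : ℕ∞) ⊤).toNat - 1)) (y ^ j) := by
  obtain ⟨hy1, hroot⟩ := isSmallRoot_iff.1 hy
  have hr : 0 < 1 / (b i : ℝ) := one_div_pos.2 (NNReal.coe_pos.2 hb)
  simp only [arrivalWeight]
  generalize 1 / (b i : ℝ) = r at hroot hr ⊢
  have hnorm := re_le_norm_denominator (r := r) (lam i) (otherRate_re_nonneg (lam := lam) (i := i) hz)
  generalize otherRate lam i z = o at *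
  set den : ℂ := r + (lam i : ℝ) + o with hden
  have hden0 : 0 < ‖den‖ := (add_pos_of_pos_of_nonneg hr (lam i).2).trans_le hnorm
  have hden' : den ≠ 0 := norm_pos_iff.1 hden0
  have hlt : ‖((lam i : ℝ) : ℂ) * y‖ < ‖den‖ := by
    rw [norm_mul, Complex.norm_real, Real.norm_of_nonneg (lam i).coe_nonneg]
    refine (mul_le_of_le_one_right (lam i).2 hy1).trans_lt (lt_of_lt_of_le ?_ hnorm)
    exact lt_add_of_pos_left _ hr
  have hsub : den - (lam i : ℝ) * y ≠ 0 := fun h0 => by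
    rw [sub_eq_zero] at h0
    rw [← h0] at hlt
    exact lt_irrefl _ hlt
  have hgeo : ‖((lam i : ℝ) : ℂ) * y / den‖ < 1 := by
    rw [norm_div, div_lt_one hden0]
    exact hlt
  have hsum := (hasSum_geometric_of_norm_lt_one hgeo).mul_left (r / den * y ^ (j - 1))
  have hval : r / den * y ^ (j - 1) * (1 - (lam i : ℝ) * y / den)⁻¹ = y ^ j := by
    obtain ⟨j, rfl⟩ := Nat.exists_eq_succ_of_ne_zero hj
    have hy' : (r : ℂ) / (den - (lam i : ℝ) * y) = y := by
      rw [hroot, mul_div_assoc, div_self hsub, mul_one]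
    rw [one_sub_div hden', inv_div, Nat.succ_sub_one, pow_succ]
    calc (r : ℂ) / den * y ^ j * (den / (den - (lam i : ℝ) * y))
        = y ^ j * (r / (den - (lam i : ℝ) * y)) * (den / den) := by ring
      _ = y ^ j * y := by rw [hy', div_self hden', mul_one]
  rw [hval] at hsum
  refine (congrArg (fun f => HasSum f _) (funext fun n => ?_)).mp hsum
  rw [min_top_right, ENat.toNat_natCast, show j + n - 1 = (j - 1) + n by omega, pow_add, div_pow,
    div_pow, mul_pow]
  ring

theorem existsUnique_isSmallRoot (hlam : 0 < lam i) (hb : 0 < b i) (hstable : lam i * b i < 1)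
    (hz : ∀ m, ‖z m‖ ≤ 1) : ∃! y, IsSmallRoot lam b i z y := by
  have hr : 0 < 1 / (b i : ℝ) := one_div_pos.2 (NNReal.coe_pos.2 hb)
  have hlr : (lam i : ℝ) < 1 / (b i : ℝ) := by
    rw [lt_div_iff₀ (NNReal.coe_pos.2 hb)]
    exact_mod_cast hstable
  have hnorm := re_le_norm_denominator (r := 1 / (b i : ℝ)) (lam i)
    (otherRate_re_nonneg (lam := lam) (i := i) hz)
  have hlam' : (0 : ℝ) < lam i := NNReal.coe_pos.2 hlam
  simp only [isSmallRoot_iff]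
  generalize 1 / (b i : ℝ) = r at hlr hr hnorm ⊢
  generalize otherRate lam i z = o at *
  generalize ((lam i : ℝ≥0) : ℝ) = ℓ at hlr hnorm hlam' ⊢
  have hℓ0 : (ℓ : ℂ) ≠ 0 := by exact_mod_cast hlam'.ne'
  set den : ℂ := r + ℓ + o with hden
  obtain ⟨δ, hδ⟩ := IsAlgClosed.exists_eq_mul_self (den ^ 2 - 4 * ℓ * r)
  -- The two roots have product `r / ℓ > 1`, hence are not both in the disk; if both were outside,
  -- the modulus `‖den‖ / ℓ` of their sum would be too small.
  obtain ⟨y₁, y₂, hsum, hprod⟩ : ∃ y₁ y₂ : ℂ, ℓ * (y₁ + y₂) = den ∧ ℓ * (y₁ * y₂) = r := by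
    refine ⟨(den + δ) / (2 * ℓ), (den - δ) / (2 * ℓ), ?_, ?_⟩
    · field_simp; ring
    · have : (den + δ) * (den - δ) = 4 * ℓ * r := by linear_combination hδ
      rw [div_mul_div_comm, this]
      field_simp
      ring
  have hprodn : ℓ * (‖y₁‖ * ‖y₂‖) = r := by
    have := congrArg norm hprod
    rwa [norm_mul, norm_mul, Complex.norm_real, Complex.norm_real, Real.norm_of_nonneg hlam'.le,
      Real.norm_of_nonneg hr.le] at this
  have hsumn : r + ℓ ≤ ℓ * (‖y₁‖ + ‖y₂‖) := by
    refine hnorm.trans ?_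
    rw [← hsum, norm_mul, Complex.norm_real, Real.norm_of_nonneg hlam'.le]
    exact mul_le_mul_of_nonneg_left (norm_add_le _ _) hlam'.le
  have hfac : ∀ y : ℂ, (r : ℂ) = y * (den - ℓ * y) ↔ y = y₁ ∨ y = y₂ := by
    intro y
    rw [← sub_eq_zero, ← sub_eq_zero (a := y), ← sub_eq_zero (a := y), ← mul_eq_zero]
    constructor <;> intro h
    · refine (mul_eq_zero.1 (?_ : (ℓ : ℂ) * ((y - y₁) * (y - y₂)) = 0)).resolve_left hℓ0
      linear_combination h - y * hsum + hprod
    · linear_combination ℓ * h + y * hsum - hprod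
  have hnot : ¬ (‖y₁‖ ≤ 1 ∧ ‖y₂‖ ≤ 1) := by
    rintro ⟨h1, h2⟩
    have := mul_le_one₀ h1 (norm_nonneg y₂) h2
    nlinarith
  have hone : ‖y₁‖ ≤ 1 ∨ ‖y₂‖ ≤ 1 := by
    by_contra! hcon
    nlinarith [mul_pos (sub_pos.2 hcon.1) (sub_pos.2 hcon.2)]
  rcases hone with h1 | h2
  · refine ⟨y₁, ⟨h1, (hfac y₁).2 (Or.inl rfl)⟩, fun y hy => ?_⟩
    rcases (hfac y).1 hy.2 with rfl | rfl
    · rfl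
    · exact absurd ⟨h1, hy.1⟩ hnot
  · refine ⟨y₂, ⟨h2, (hfac y₂).2 (Or.inr rfl)⟩, fun y hy => ?_⟩
    rcases (hfac y).1 hy.2 with rfl | rfl
    · exact absurd ⟨hy.1, h2⟩ hnot
    · rfl

/-! ### The truncated queue -/

/-- The linear equations of the queue of capacity `K + 1` imply the one-step equations. -/
theorem hasSum_truncated {r : ℝ} (hr : 0 < r) (ℓ : ℝ≥0) {o : ℂ} (ho : 0 ≤ o.re) {K : ℕ} {f : ℕ → ℂ}
    (hconst : ∀ j, K + 1 ≤ j → f j = f (K + 1))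
    (hlin : ∀ j, 1 ≤ j → j ≤ K → (r + ℓ + o) * f j = r * f (j - 1) + ℓ * f (j + 1))
    (hlast : (r + o) * f (K + 1) = r * f K) {j : ℕ} (hj : j ≠ 0) :
    HasSum (fun n => arrivalWeight r ℓ o n *
      f ((min ((j + n : ℕ) : ℕ∞) ((K + 1 : ℕ) : ℕ∞)).toNat - 1)) (f j) := by
  have hnorm := re_le_norm_denominator (r := r) ℓ ho
  have hro : (r + o : ℂ) ≠ 0 := fun h => by
    have := congrArg Complex.re h
    simp only [Complex.add_re, Complex.ofReal_re, Complex.zero_re] at this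
    linarith
  have hden0 : 0 < ‖(r + ℓ + o : ℂ)‖ := (add_pos_of_pos_of_nonneg hr ℓ.2).trans_le hnorm
  have hden : (r + ℓ + o : ℂ) ≠ 0 := norm_pos_iff.1 hden0
  have hmin : ∀ p : ℕ, (min (p : ℕ∞) ((K + 1 : ℕ) : ℕ∞)).toNat = min p (K + 1) := fun p => by
    rcases le_total p (K + 1) with hp | hp
    · rw [min_eq_left hp, min_eq_left (by exact_mod_cast hp), ENat.toNat_natCast]
    · rw [min_eq_right hp, min_eq_right (by exact_mod_cast hp), ENat.toNat_natCast]
  simp only [hmin, arrivalWeight]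
  have hbase : ∀ j, K + 1 ≤ j → HasSum (fun n => (r : ℂ) / (r + (ℓ : ℝ) + o) *
      ((ℓ : ℝ) / (r + (ℓ : ℝ) + o)) ^ n * f (min (j + n) (K + 1) - 1)) (f j) := by
    intro j hj
    have hgeo : ‖((ℓ : ℝ) : ℂ) / (r + (ℓ : ℝ) + o)‖ < 1 := by
      rw [norm_div, div_lt_one hden0, Complex.norm_real, Real.norm_of_nonneg ℓ.coe_nonneg]
      exact (lt_add_of_pos_left _ hr).trans_le hnorm
    have hsum := ((hasSum_geometric_of_norm_lt_one hgeo).mul_left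
      ((r : ℂ) / (r + (ℓ : ℝ) + o))).mul_right (f K)
    have hval : (r : ℂ) / (r + (ℓ : ℝ) + o) * (1 - (ℓ : ℝ) / (r + (ℓ : ℝ) + o))⁻¹ * f K = f j := by
      rw [hconst j hj, one_sub_div hden, inv_div]
      have : (r + (ℓ : ℝ) + o - (ℓ : ℝ) : ℂ) = r + o := by ring
      rw [this, div_mul_div_cancel₀ hden, div_mul_eq_mul_div, div_eq_iff hro, ← hlast, mul_comm]
    rw [hval] at hsum
    refine (congrArg (fun f => HasSum f _) (funext fun n => ?_)).mp hsum
    rw [min_eq_right (by omega), Nat.add_sub_cancel]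
  rcases le_total (K + 1) j with hK | hK
  · exact hbase j hK
  · obtain ⟨d, hd⟩ := Nat.exists_eq_add_of_le hK
    clear hK
    -- Downward induction on `j`: apart from its first term, the sum for `j` is a multiple of the sum
    -- for `j + 1`.
    induction d generalizing j with
    | zero => exact hbase _ hd.le
    | succ d ih =>
      have hs := (ih (Nat.succ_ne_zero j) (by omega)).mul_left (((ℓ : ℝ) : ℂ) / (r + (ℓ : ℝ) + o))
      have hs' : HasSum (fun n => (r : ℂ) / (r + (ℓ : ℝ) + o) *
          ((ℓ : ℝ) / (r + (ℓ : ℝ) + o)) ^ (n + 1) * f (min (j + (n + 1)) (K + 1) - 1))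
          (((ℓ : ℝ) : ℂ) / (r + (ℓ : ℝ) + o) * f (j + 1)) := by
        refine (congrArg (fun f => HasSum f _) (funext fun n => ?_)).mp hs
        rw [pow_succ, show j + 1 + n = j + (n + 1) by ring]
        ring
      have := (hasSum_nat_add_iff (f := fun n => (r : ℂ) / (r + (ℓ : ℝ) + o) *
          ((ℓ : ℝ) / (r + (ℓ : ℝ) + o)) ^ n * f (min (j + n) (K + 1) - 1)) 1).1 hs'
      refine (congrArg (fun a => HasSum _ a) ?_).mp this
      rw [Finset.sum_range_one, pow_zero, mul_one, add_zero, min_eq_left (by omega)]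
      have hl := hlin j (Nat.one_le_iff_ne_zero.2 hj) (by omega)
      field_simp
      linear_combination -hl

theorem mulVec_matD_add_matU (K : ℕ) (f : ℕ → ℂ) (p : Fin (K + 1)) :
    ((matD lam b i z K + matU b i K).mulVec fun c => f (c + 1)) p =
      (-(if p = Fin.last K then 0 else ((lam i : ℝ) : ℂ)) -
          (otherRate lam i z + 1 / ((b i : ℝ) : ℂ))) * f (p + 1) +
        (if (p : ℕ) < K then ((lam i : ℝ) : ℂ) * f (p + 2) else 0) +
        (if 0 < (p : ℕ) then 1 / ((b i : ℝ) : ℂ) * f p else 0) := by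
  have hsplit : ∀ c : Fin (K + 1), (matD lam b i z K + matU b i K) p c * f (c + 1) =
      (if c = p then (-(if p = Fin.last K then 0 else ((lam i : ℝ) : ℂ)) -
          (otherRate lam i z + 1 / ((b i : ℝ) : ℂ))) * f (p + 1) else 0) +
        (if (c : ℕ) = p + 1 then ((lam i : ℝ) : ℂ) * f (p + 2) else 0) +
        (if (p : ℕ) = c + 1 then 1 / ((b i : ℝ) : ℂ) * f p else 0) := by
    intro c
    simp only [Matrix.add_apply, matD, matU, Matrix.of_apply, add_mul, ite_mul, zero_mul]
    congr 1
    · by_cases hcp : c = p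
      · subst hcp
        simp
      · by_cases hc : (c : ℕ) = p + 1
        · simp [hcp, hc]
        · simp [hcp, hc]
    · split_ifs with hpc
      · rw [hpc]
      · rfl
  rw [Matrix.mulVec, dotProduct, Finset.sum_congr rfl fun c _ => hsplit c,
    Finset.sum_add_distrib, Finset.sum_add_distrib]
  congr 1
  · congr 1
    · simp
    · rw [Fin.sum_univ_eq_sum_range (fun c : ℕ => if c = (p : ℕ) + 1 then
        ((lam i : ℝ) : ℂ) * f (p + 2) else 0) (K + 1), Finset.sum_ite_eq']
      simp
  · rcases Nat.eq_zero_or_pos (p : ℕ) with hp | hp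
    · simp [hp]
    · obtain ⟨q, hq⟩ := Nat.exists_eq_succ_of_ne_zero hp.ne'
      rw [Fin.sum_univ_eq_sum_range (fun c : ℕ => if (p : ℕ) = c + 1 then
        1 / ((b i : ℝ) : ℂ) * f p else 0) (K + 1), if_pos hp]
      simp only [hq, Nat.succ_eq_add_one, Nat.add_right_cancel_iff]
      rw [Finset.sum_ite_eq, if_pos]
      rw [Finset.mem_range]
      omega

/-- The extension to all states of a vector indexed by the states `1, …, K + 1`, with value `c` at
the state `0`. -/
def extendVec (K : ℕ) (c : ℂ) (g : Fin (K + 1) → ℂ) (j : ℕ) : ℂ :=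
  if j = 0 then c else g ⟨min (j - 1) K, by omega⟩

theorem extendVec_succ (K : ℕ) (c : ℂ) (g : Fin (K + 1) → ℂ) (p : Fin (K + 1)) :
    extendVec K c g (p + 1) = g p := by
  rw [extendVec, if_neg (Nat.succ_ne_zero _)]
  congr 1
  ext
  simp only [Nat.add_sub_cancel]
  omega

/-- A solution of the linear system with matrix `D + U` solves the one-step equations. -/
theorem hasSum_extendVec (hb : 0 < b i) (hz : ∀ m, ‖z m‖ ≤ 1) {K : ℕ} {c : ℂ}
    {g : Fin (K + 1) → ℂ}
    (hg : (matD lam b i z K + matU b i K).mulVec g = Pi.single 0 (-(1 / ((b i : ℝ) : ℂ)) * c))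
    {j : ℕ} (hj : j ≠ 0) :
    HasSum (fun n => arrivalWeight (1 / (b i : ℝ)) (lam i) (otherRate lam i z) n *
      extendVec K c g ((min ((j + n : ℕ) : ℕ∞) ((K + 1 : ℕ) : ℕ∞)).toNat - 1))
      (extendVec K c g j) := by
  have hr : 0 < 1 / (b i : ℝ) := one_div_pos.2 (NNReal.coe_pos.2 hb)
  have hrow : ∀ p : Fin (K + 1), _ := fun p =>
    (mulVec_matD_add_matU (lam := lam) (b := b) (i := i) (z := z) K (extendVec K c g) p).symm.trans
      ((congrArg (fun g' => (matD lam b i z K + matU b i K).mulVec g' p)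
        (funext (extendVec_succ K c g))).trans (congrFun hg p))
  have hzero : extendVec K c g 0 = c := rfl
  have hsingle : ∀ p : Fin (K + 1), (Pi.single 0 (-(1 / ((b i : ℝ) : ℂ)) * c) :
      Fin (K + 1) → ℂ) p = (if 0 < (p : ℕ) then 1 / ((b i : ℝ) : ℂ) * extendVec K c g p else 0) -
        1 / ((b i : ℝ) : ℂ) * extendVec K c g p := by
    intro p
    rcases Nat.eq_zero_or_pos (p : ℕ) with hp | hp
    · have : p = 0 := Fin.ext hp
      subst this
      simp [hzero]
    · rw [if_pos hp, sub_self, Pi.single_eq_of_ne]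
      rintro rfl
      simp at hp
  refine hasSum_truncated hr (lam i) (otherRate_re_nonneg hz) ?_ ?_ ?_ hj
  · intro j hj
    rw [extendVec, extendVec, if_neg (by omega), if_neg (by omega)]
    congr 2
    omega
  · intro j hj hjK
    obtain ⟨q, rfl⟩ := Nat.exists_eq_succ_of_ne_zero (Nat.one_le_iff_ne_zero.1 hj)
    have h := hrow ⟨q, by omega⟩
    rw [hsingle] at h
    have hne : (⟨q, by omega⟩ : Fin (K + 1)) ≠ Fin.last K := by
      rw [Ne, Fin.ext_iff, Fin.val_last]; simp only; omega
    simp only [hne, if_false, if_pos (show q < K by omega)] at h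
    simp only [Nat.succ_eq_add_one, Nat.add_sub_cancel]
    push_cast
    linear_combination -h
  · have h := hrow (Fin.last K)
    rw [hsingle] at h
    simp only [Fin.val_last, if_true, lt_self_iff_false, if_false] at h
    push_cast
    linear_combination -h

/-! ### Geometric drift -/

theorem arrivalLaw_real_eq {r : ℝ} (hr : 0 < r) (n : ℕ) :
    (arrivalLaw lam (serviceLaw r)).real {x | x i = n} =
      r / (r + lam i) * (lam i / (r + lam i)) ^ n := by
  have := isProbabilityMeasure_serviceLaw hr
  have hmeas : MeasurableSet {x : Fin M → ℕ | x i = n} := (Set.to_countable _).measurableSet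
  have hs := hasSum_arrivals_service (lam := lam) (i := i) (z := fun _ => 1) hr (by simp)
    (g := fun j => if j = n then 1 else 0) (c := 1) (fun j => by split_ifs <;> simp)
  have h0 : otherRate lam i (fun _ => 1) = 0 := by simp [otherRate]
  rw [h0] at hs
  have hval := hs.unique (hasSum_single n fun j hj => by simp [hj])
  have hind : (fun x : Fin M → ℕ => (∏ m ∈ Finset.univ.erase i, (1 : ℂ) ^ x m) *
      (if x i = n then (1 : ℂ) else 0)) = {x : Fin M → ℕ | x i = n}.indicator fun _ => (1 : ℂ) := by
    ext x
    simp [Set.indicator_apply]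
  rw [hind, integral_indicator_const _ hmeas] at hval
  simp only [if_true, mul_one, add_zero, Complex.real_smul] at hval
  exact_mod_cast hval

theorem lintegral_pow_arrivalLaw {r : ℝ} (hr : 0 < r) (hlam : 0 < lam i) :
    ∫⁻ x, ENNReal.ofReal ((lam i + r) / (2 * lam i)) ^ x i ∂arrivalLaw lam (serviceLaw r) =
      ENNReal.ofReal (2 * r / (lam i + r)) := by
  have := isProbabilityMeasure_serviceLaw hr
  have hlam' : (0 : ℝ) < lam i := NNReal.coe_pos.2 hlam
  have hmap : ∀ n, ((arrivalLaw lam (serviceLaw r)).map fun x => x i) {n} =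
      ENNReal.ofReal (r / (r + lam i) * (lam i / (r + lam i)) ^ n) := fun n => by
    rw [Measure.map_apply (measurable_pi_apply i) (measurableSet_singleton n),
      ← arrivalLaw_real_eq (lam := lam) (i := i) hr n, ofReal_measureReal]
    rfl
  calc ∫⁻ x, ENNReal.ofReal ((lam i + r) / (2 * lam i)) ^ x i ∂arrivalLaw lam (serviceLaw r)
      = ∫⁻ n, ENNReal.ofReal ((lam i + r) / (2 * lam i)) ^ n
          ∂(arrivalLaw lam (serviceLaw r)).map fun x => x i :=
        (lintegral_map (measurable_of_countable _) (measurable_pi_apply i)).symm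
    _ = ∑' n : ℕ, ENNReal.ofReal (r / (r + lam i) * (1 / 2) ^ n) := by
        rw [lintegral_countable']
        refine tsum_congr fun n => ?_
        rw [hmap, ← ENNReal.ofReal_pow (by positivity), ← ENNReal.ofReal_mul (by positivity)]
        congr 1
        rw [mul_left_comm, ← mul_pow]
        congr 2
        field_simp
        ring
    _ = ENNReal.ofReal (2 * r / (lam i + r)) := by
        rw [← ENNReal.ofReal_tsum_of_nonneg (fun n => by positivity)
          (summable_geometric_two.mul_left _), tsum_mul_left, tsum_geometric_two]
        congr 1
        rw [add_comm r]
        ring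

theorem lintegral_step_pow {r : ℝ} (hr : 0 < r) (hlam : 0 < lam i) {w : Fin M → ℕ} (hw : w i ≠ 0) :
    ∫⁻ x, ENNReal.ofReal ((lam i + r) / (2 * lam i)) ^ step ⊤ i w x i
        ∂arrivalLaw lam (serviceLaw r) ≤
      ENNReal.ofReal (4 * lam i * r / (lam i + r) ^ 2) *
        ENNReal.ofReal ((lam i + r) / (2 * lam i)) ^ w i := by
  have hlam' : (0 : ℝ) < lam i := NNReal.coe_pos.2 hlam
  obtain ⟨j, hj⟩ := Nat.exists_eq_succ_of_ne_zero hw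
  have hstep : ∀ x : Fin M → ℕ, step ⊤ i w x i = j + x i := fun x => by
    rw [step, if_pos rfl, min_top_right, ENat.toNat_natCast]
    omega
  simp_rw [hstep, pow_add]
  rw [lintegral_const_mul _ (measurable_of_countable _), lintegral_pow_arrivalLaw hr hlam, hj,
    pow_succ _ j, mul_left_comm, ← ENNReal.ofReal_mul (by positivity)]
  refine le_of_eq ?_
  congr 2
  field_simp
  ring

end Harmonic

/-! ### Visits driven by the input of the system -/

section InputVisit

variable {M : ℕ} [NeZero M] {Ω : Type*} [MeasurableSpace Ω] {P : Measure Ω}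
  {lam b : Fin M → ℝ≥0} {C : Fin M → Measure ℝ≥0} {first : Fin M} {N0 : Ω → Fin M → ℕ}
  {A : Fin M → ℝ≥0 → Ω → ℕ} {B : ℕ → ℕ → Ω → ℝ≥0} {S : ℕ → Ω → ℝ≥0}

theorem IsInput.map_service (h : IsInput P lam b C first N0 A B S) (v n : ℕ) :
    P.map (B v n) = serviceLaw (1 / (b (queueOf first v) : ℝ)) :=
  map_eq_serviceLaw (h.measurable_service v n) (h.law_service v n)

variable {used : Set DurationIndex} {v : ℕ} {τ : Ω → ℝ≥0} {ξ : Ω → Fin M → ℕ} {E : Set Ω}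

/-- An exhaustive visit to an unlimited queue ends almost surely. -/
theorem IsInput.ae_visit_ends (h : IsInput P lam b C first N0 A B S) (hlam : ∀ m, 0 < lam m)
    (hb : ∀ m, 0 < b m) (hstable : ∀ m, lam m * b m < 1) (hτ : Measurable τ) (hξ : Measurable ξ)
    (hv : ∀ n, (.inl (v, n) : DurationIndex) ∉ used)
    (hren : ∀ w, Renews P lam A (duration B S) used τ (E ∩ {ω | ξ ω = w})) (hE : MeasurableSet E) :
    ∀ᵐ ω ∂P, ω ∈ E →
      ∃ n, visitWalk ⊤ A B v (queueOf first v) τ ξ n ω (queueOf first v) = 0 := by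
  have : IsProbabilityMeasure P := h.indep.isProbabilityMeasure
  set i := queueOf first v with hi
  have hbi : (0 : ℝ) < b i := NNReal.coe_pos.2 (hb i)
  have hr : 0 < 1 / (b i : ℝ) := one_div_pos.2 hbi
  have hl : (0 : ℝ) < lam i := NNReal.coe_pos.2 (hlam i)
  have hlr : (lam i : ℝ) < 1 / (b i : ℝ) := by
    rw [lt_div_iff₀ hbi]
    exact_mod_cast hstable i
  -- The drift condition holds for `w ↦ y ^ wᵢ` with `y = (λ + r) / (2 λ) > 1`.
  refine ae_exists_visitWalk_eq_zero h.poisson h.measurable_service h.measurable_switchover hτ hξ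
    hv hren (C := serviceLaw (1 / (b i : ℝ))) (h.map_service v)
    (f := fun w => ENNReal.ofReal ((lam i + 1 / (b i : ℝ)) / (2 * lam i)) ^ w i)
    (θ := ENNReal.ofReal (4 * lam i * (1 / (b i : ℝ)) / (lam i + 1 / (b i : ℝ)) ^ 2)) ?_ ?_ ?_
    (fun w hw => lintegral_step_pow hr (hlam i) hw) hE
  · rw [ENNReal.ofReal_lt_one, div_lt_one (by positivity)]
    nlinarith [sq_pos_of_pos (sub_pos.2 hlr)]
  · intro w
    refine one_le_pow₀ ?_
    rw [ENNReal.one_le_ofReal, le_div_iff₀ (by positivity)]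
    linarith
  · exact fun w => ENNReal.pow_ne_top ENNReal.ofReal_ne_top

/-- The mean of a harmonic function is preserved by an exhaustive visit. -/
theorem IsInput.integral_markedFun_visitEnd (h : IsInput P lam b C first N0 A B S)
    (hb : ∀ m, 0 < b m) (hτ : Measurable τ) (hξ : Measurable ξ)
    (hv : ∀ n, (.inl (v, n) : DurationIndex) ∉ used)
    (hren : ∀ w, Renews P lam A (duration B S) used τ (E ∩ {ω | ξ ω = w}))
    {cap : ℕ∞} {i : Fin M} (hi : queueOf first v = i)
    (hend : ∀ᵐ ω ∂P, ∃ n, visitWalk cap A B v i τ ξ n ω i = 0)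
    {z : Fin M → ℂ} (hz : ∀ m, ‖z m‖ ≤ 1) {f : ℕ → ℂ} {c : ℝ} (hc : ∀ j, ‖f j‖ ≤ c)
    (hf : ∀ j, j ≠ 0 → HasSum (fun n => arrivalWeight (1 / (b i : ℝ)) (lam i)
      (otherRate lam i z) n * f ((min ((j + n : ℕ) : ℕ∞) cap).toNat - 1)) (f j)) :
    ∫ ω in E, markedFun z i f
        (visitEnd ⊤ cap (fun m t => A m t ω) i (τ ω) (fun l => B v l ω) (ξ ω)).2 ∂P =
      ∫ ω in E, markedFun z i f (ξ ω) ∂P := by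
  have : IsProbabilityMeasure P := h.indep.isProbabilityMeasure
  subst hi
  exact integral_visitEnd h.poisson h.measurable_service h.measurable_switchover hτ hξ hv hren
    (h.map_service v) (norm_markedFun_le hz hc)
    (fun w hw => integral_step_markedFun (one_div_pos.2 (NNReal.coe_pos.2 (hb _))) hz hc hf hw) hend

omit [NeZero M] [MeasurableSpace Ω] in
/-- At the end of an exhaustive visit, queue `i` is empty. -/
theorem visitEnd_top_apply_eq_zero {cap : ℕ∞} {i : Fin M} {ω : Ω}
    (hω : ∃ n, visitWalk cap A B v i τ ξ n ω i = 0) :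
    (visitEnd ⊤ cap (fun m t => A m t ω) i (τ ω) (fun l => B v l ω) (ξ ω)).2 i = 0 := by
  obtain ⟨n, hn⟩ := hω
  rw [visitEnd_top_eq_stoppedWalk hn]
  exact hn

omit [NeZero M] [MeasurableSpace Ω] in
theorem visitWalk_truncated_ends {cap : ℕ∞} {i : Fin M} {ω : Ω}
    (hω : ∃ n, visitWalk ⊤ A B v i τ ξ n ω i = 0) :
    ∃ n, visitWalk cap A B v i τ ξ n ω i = 0 := by
  obtain ⟨n, hn⟩ := exists_stoppedWalk_eq_zero_iff.1 hω
  exact exists_stoppedWalk_eq_zero_iff.2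
    ⟨n, Nat.eq_zero_of_le_zero ((lengthsAfter_le_top n).trans_eq hn)⟩

end InputVisit

/-! ### A single visit -/

section SingleVisit

variable {M : ℕ} [NeZero M] {Ω : Type*} [MeasurableSpace Ω] {P : Measure Ω}
  {lam b : Fin M → ℝ≥0} {C : Fin M → Measure ℝ≥0} {first : Fin M} {N0 : Ω → Fin M → ℕ}
  {A : Fin M → ℝ≥0 → Ω → ℕ} {B : ℕ → ℕ → Ω → ℝ≥0} {S : ℕ → Ω → ℝ≥0}

theorem queueOf_zero (first : Fin M) : queueOf first 0 = first := by
  have : Fin.ofNat M 0 = 0 := rfl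
  rw [queueOf, this, add_zero]

/-- A visit may be started at time `0` with fixed queue lengths `x`: the initial queue lengths of the
system play no role. -/
theorem IsInput.renews_zero (h : IsInput P lam b C first N0 A B S) (x w : Fin M → ℕ) :
    Renews P lam A (duration B S) ∅ (fun _ => 0) (Set.univ ∩ {_ω | x = w}) := by
  by_cases hxw : x = w
  · have hset : (Set.univ ∩ {_ω | x = w} : Set Ω) = ⋃ y, {ω | N0 ω = y} := by
      ext ω; simp [hxw]
    rw [hset]
    refine Renews.iUnion h.poisson h.measurable_duration measurable_const h.renews_initial ?_
    exact fun y y' hyy' => Set.disjoint_left.2 fun ω hy hy' => hyy' (hy.symm.trans hy')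
  · have hset : (Set.univ ∩ {_ω | x = w} : Set Ω) = ∅ := by
      ext ω; simp [hxw]
    rw [hset]
    exact Renews.empty measurable_const

theorem IsInput.ae_first_visit_ends (h : IsInput P lam b C first N0 A B S)
    (hlam : ∀ m, 0 < lam m) (hb : ∀ m, 0 < b m) (hstable : ∀ m, lam m * b m < 1)
    (x : Fin M → ℕ) (cap : ℕ∞) :
    ∀ᵐ ω ∂P, ∃ n, visitWalk cap A B 0 first (fun _ => 0) (fun _ => x) n ω first = 0 := by
  have := h.ae_visit_ends hlam hb hstable (v := 0) (used := ∅) measurable_const measurable_const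
    (fun _ => Set.notMem_empty _) (h.renews_zero x) MeasurableSet.univ
  rw [queueOf_zero] at this
  filter_upwards [this] with ω hω
  exact visitWalk_truncated_ends (hω (Set.mem_univ ω))

theorem IsInput.integral_markedFun_first_visit (h : IsInput P lam b C first N0 A B S)
    (hlam : ∀ m, 0 < lam m) (hb : ∀ m, 0 < b m) (hstable : ∀ m, lam m * b m < 1)
    {cap : ℕ∞} {z : Fin M → ℂ} (hz : ∀ m, ‖z m‖ ≤ 1) {f : ℕ → ℂ} {c : ℝ} (hc : ∀ j, ‖f j‖ ≤ c)
    (hf : ∀ j, j ≠ 0 → HasSum (fun n => arrivalWeight (1 / (b first : ℝ)) (lam first)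
      (otherRate lam first z) n * f ((min ((j + n : ℕ) : ℕ∞) cap).toNat - 1)) (f j))
    (x : Fin M → ℕ) :
    ∫ ω, markedFun z first f
        (visitEnd ⊤ cap (fun m t => A m t ω) first 0 (fun n => B 0 n ω) x).2 ∂P =
      markedFun z first f x := by
  have : IsProbabilityMeasure P := h.indep.isProbabilityMeasure
  have := h.integral_markedFun_visitEnd hb (v := 0) (used := ∅) measurable_const measurable_const
    (fun _ => Set.notMem_empty _) (h.renews_zero x) (queueOf_zero first)
    (h.ae_first_visit_ends hlam hb hstable x cap) hz hc hf
  simpa using this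

theorem IsInput.visitPgf_top (h : IsInput P lam b C first N0 A B S)
    (hlam : ∀ m, 0 < lam m) (hb : ∀ m, 0 < b m) (hstable : ∀ m, lam m * b m < 1)
    {cap : ℕ∞} {z : Fin M → ℂ} (hz : ∀ m, ‖z m‖ ≤ 1) {f : ℕ → ℂ} {c : ℝ} (hc : ∀ j, ‖f j‖ ≤ c)
    (h0 : f 0 = 1)
    (hf : ∀ j, j ≠ 0 → HasSum (fun n => arrivalWeight (1 / (b first : ℝ)) (lam first)
      (otherRate lam first z) n * f ((min ((j + n : ℕ) : ℕ∞) cap).toNat - 1)) (f j))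
    (x : Fin M → ℕ) :
    visitPgf P ⊤ cap first A B x z =
      f (x first) * ∏ m ∈ Finset.univ.erase first, z m ^ x m := by
  refine Eq.trans (integral_congr_ae ?_)
    (h.integral_markedFun_first_visit hlam hb hstable hz hc hf x)
  filter_upwards [h.ae_first_visit_ends hlam hb hstable x cap] with ω hω
  exact (markedFun_of_zero h0 (visitEnd_top_apply_eq_zero hω)).symm

theorem norm_extendVec_le (K : ℕ) (c : ℂ) (g : Fin (K + 1) → ℂ) (j : ℕ) :
    ‖extendVec K c g j‖ ≤ ‖c‖ + ∑ p, ‖g p‖ := by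
  rw [extendVec]
  split_ifs
  · exact le_add_of_nonneg_right (Finset.sum_nonneg fun _ _ => norm_nonneg _)
  · exact (Finset.single_le_sum (f := fun p => ‖g p‖) (fun _ _ => norm_nonneg _)
      (Finset.mem_univ _)).trans (le_add_of_nonneg_left (norm_nonneg _))

/-- The matrix `D + U` is invertible: a vector in its kernel extends by `0` to a harmonic function,
whose value is its mean `0` at the end of a visit. -/
theorem IsInput.isUnit_det (h : IsInput P lam b C first N0 A B S)
    (hlam : ∀ m, 0 < lam m) (hb : ∀ m, 0 < b m) (hstable : ∀ m, lam m * b m < 1)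
    {z : Fin M → ℂ} (hz : ∀ m, ‖z m‖ ≤ 1) (K : ℕ) :
    IsUnit (matD lam b first z K + matU b first K).det := by
  rw [isUnit_iff_ne_zero]
  intro hdet
  obtain ⟨g, hg0, hg⟩ := Matrix.exists_mulVec_eq_zero_iff.2 hdet
  refine hg0 (funext fun p => ?_)
  have key := h.integral_markedFun_first_visit hlam hb hstable hz (norm_extendVec_le K 0 g)
    (cap := ((K + 1 : ℕ) : ℕ∞))
    (fun j hj => hasSum_extendVec (hb first) hz (by rw [hg]; simp) hj)
    (Pi.single first (p + 1))
  have hx : markedFun z first (extendVec K 0 g) (Pi.single first ((p : ℕ) + 1)) = g p := by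
    rw [markedFun, Pi.single_eq_same, extendVec_succ, Finset.prod_eq_one, mul_one]
    intro m hm
    rw [Pi.single_eq_of_ne (Finset.ne_of_mem_erase hm), pow_zero]
  rw [hx] at key
  rw [← key, Pi.zero_apply]
  refine integral_eq_zero_of_ae ?_
  filter_upwards [h.ae_first_visit_ends hlam hb hstable (Pi.single first (p + 1))
    ((K + 1 : ℕ) : ℕ∞)] with ω hω
  rw [markedFun, visitEnd_top_apply_eq_zero hω]
  simp [extendVec]

theorem IsInput.visitPgf_truncated (h : IsInput P lam b C first N0 A B S)
    (hlam : ∀ m, 0 < lam m) (hb : ∀ m, 0 < b m) (hstable : ∀ m, lam m * b m < 1)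
    {z : Fin M → ℂ} (hz : ∀ m, ‖z m‖ ≤ 1) (K : ℕ) (j : Fin (K + 1)) (x : Fin M → ℕ)
    (hx : x first = j + 1) :
    visitPgf P ⊤ (K + 1 : ℕ) first A B x z =
      -(1 / ((b first : ℝ) : ℂ)) * (∏ m ∈ Finset.univ.erase first, z m ^ x m) *
        (matD lam b first z K + matU b first K)⁻¹ j 0 := by
  have hunit := h.isUnit_det hlam hb hstable hz K
  let g : Fin (K + 1) → ℂ := (matD lam b first z K + matU b first K)⁻¹.mulVec
    (Pi.single 0 (-(1 / ((b first : ℝ) : ℂ)) * 1))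
  have hg : (matD lam b first z K + matU b first K).mulVec g =
      Pi.single 0 (-(1 / ((b first : ℝ) : ℂ)) * 1) := by
    rw [Matrix.mulVec_mulVec, Matrix.mul_nonsing_inv _ hunit, Matrix.one_mulVec]
  rw [h.visitPgf_top hlam hb hstable hz (norm_extendVec_le K 1 g) rfl
    (fun j hj => hasSum_extendVec (hb first) hz hg hj) x, hx, extendVec_succ]
  simp only [g, Matrix.mulVec_single, Pi.smul_apply, Matrix.col_apply, MulOpposite.smul_eq_mul_unop,
    MulOpposite.unop_op]
  ring

theorem IsInput.visitPgf_unlimited (h : IsInput P lam b C first N0 A B S)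
    (hlam : ∀ m, 0 < lam m) (hb : ∀ m, 0 < b m) (hstable : ∀ m, lam m * b m < 1)
    {z : Fin M → ℂ} (hz : ∀ m, ‖z m‖ ≤ 1) {y : ℂ} (hy : IsSmallRoot lam b first z y)
    (x : Fin M → ℕ) :
    visitPgf P ⊤ ⊤ first A B x z = y ^ x first * ∏ m ∈ Finset.univ.erase first, z m ^ x m :=
  h.visitPgf_top hlam hb hstable hz (f := fun j => y ^ j) (c := 1)
    (fun j => by rw [norm_pow]; exact pow_le_one₀ (norm_nonneg _) hy.1) (pow_zero y)
    (fun _ hj => hy.hasSum_pow (hb first) hz hj) x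

theorem IsInput.measurable_visitEnd_const (h : IsInput P lam b C first N0 A B S) (k cap : ℕ∞)
    (x : Fin M → ℕ) :
    Measurable fun ω => visitEnd k cap (fun m t => A m t ω) first 0 (fun n => B 0 n ω) x :=
  measurable_visitEnd h.poisson measurable_const (h.measurable_service 0) measurable_const k cap
    first

omit [NeZero M] in
/-- Bounded convergence for generating functions. -/
theorem tendsto_integral_monomial [IsFiniteMeasure P] {f : ℕ → Ω → Fin M → ℕ} {g : Ω → Fin M → ℕ}
    {z : Fin M → ℂ} (hz : ∀ m, ‖z m‖ ≤ 1) (hf : ∀ n, Measurable (f n))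
    (hfg : ∀ᵐ ω ∂P, ∀ᶠ n in atTop, f n ω = g ω) :
    Tendsto (fun n => ∫ ω, monomial z (f n ω) ∂P) atTop (𝓝 (∫ ω, monomial z (g ω) ∂P)) := by
  refine tendsto_integral_of_dominated_convergence (fun _ => 1) (fun n => ?_) (integrable_const 1)
    (fun n => ae_of_all _ fun ω => norm_monomial_le hz _) ?_
  · exact ((measurable_of_countable (monomial z)).comp (hf n)).aestronglyMeasurable
  · filter_upwards [hfg] with ω hω
    exact tendsto_const_nhds.congr' (hω.mono fun n hn => by simp only [hn])

theorem IsInput.tendsto_visitPgf_limited (h : IsInput P lam b C first N0 A B S)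
    (hlam : ∀ m, 0 < lam m) (hb : ∀ m, 0 < b m) (hstable : ∀ m, lam m * b m < 1)
    {z : Fin M → ℂ} (hz : ∀ m, ‖z m‖ ≤ 1) (cap : ℕ∞) (x : Fin M → ℕ) :
    Tendsto (fun k : ℕ => visitPgf P k cap first A B x z) atTop
      (𝓝 (visitPgf P ⊤ cap first A B x z)) := by
  have : IsProbabilityMeasure P := h.indep.isProbabilityMeasure
  refine tendsto_integral_monomial hz
    (fun k => measurable_snd.comp (h.measurable_visitEnd_const k cap x)) ?_
  filter_upwards [h.ae_first_visit_ends hlam hb hstable x cap] with ω hω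
  obtain ⟨n, hn⟩ := exists_stoppedWalk_eq_zero_iff.1 hω
  filter_upwards [eventually_ge_atTop n] with k hk
  rw [visitEnd_eq_visitEnd_top hn hk]

theorem IsInput.tendsto_visitPgf_capacity (h : IsInput P lam b C first N0 A B S)
    (hlam : ∀ m, 0 < lam m) (hb : ∀ m, 0 < b m) (hstable : ∀ m, lam m * b m < 1)
    {z : Fin M → ℂ} (hz : ∀ m, ‖z m‖ ≤ 1) (x : Fin M → ℕ) :
    Tendsto (fun K : ℕ => visitPgf P ⊤ (K + 1 : ℕ) first A B x z) atTop
      (𝓝 (visitPgf P ⊤ ⊤ first A B x z)) := by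
  have : IsProbabilityMeasure P := h.indep.isProbabilityMeasure
  refine tendsto_integral_monomial hz
    (fun K => measurable_snd.comp (h.measurable_visitEnd_const ⊤ _ x)) ?_
  filter_upwards [h.ae_first_visit_ends hlam hb hstable x ⊤] with ω hω
  exact (eventually_visitEnd_eq (exists_stoppedWalk_eq_zero_iff.1 hω)).mono fun K hK => by rw [hK]

end SingleVisit

/-! ### The successive visits -/

section System

variable {M : ℕ} [NeZero M] {Ω : Type*} [MeasurableSpace Ω] {P : Measure Ω}
  {lam b : Fin M → ℝ≥0} {C : Fin M → Measure ℝ≥0} {first : Fin M} {N0 : Ω → Fin M → ℕ}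
  {A : Fin M → ℝ≥0 → Ω → ℕ} {B : ℕ → ℕ → Ω → ℝ≥0} {S : ℕ → Ω → ℝ≥0}

/-- The durations of the visits before the `v`-th one and of the switch-overs that follow them. -/
def usedBefore (v : ℕ) : Set DurationIndex := {d | ∃ u < v, (∃ l, d = .inl (u, l)) ∨ d = .inr u}

/-- The start of a visit in the exhaustive system. -/
abbrev startTime (first : Fin M) (N0 : Ω → Fin M → ℕ) (A : Fin M → ℝ≥0 → Ω → ℕ)
    (B : ℕ → ℕ → Ω → ℝ≥0) (S : ℕ → Ω → ℝ≥0) (v : ℕ) (ω : Ω) : ℝ≥0 :=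
  (visitBegin ⊤ first (fun m t => A m t ω) (fun u n => B u n ω) (fun u => S u ω) (N0 ω) v).1

/-- The end of a visit in the exhaustive system. -/
abbrev endTime (first : Fin M) (N0 : Ω → Fin M → ℕ) (A : Fin M → ℝ≥0 → Ω → ℕ)
    (B : ℕ → ℕ → Ω → ℝ≥0) (S : ℕ → Ω → ℝ≥0) (v : ℕ) (ω : Ω) : ℝ≥0 :=
  (visitEnd ⊤ ⊤ (fun m t => A m t ω) (queueOf first v) (startTime first N0 A B S v ω)
    (fun l => B v l ω) (lengthsBegin ⊤ first N0 A B S v ω)).1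

theorem notMem_usedBefore (v n : ℕ) : (.inl (v, n) : DurationIndex) ∉ usedBefore v := by
  rintro ⟨u, hu, ⟨l, hl⟩ | hl⟩
  · simp only [Sum.inl.injEq, Prod.mk.injEq] at hl
    omega
  · simp at hl

theorem notMem_usedBefore_union (v : ℕ) :
    (.inr v : DurationIndex) ∉ usedBefore v ∪ {d | ∃ l, d = .inl (v, l)} := by
  rintro (⟨u, hu, ⟨l, hl⟩ | hl⟩ | ⟨l, hl⟩)
  · simp at hl
  · simp only [Sum.inr.injEq] at hl
    omega
  · simp at hl

theorem insert_usedBefore (v : ℕ) :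
    insert (.inr v) (usedBefore v ∪ {d | ∃ l, d = .inl (v, l)}) ⊆ usedBefore (v + 1) := by
  rintro d (rfl | ⟨u, hu, hd⟩ | hd)
  · exact ⟨v, v.lt_succ_self, Or.inr rfl⟩
  · exact ⟨u, hu.trans v.lt_succ_self, hd⟩
  · exact ⟨v, v.lt_succ_self, Or.inl hd⟩

omit [MeasurableSpace Ω] in
theorem lengthsBegin_succ (v : ℕ) (ω : Ω) :
    lengthsBegin ⊤ first N0 A B S (v + 1) ω = lengthsEnd ⊤ first N0 A B S v ω +
      arrivalsAfter A (endTime first N0 A B S v) (duration B S (.inr v)) ω := rfl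

theorem IsInput.measurable_startTime (h : IsInput P lam b C first N0 A B S) (v : ℕ) :
    Measurable (startTime first N0 A B S v) :=
  measurable_fst.comp (h.measurable_visitBegin ⊤ v)

theorem IsInput.measurable_endTime (h : IsInput P lam b C first N0 A B S) (v : ℕ) :
    Measurable (endTime first N0 A B S v) :=
  measurable_fst.comp (measurable_visitEnd h.poisson (h.measurable_startTime v)
    (h.measurable_service v) (h.measurable_lengthsBegin ⊤ v) ⊤ ⊤ (queueOf first v))

omit [NeZero M] in
theorem pgf_map {f : Ω → Fin M → ℕ} (hf : Measurable f) (z : Fin M → ℂ) :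
    pgf (P.map f) z = ∫ ω, monomial z (f ω) ∂P :=
  integral_map hf.aemeasurable (measurable_of_countable _).aestronglyMeasurable

theorem queueOf_succ_sub_one (first : Fin M) (u : ℕ) :
    queueOf first (u + 1) - 1 = queueOf first u := by
  have : Fin.ofNat M (u + 1) = Fin.ofNat M u + 1 := by
    ext; simp [Fin.add_def, Nat.add_mod]
  rw [queueOf, queueOf, this, ← add_assoc, add_sub_cancel_right]

omit [NeZero M] in
theorem norm_update_le {z : Fin M → ℂ} (hz : ∀ m, ‖z m‖ ≤ 1) (i : Fin M) {y : ℂ} (hy : ‖y‖ ≤ 1)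
    (m : Fin M) : ‖Function.update z i y m‖ ≤ 1 := by
  rcases eq_or_ne m i with rfl | hm
  · rwa [Function.update_self]
  · rw [Function.update_of_ne hm]; exact hz m

section Stable

variable (h : IsInput P lam b C first N0 A B S) (hlam : ∀ m, 0 < lam m) (hb : ∀ m, 0 < b m)
  (hstable : ∀ m, lam m * b m < 1)
include h hlam hb hstable

theorem IsInput.ae_visit_ends_of_renews (v : ℕ)
    (hren : ∀ w, Renews P lam A (duration B S) (usedBefore v) (startTime first N0 A B S v)
      (Set.univ ∩ {ω | lengthsBegin ⊤ first N0 A B S v ω = w})) :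
    ∀ᵐ ω ∂P, ∃ n, visitWalk ⊤ A B v (queueOf first v) (startTime first N0 A B S v)
      (lengthsBegin ⊤ first N0 A B S v) n ω (queueOf first v) = 0 := by
  filter_upwards [h.ae_visit_ends hlam hb hstable (h.measurable_startTime v)
    (h.measurable_lengthsBegin ⊤ v) (notMem_usedBefore v) hren MeasurableSet.univ] with ω hω
  exact hω (Set.mem_univ ω)

theorem IsInput.renews_endTime_of_renews (v : ℕ)
    (hren : ∀ w, Renews P lam A (duration B S) (usedBefore v) (startTime first N0 A B S v)
      (Set.univ ∩ {ω | lengthsBegin ⊤ first N0 A B S v ω = w})) (w : Fin M → ℕ) :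
    Renews P lam A (duration B S) (usedBefore v ∪ {d | ∃ l, d = .inl (v, l)})
      (endTime first N0 A B S v) (Set.univ ∩ {ω | lengthsEnd ⊤ first N0 A B S v ω = w}) :=
  renews_visitEnd h.poisson h.measurable_service h.measurable_switchover (h.measurable_startTime v)
    (notMem_usedBefore v) hren (h.measurable_lengthsBegin ⊤ v)
    ((h.ae_visit_ends_of_renews hlam hb hstable v hren).mono fun _ hω _ => hω)
    MeasurableSet.univ w

/-- The arrivals start afresh at the beginning of every visit. -/
theorem IsInput.renews_startTime (v : ℕ) (w : Fin M → ℕ) :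
    Renews P lam A (duration B S) (usedBefore v) (startTime first N0 A B S v)
      (Set.univ ∩ {ω | lengthsBegin ⊤ first N0 A B S v ω = w}) := by
  induction v generalizing w with
  | zero =>
    rw [Set.univ_inter]
    exact (h.renews_initial w).mono (Set.empty_subset _)
  | succ v ih =>
    have := Renews.next_of_mem h.poisson h.measurable_duration (h.measurable_endTime v)
      (h.renews_endTime_of_renews hlam hb hstable v ih) (notMem_usedBefore_union v)
      {p | p.1 + p.2 = w}
    exact this.mono (insert_usedBefore v)

/-- The arrivals start afresh at the end of every visit. -/
theorem IsInput.renews_endTime (v : ℕ) (w : Fin M → ℕ) :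
    Renews P lam A (duration B S) (usedBefore v ∪ {d | ∃ l, d = .inl (v, l)})
      (endTime first N0 A B S v) (Set.univ ∩ {ω | lengthsEnd ⊤ first N0 A B S v ω = w}) :=
  h.renews_endTime_of_renews hlam hb hstable v (h.renews_startTime hlam hb hstable v) w

theorem IsInput.ae_every_visit_ends (v : ℕ) :
    ∀ᵐ ω ∂P, ∃ n, visitWalk ⊤ A B v (queueOf first v) (startTime first N0 A B S v)
      (lengthsBegin ⊤ first N0 A B S v) n ω (queueOf first v) = 0 :=
  h.ae_visit_ends_of_renews hlam hb hstable v (h.renews_startTime hlam hb hstable v)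

/-- The effect of an exhaustive visit on the generating function, on an event determined by the
queue lengths at its beginning. -/
theorem IsInput.setIntegral_lengthsEnd {z : Fin M → ℂ} (hz : ∀ m, ‖z m‖ ≤ 1) {v : ℕ} {i : Fin M}
    (hi : queueOf first v = i) {y : ℂ} (hy : IsSmallRoot lam b i z y) (F : Set (Fin M → ℕ)) :
    ∫ ω in lengthsBegin ⊤ first N0 A B S v ⁻¹' F,
        monomial z (lengthsEnd ⊤ first N0 A B S v ω) ∂P =
      ∫ ω in lengthsBegin ⊤ first N0 A B S v ⁻¹' F,
        monomial (Function.update z i y) (lengthsBegin ⊤ first N0 A B S v ω) ∂P := by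
  have hren : ∀ w, Renews P lam A (duration B S) (usedBefore v) (startTime first N0 A B S v)
      (lengthsBegin ⊤ first N0 A B S v ⁻¹' F ∩ {ω | lengthsBegin ⊤ first N0 A B S v ω = w}) := by
    intro w
    by_cases hw : w ∈ F
    · have hset : lengthsBegin ⊤ first N0 A B S v ⁻¹' F ∩
          {ω | lengthsBegin ⊤ first N0 A B S v ω = w} =
          Set.univ ∩ {ω | lengthsBegin ⊤ first N0 A B S v ω = w} := by
        ext ω
        simp only [Set.mem_inter_iff, Set.mem_preimage, Set.mem_univ, true_and, Set.mem_ofPred_eq,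
          and_iff_right_iff_imp]
        rintro rfl
        exact hw
      rw [hset]
      exact h.renews_startTime hlam hb hstable v w
    · have hset : lengthsBegin ⊤ first N0 A B S v ⁻¹' F ∩
          {ω | lengthsBegin ⊤ first N0 A B S v ω = w} = ∅ :=
        Set.eq_empty_iff_forall_notMem.2 fun ω hω => hw (hω.2 ▸ hω.1)
      rw [hset]
      exact Renews.empty (h.measurable_startTime v)
  have hend := h.ae_every_visit_ends hlam hb hstable v
  subst hi
  have key := h.integral_markedFun_visitEnd hb (h.measurable_startTime v)
    (h.measurable_lengthsBegin ⊤ v) (notMem_usedBefore v) hren rfl hend hz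
    (f := fun j => y ^ j) (c := 1)
    (fun j => by rw [norm_pow]; exact pow_le_one₀ (norm_nonneg _) hy.1)
    (fun _ hj => hy.hasSum_pow (hb _) hz hj)
  simp only [markedFun_pow y (lengthsBegin ⊤ first N0 A B S v _)] at key
  rw [← key]
  refine integral_congr_ae ?_
  filter_upwards [ae_restrict_of_ae hend] with ω hω
  exact (markedFun_of_zero (pow_zero y) (visitEnd_top_apply_eq_zero hω)).symm

theorem IsInput.pgf_lengthsEnd {z : Fin M → ℂ} (hz : ∀ m, ‖z m‖ ≤ 1) {v : ℕ} {i : Fin M}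
    (hi : queueOf first v = i) {y : ℂ} (hy : IsSmallRoot lam b i z y) :
    pgf (P.map (lengthsEnd ⊤ first N0 A B S v)) z =
      pgf (P.map (lengthsBegin ⊤ first N0 A B S v)) (Function.update z i y) := by
  rw [pgf_map (h.measurable_lengthsEnd ⊤ v), pgf_map (h.measurable_lengthsBegin ⊤ v)]
  simpa using h.setIntegral_lengthsEnd hlam hb hstable hz hi hy Set.univ

theorem IsInput.integral_cond_lengthsEnd {z : Fin M → ℂ} (hz : ∀ m, ‖z m‖ ≤ 1) {v : ℕ}
    {i : Fin M} (hi : queueOf first v = i) {y : ℂ} (hy : IsSmallRoot lam b i z y) (x : Fin M → ℕ)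
    (hx : P {ω | lengthsBegin ⊤ first N0 A B S v ω = x} ≠ 0) :
    ∫ ω, monomial z (lengthsEnd ⊤ first N0 A B S v ω)
        ∂(P[|{ω | lengthsBegin ⊤ first N0 A B S v ω = x}]) =
      y ^ x i * ∏ m ∈ Finset.univ.erase i, z m ^ x m := by
  have : IsProbabilityMeasure P := h.indep.isProbabilityMeasure
  have hmeas : MeasurableSet {ω | lengthsBegin ⊤ first N0 A B S v ω = x} :=
    h.measurable_lengthsBegin ⊤ v (measurableSet_singleton x)
  have hF := h.setIntegral_lengthsEnd hlam hb hstable hz hi hy {x}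
  have hconst : ∫ ω in lengthsBegin ⊤ first N0 A B S v ⁻¹' {x},
      monomial (Function.update z i y) (lengthsBegin ⊤ first N0 A B S v ω) ∂P =
      P.real {ω | lengthsBegin ⊤ first N0 A B S v ω = x} • monomial (Function.update z i y) x := by
    rw [← setIntegral_const]
    exact setIntegral_congr_fun hmeas fun ω hω => by
      rw [show lengthsBegin ⊤ first N0 A B S v ω = x from hω]
  rw [hconst] at hF
  rw [ProbabilityTheory.cond, integral_smul_measure]
  change (P {ω | lengthsBegin ⊤ first N0 A B S v ω = x})⁻¹.toReal •
    ∫ ω in lengthsBegin ⊤ first N0 A B S v ⁻¹' {x}, _ ∂P = _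
  rw [hF, ENNReal.toReal_inv, smul_smul, ← measureReal_def, inv_mul_cancel₀, one_smul,
    ← markedFun_pow, markedFun]
  exact (measureReal_ne_zero_iff (measure_ne_top _ _)).2 hx

/-- The effect of a switch-over on the generating function. -/
theorem IsInput.pgf_lengthsBegin_succ {z : Fin M → ℂ} (hz : ∀ m, ‖z m‖ ≤ 1) (u : ℕ) :
    pgf (P.map (lengthsBegin ⊤ first N0 A B S (u + 1))) z =
      pgf (P.map (lengthsEnd ⊤ first N0 A B S u)) z *
        arrivalsPgf lam (C (queueOf first u)) z := by
  have : IsProbabilityMeasure P := h.indep.isProbabilityMeasure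
  have hC : IsProbabilityMeasure (C (queueOf first u)) := by
    rw [← h.law_switchover u]
    exact Measure.isProbabilityMeasure_map (h.measurable_switchover u).aemeasurable
  have hX : Measurable (arrivalsAfter A (endTime first N0 A B S u) (S u)) :=
    measurable_arrivalsAfter h.poisson (h.measurable_endTime u) (h.measurable_switchover u)
  have hprod := Renews.map_prod_next h.poisson h.measurable_duration (h.measurable_endTime u)
    (h.measurable_lengthsEnd ⊤ u) (h.renews_endTime hlam hb hstable u) (notMem_usedBefore_union u)
  rw [Measure.restrict_univ, show duration B S (.inr u) = S u from rfl, h.law_switchover u] at hprod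
  rw [pgf_map (h.measurable_lengthsBegin ⊤ (u + 1)), ← pgf_arrivalLaw lam _ hz, pgf, pgf,
    ← integral_prod_mul, ← hprod, integral_map ((h.measurable_lengthsEnd ⊤ u).prodMk hX).aemeasurable
      (measurable_of_countable _).aestronglyMeasurable]
  refine integral_congr_ae (ae_of_all _ fun ω => ?_)
  simp only [lengthsBegin_succ, monomial, Pi.add_apply, pow_add, Finset.prod_mul_distrib]
  rfl

theorem IsInput.pgf_lengthsEnd_succ {z : Fin M → ℂ} (hz : ∀ m, ‖z m‖ ≤ 1) {u : ℕ} {i : Fin M}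
    (hi : queueOf first (u + 1) = i) {y : ℂ} (hy : IsSmallRoot lam b i z y) :
    pgf (P.map (lengthsEnd ⊤ first N0 A B S (u + 1))) z =
      pgf (P.map (lengthsEnd ⊤ first N0 A B S u)) (Function.update z i y) *
        arrivalsPgf lam (C (i - 1)) (Function.update z i y) := by
  rw [h.pgf_lengthsEnd hlam hb hstable hz hi hy,
    h.pgf_lengthsBegin_succ hlam hb hstable (norm_update_le hz i hy.1), ← hi,
    queueOf_succ_sub_one]

/-- Almost surely, the first `v + 1` visits of the `k`-limited system coincide with those of the
exhaustive system for all large `k`. -/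
theorem IsInput.tendsto_pgf_lengthsEnd {z : Fin M → ℂ} (hz : ∀ m, ‖z m‖ ≤ 1) (v : ℕ) :
    Tendsto (fun k : ℕ => pgf (P.map (lengthsEnd k first N0 A B S v)) z) atTop
      (𝓝 (pgf (P.map (lengthsEnd ⊤ first N0 A B S v)) z)) := by
  have : IsProbabilityMeasure P := h.indep.isProbabilityMeasure
  simp only [pgf_map (h.measurable_lengthsEnd _ v)]
  refine tendsto_integral_monomial hz (fun k => h.measurable_lengthsEnd k v) ?_
  filter_upwards [ae_all_iff.2 (h.ae_every_visit_ends hlam hb hstable)] with ω hω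
  have hvisit : ∀ u, ∀ᶠ k : ℕ in atTop,
      visitEnd k ⊤ (fun m t => A m t ω) (queueOf first u) (startTime first N0 A B S u ω)
        (fun l => B u l ω) (lengthsBegin ⊤ first N0 A B S u ω) =
      visitEnd ⊤ ⊤ (fun m t => A m t ω) (queueOf first u) (startTime first N0 A B S u ω)
        (fun l => B u l ω) (lengthsBegin ⊤ first N0 A B S u ω) := by
    intro u
    obtain ⟨n, hn⟩ := exists_stoppedWalk_eq_zero_iff.1 (hω u)
    filter_upwards [eventually_ge_atTop n] with k hk
    exact visitEnd_eq_visitEnd_top hn hk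
  have hbegin : ∀ u, ∀ᶠ k : ℕ in atTop,
      visitBegin k first (fun m t => A m t ω) (fun u n => B u n ω) (fun u => S u ω) (N0 ω) u =
      visitBegin ⊤ first (fun m t => A m t ω) (fun u n => B u n ω) (fun u => S u ω) (N0 ω) u := by
    intro u
    induction u with
    | zero => exact Eventually.of_forall fun _ => rfl
    | succ u ih =>
      filter_upwards [ih, hvisit u] with k hk hk'
      simp only [visitBegin, hk]
      rw [lengthsBegin] at hk'
      rw [hk']
  filter_upwards [hbegin v, hvisit v] with k hk hk'
  simp only [lengthsEnd, hk]
  exact congrArg Prod.snd hk'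

end Stable
end System

/-! ### The steady state -/

section SteadyState

variable {M : ℕ}

theorem hasSum_measureReal_singleton {α : Type*} [MeasurableSpace α] [MeasurableSingletonClass α]
    [Countable α] (μ : Measure α) [IsProbabilityMeasure μ] :
    HasSum (fun x => μ.real {x}) 1 := by
  have hint : Integrable (fun _ : α => (1 : ℝ)) μ := integrable_const 1
  have hsum := hasSum_integral_measure (μ := fun x : α => μ {x} • Measure.dirac x)
    (f := fun _ : α => (1 : ℝ)) (by rwa [Measure.sum_smul_dirac])
  simpa [Measure.sum_smul_dirac, measureReal_def] using hsum

theorem hasSum_pgf (μ : Measure (Fin M → ℕ)) [IsProbabilityMeasure μ] {z : Fin M → ℂ}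
    (hz : ∀ m, ‖z m‖ ≤ 1) : HasSum (fun x => μ.real {x} • monomial z x) (pgf μ z) := by
  have hint : Integrable (monomial z) μ :=
    Integrable.of_bound (measurable_of_countable _).aestronglyMeasurable 1
      (ae_of_all _ fun x => norm_monomial_le hz x)
  have hsum := hasSum_integral_measure (μ := fun x : Fin M → ℕ => μ {x} • Measure.dirac x)
    (f := monomial z) (by rwa [Measure.sum_smul_dirac])
  simpa [Measure.sum_smul_dirac, measureReal_def, pgf] using hsum

/-- Scheffé's lemma for laws on a countable space: pointwise convergence of the masses implies
convergence in total variation. -/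
theorem tendsto_tsum_abs_sub_measureReal {α ι : Type*} [MeasurableSpace α]
    [MeasurableSingletonClass α] [Countable α] {l : Filter ι} {μ : ι → Measure α} {ν : Measure α}
    [∀ v, IsProbabilityMeasure (μ v)] [IsProbabilityMeasure ν]
    (hμ : ∀ x, Tendsto (fun v => (μ v).real {x}) l (𝓝 (ν.real {x}))) :
    Tendsto (fun v => ∑' x, |(μ v).real {x} - ν.real {x}|) l (𝓝 0) := by
  have hν := hasSum_measureReal_singleton ν
  have hpos : Tendsto (fun v => ∑' x, max (ν.real {x} - (μ v).real {x}) 0) l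
      (𝓝 (∑' _ : α, (0 : ℝ))) := by
    refine tendsto_tsum_of_dominated_convergence hν.summable (fun x => ?_)
      (Eventually.of_forall fun v x => ?_)
    · simpa using ((tendsto_const_nhds (x := ν.real {x})).sub (hμ x)).max
        (tendsto_const_nhds (x := (0 : ℝ)))
    · rw [Real.norm_of_nonneg (le_max_right _ _)]
      exact max_le (sub_le_self _ measureReal_nonneg) measureReal_nonneg
  rw [tsum_zero] at hpos
  have htwo := hpos.const_mul 2
  rw [mul_zero] at htwo
  refine htwo.congr fun v => ?_
  -- As both laws have mass `1`, the positive and the negative parts of `ν - μ v` have equal sums.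
  have hμv := hasSum_measureReal_singleton (μ v)
  have hle : ∀ x, max (ν.real {x} - (μ v).real {x}) 0 ≤ ν.real {x} := fun x =>
    max_le (sub_le_self _ measureReal_nonneg) measureReal_nonneg
  have hsm : Summable fun x => max (ν.real {x} - (μ v).real {x}) 0 :=
    Summable.of_nonneg_of_le (fun _ => le_max_right _ _) hle hν.summable
  have hs := (hsm.hasSum.mul_left 2).add (hμv.sub hν)
  rw [sub_self, add_zero] at hs
  rw [← hs.tsum_eq]
  refine tsum_congr fun x => ?_
  rcases le_total (ν.real {x}) ((μ v).real {x}) with hx | hx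
  · rw [max_eq_right (sub_nonpos.2 hx), abs_of_nonneg (sub_nonneg.2 hx)]
    ring
  · rw [max_eq_left (sub_nonneg.2 hx), abs_of_nonpos (sub_nonpos.2 hx)]
    ring

theorem tendsto_pgf {ι : Type*} {l : Filter ι} {μ : ι → Measure (Fin M → ℕ)}
    {ν : Measure (Fin M → ℕ)} [∀ v, IsProbabilityMeasure (μ v)] [IsProbabilityMeasure ν]
    (hμ : ∀ x, Tendsto (fun v => (μ v).real {x}) l (𝓝 (ν.real {x}))) {z : Fin M → ℂ}
    (hz : ∀ m, ‖z m‖ ≤ 1) : Tendsto (fun v => pgf (μ v) z) l (𝓝 (pgf ν z)) := by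
  rw [tendsto_iff_norm_sub_tendsto_zero]
  refine squeeze_zero (fun _ => norm_nonneg _) (fun v => ?_) (tendsto_tsum_abs_sub_measureReal hμ)
  have hsum : Summable fun x => |(μ v).real {x} - ν.real {x}| :=
    ((hasSum_measureReal_singleton (μ v)).sub (hasSum_measureReal_singleton ν)).summable.abs
  rw [← ((hasSum_pgf (μ v) hz).sub (hasSum_pgf ν hz)).tsum_eq]
  refine tsum_of_norm_bounded hsum.hasSum fun x => ?_
  rw [← sub_smul, norm_smul, Real.norm_eq_abs]
  exact mul_le_of_le_one_right (abs_nonneg _) (norm_monomial_le hz x)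

variable [NeZero M] {Ω : Type*} [MeasurableSpace Ω] {P : Measure Ω}
  {lam b : Fin M → ℝ≥0} {C : Fin M → Measure ℝ≥0} {first : Fin M} {N0 : Ω → Fin M → ℕ}
  {A : Fin M → ℝ≥0 → Ω → ℕ} {B : ℕ → ℕ → Ω → ℝ≥0} {S : ℕ → Ω → ℝ≥0}

/-- The visits to queue `i`. -/
abbrev visitsTo (first i : Fin M) : Filter ℕ := atTop ⊓ 𝓟 {v | queueOf first v = i}

theorem visitsTo_neBot (first i : Fin M) : (visitsTo first i).NeBot := by
  rw [← frequently_mem_iff_neBot, frequently_atTop]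
  refine fun n => ⟨(i - first : Fin M) + n * M, ?_, ?_⟩
  · exact (Nat.le_mul_of_pos_right n (NeZero.pos M)).trans (Nat.le_add_left _ _)
  · have : Fin.ofNat M ((i - first : Fin M) + n * M) = i - first := by
      ext; simp [Nat.mod_eq_of_lt]
    show queueOf first _ = i
    rw [queueOf, this, add_sub_cancel]

theorem tendsto_succ_visitsTo (first i : Fin M) :
    Tendsto (fun u => u + 1) (visitsTo first (i - 1)) (visitsTo first i) := by
  refine tendsto_inf.2 ⟨(tendsto_add_atTop_nat 1).mono_left inf_le_left, tendsto_principal.2 ?_⟩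
  filter_upwards [mem_inf_of_right (mem_principal_self _)] with u hu
  have hu : queueOf first (u + 1) - 1 = i - 1 := (queueOf_succ_sub_one first u).trans hu
  exact sub_left_injective hu

theorem eventually_visitsTo (first i : Fin M) : ∀ᶠ v in visitsTo first i, queueOf first v = i :=
  mem_inf_of_right (mem_principal_self _)

theorem IsSteadyState.tendsto_pgf_begin (h : IsInput P lam b C first N0 A B S)
    {β γ : Fin M → Measure (Fin M → ℕ)} (hs : IsSteadyState P first N0 A B S β γ) (i : Fin M)
    {z : Fin M → ℂ} (hz : ∀ m, ‖z m‖ ≤ 1) :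
    Tendsto (fun v => pgf (P.map (lengthsBegin ⊤ first N0 A B S v)) z) (visitsTo first i)
      (𝓝 (pgf (β i) z)) := by
  have : IsProbabilityMeasure P := h.indep.isProbabilityMeasure
  have := hs.prob_begin i
  have (v : ℕ) : IsProbabilityMeasure (P.map (lengthsBegin ⊤ first N0 A B S v)) :=
    Measure.isProbabilityMeasure_map (h.measurable_lengthsBegin ⊤ v).aemeasurable
  refine tendsto_pgf (fun x => (hs.tendsto_begin i x).congr fun v => ?_) hz
  exact (map_measureReal_apply (h.measurable_lengthsBegin ⊤ v) (measurableSet_singleton x)).symm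

theorem IsSteadyState.tendsto_pgf_end (h : IsInput P lam b C first N0 A B S)
    {β γ : Fin M → Measure (Fin M → ℕ)} (hs : IsSteadyState P first N0 A B S β γ) (i : Fin M)
    {z : Fin M → ℂ} (hz : ∀ m, ‖z m‖ ≤ 1) :
    Tendsto (fun v => pgf (P.map (lengthsEnd ⊤ first N0 A B S v)) z) (visitsTo first i)
      (𝓝 (pgf (γ i) z)) := by
  have : IsProbabilityMeasure P := h.indep.isProbabilityMeasure
  have := hs.prob_end i
  have (v : ℕ) : IsProbabilityMeasure (P.map (lengthsEnd ⊤ first N0 A B S v)) :=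
    Measure.isProbabilityMeasure_map (h.measurable_lengthsEnd ⊤ v).aemeasurable
  refine tendsto_pgf (fun x => (hs.tendsto_end i x).congr fun v => ?_) hz
  exact (map_measureReal_apply (h.measurable_lengthsEnd ⊤ v) (measurableSet_singleton x)).symm

theorem IsSteadyState.pgf_end_eq (h : IsInput P lam b C first N0 A B S)
    (hlam : ∀ m, 0 < lam m) (hb : ∀ m, 0 < b m) (hstable : ∀ m, lam m * b m < 1)
    {β γ : Fin M → Measure (Fin M → ℕ)} (hs : IsSteadyState P first N0 A B S β γ)
    {z : Fin M → ℂ} (hz : ∀ m, ‖z m‖ ≤ 1) {i : Fin M} {y : ℂ} (hy : IsSmallRoot lam b i z y) :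
    pgf (γ i) z = pgf (β i) (Function.update z i y) := by
  have := visitsTo_neBot first i
  refine tendsto_nhds_unique_of_eventuallyEq (hs.tendsto_pgf_end h i hz)
    (hs.tendsto_pgf_begin h i (norm_update_le hz i hy.1)) ?_
  filter_upwards [eventually_visitsTo first i] with v hv
  exact h.pgf_lengthsEnd hlam hb hstable hz hv hy

theorem IsSteadyState.pgf_end_eq_mul (h : IsInput P lam b C first N0 A B S)
    (hlam : ∀ m, 0 < lam m) (hb : ∀ m, 0 < b m) (hstable : ∀ m, lam m * b m < 1)
    {β γ : Fin M → Measure (Fin M → ℕ)} (hs : IsSteadyState P first N0 A B S β γ)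
    {z : Fin M → ℂ} (hz : ∀ m, ‖z m‖ ≤ 1) {i : Fin M} {y : ℂ} (hy : IsSmallRoot lam b i z y) :
    pgf (γ i) z = pgf (γ (i - 1)) (Function.update z i y) *
      arrivalsPgf lam (C (i - 1)) (Function.update z i y) := by
  have := visitsTo_neBot first (i - 1)
  refine tendsto_nhds_unique_of_eventuallyEq
    ((hs.tendsto_pgf_end h i hz).comp (tendsto_succ_visitsTo first i))
    ((hs.tendsto_pgf_end h (i - 1) (norm_update_le hz i hy.1)).mul_const _) ?_
  filter_upwards [(tendsto_succ_visitsTo first i).eventually (eventually_visitsTo first i)]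
    with u hu
  exact h.pgf_lengthsEnd_succ hlam hb hstable hz hu hy

end SteadyState

end Polling

end

theorem mainTheorem4 {M : ℕ} [NeZero M] {Ω : Type*} [MeasurableSpace Ω]
    (P : Measure Ω) [IsProbabilityMeasure P]
    (lam b : Fin M → ℝ≥0) (C : Fin M → Measure ℝ≥0)
    (hlam : ∀ m, 0 < lam m) (hb : ∀ m, 0 < b m) (hstable : ∀ m, lam m * b m < 1)
    (first : Fin M) (N0 : Ω → Fin M → ℕ) (A : Fin M → ℝ≥0 → Ω → ℕ)
    (B : ℕ → ℕ → Ω → ℝ≥0) (S : ℕ → Ω → ℝ≥0)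
    (hinput : Polling.IsInput P lam b C first N0 A B S) :
    -- the root is well defined
    (∀ (i : Fin M) (z : Fin M → ℂ), (∀ m, ‖z m‖ ≤ 1) → ∃! y, Polling.IsSmallRoot lam b i z y) ∧
    -- under the exhaustive discipline, every visit ends almost surely
    (∀ v, ∀ᵐ ω ∂P, ∃ n,
      Polling.lengthsAfter ⊤ (fun m t => A m t ω) (Polling.queueOf first v)
        (Polling.visitBegin ⊤ first (fun m t => A m t ω) (fun u l => B u l ω)
          (fun u => S u ω) (N0 ω) v).1 (fun l => B v l ω)
        (Polling.lengthsBegin ⊤ first N0 A B S v ω) n (Polling.queueOf first v) = 0) ∧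
    -- one visit to a queue of capacity `L - 1 = K + 1`, starting with `x`: limit `k → ∞`
    (∀ (z : Fin M → ℂ), (∀ m, ‖z m‖ ≤ 1) →
      ∀ (K : ℕ) (j : Fin (K + 1)) (x : Fin M → ℕ), x first = j + 1 →
        IsUnit (Polling.matD lam b first z K + Polling.matU b first K).det ∧
        Tendsto (fun k : ℕ => Polling.visitPgf P k (K + 1 : ℕ) first A B x z) atTop
          (𝓝 (Polling.visitPgf P ⊤ (K + 1 : ℕ) first A B x z)) ∧
        Polling.visitPgf P ⊤ (K + 1 : ℕ) first A B x z =
          -(1 / ((b first : ℝ) : ℂ)) * (∏ m ∈ Finset.univ.erase first, z m ^ x m) *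
            (Polling.matD lam b first z K + Polling.matU b first K)⁻¹ j 0) ∧
    -- one visit starting with `x`: limit `L → ∞`, and limit `k → ∞` for the unlimited queue
    (∀ (z : Fin M → ℂ), (∀ m, ‖z m‖ ≤ 1) → ∀ y, Polling.IsSmallRoot lam b first z y →
      ∀ x : Fin M → ℕ,
        Tendsto (fun K : ℕ => Polling.visitPgf P ⊤ (K + 1 : ℕ) first A B x z) atTop
          (𝓝 (y ^ x first * ∏ m ∈ Finset.univ.erase first, z m ^ x m)) ∧
        Polling.visitPgf P ⊤ ⊤ first A B x z =
          y ^ x first * ∏ m ∈ Finset.univ.erase first, z m ^ x m ∧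
        Tendsto (fun k : ℕ => Polling.visitPgf P k ⊤ first A B x z) atTop
          (𝓝 (y ^ x first * ∏ m ∈ Finset.univ.erase first, z m ^ x m))) ∧
    -- every visit of the polling system
    (∀ (z : Fin M → ℂ), (∀ m, ‖z m‖ ≤ 1) → ∀ (v : ℕ) (i : Fin M), Polling.queueOf first v = i →
      ∀ y, Polling.IsSmallRoot lam b i z y →
        -- conditionally on the queue lengths at the beginning of the visit
        (∀ x : Fin M → ℕ, P {ω | Polling.lengthsBegin ⊤ first N0 A B S v ω = x} ≠ 0 →
          ∫ ω, Polling.monomial z (Polling.lengthsEnd ⊤ first N0 A B S v ω)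
              ∂(P[|{ω | Polling.lengthsBegin ⊤ first N0 A B S v ω = x}]) =
            y ^ x i * ∏ m ∈ Finset.univ.erase i, z m ^ x m) ∧
        -- the `k`-limited system converges to the exhaustive one
        Tendsto (fun k : ℕ => Polling.pgf (P.map (Polling.lengthsEnd k first N0 A B S v)) z) atTop
          (𝓝 (Polling.pgf (P.map (Polling.lengthsEnd ⊤ first N0 A B S v)) z)) ∧
        -- unconditionally
        Polling.pgf (P.map (Polling.lengthsEnd ⊤ first N0 A B S v)) z =
          Polling.pgf (P.map (Polling.lengthsBegin ⊤ first N0 A B S v)) (Function.update z i y) ∧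
        -- including the switch-over time
        (∀ u, v = u + 1 →
          Polling.pgf (P.map (Polling.lengthsEnd ⊤ first N0 A B S v)) z =
            Polling.pgf (P.map (Polling.lengthsEnd ⊤ first N0 A B S u)) (Function.update z i y) *
              Polling.arrivalsPgf lam (C (i - 1)) (Function.update z i y))) ∧
    -- the steady state
    (∀ β γ : Fin M → Measure (Fin M → ℕ), Polling.IsSteadyState P first N0 A B S β γ →
      ∀ (z : Fin M → ℂ), (∀ m, ‖z m‖ ≤ 1) → ∀ (i : Fin M) (y : ℂ),
        Polling.IsSmallRoot lam b i z y →
          Polling.pgf (γ i) z = Polling.pgf (β i) (Function.update z i y) ∧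
          Polling.pgf (γ i) z =
            Polling.pgf (γ (i - 1)) (Function.update z i y) *
              Polling.arrivalsPgf lam (C (i - 1)) (Function.update z i y)) := by
  refine ⟨fun i z hz => Polling.existsUnique_isSmallRoot (hlam i) (hb i) (hstable i) hz, ?_, ?_,
    ?_, ?_, ?_⟩
  · intro v
    filter_upwards [hinput.ae_every_visit_ends hlam hb hstable v] with ω hω
    exact Polling.exists_stoppedWalk_eq_zero_iff.1 hω
  · intro z hz K j x hx
    exact ⟨hinput.isUnit_det hlam hb hstable hz K,
      hinput.tendsto_visitPgf_limited hlam hb hstable hz _ x,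
      hinput.visitPgf_truncated hlam hb hstable hz K j x hx⟩
  · intro z hz y hy x
    have hpgf := hinput.visitPgf_unlimited hlam hb hstable hz hy x
    exact ⟨hpgf ▸ hinput.tendsto_visitPgf_capacity hlam hb hstable hz x, hpgf,
      hpgf ▸ hinput.tendsto_visitPgf_limited hlam hb hstable hz ⊤ x⟩
  · intro z hz v i hi y hy
    refine ⟨fun x hx => hinput.integral_cond_lengthsEnd hlam hb hstable hz hi hy x hx,
      hinput.tendsto_pgf_lengthsEnd hlam hb hstable hz v,
      hinput.pgf_lengthsEnd hlam hb hstable hz hi hy, ?_⟩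
    rintro u rfl
    exact hinput.pgf_lengthsEnd_succ hlam hb hstable hz hi hy
  · intro β γ hs z hz i y hy
    exact ⟨hs.pgf_end_eq hinput hlam hb hstable hz hy,
      hs.pgf_end_eq_mul hinput hlam hb hstable hz hy⟩
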